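/- Let $\mathbb{K}$ be a field of characteristic zero, $R$ a commutative unital $\mathbb{K}$-algebra and $t,T,u$ commuting variables. Put $\mathfrak{h}=\mathbb{K}\langle x,y\rangle$, $\mathfrak{h}^1=\mathbb{K}+\mathfrak{h}y$, $\mathfrak{h}^0=\mathbb{K}+x\mathfrak{h}y$, $\mathfrak{h}_t=\mathbb{K}[t]\langle x,y\rangle$, $\mathfrak{h}_t^1=\mathbb{K}[t]+\mathfrak{h}_ty$, $\mathfrak{h}_t^0=\mathbb{K}[t]+x\mathfrak{h}_ty$, and $z_k=x^{k-1}y$ for $k\ge 1$. Let $\delta(1)=1$ and $\delta(w)=0$ for a word $w\ne 1$. **Products.** The $t$-shuffle product $\overset{t}{\sqcup\!\sqcup}$ on $\mathfrak{h}_t$ is $\mathbb{K}[t]$-bilinear with $1\overset{t}{\sqcup\!\sqcup}w=w\overset{t}{\sqcup\!\sqcup}1=w$ and, for letters $a,b$ and words $w_1,w_2$, $$aw_1\overset{t}{\sqcup\!\sqcup}bw_2=a(w_1\overset{t}{\sqcup\!\sqcup}bw_2)+b(aw_1\overset{t}{\sqcup\!\sqcup}w_2)-\delta(w_1)\rho(a)bw_2-\delta(w_2)\rho(b)aw_1,\qquad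 \rho(x)=0,\ \rho(y)=tx.$$ The $t$-stuffle product $\overset{t}{*}$ on $\mathfrak{h}^1_t$ is $\mathbb{K}[t]$-bilinear with $1\overset{t}{*}w=w\overset{t}{*}1=w$ and, for $k,l\ge1$ and words $w_1,w_2\in\mathfrak{h}_t^1$, $$z_kw_1\overset{t}{*}z_lw_2=z_k(w_1\overset{t}{*}z_lw_2)+z_l(z_kw_1\overset{t}{*}w_2)+(1-2t)z_{k+l}(w_1\overset{t}{*}w_2)+[1-\delta(w_1)\delta(w_2)](t^2-t)x^{k+l}(w_1\overset{t}{*}w_2).$$ For $t=0$ one obtains the usual products $\sqcup\!\sqcup $ on $\mathfrak{h}$ and $*$ on $\mathfrak{h}^1$. With respect to each of these products ($\sqcup\!\sqcup $ and $*$ on $\mathfrak{h}^1$, $\overset{t}{\sqcup\!\sqcup}$ and $\overset{t}{*}$ on $\mathfrak{h}_t^1$), $\mathfrak{h}^1$ (resp. $\mathfrak{h}_t^1$) is the polynomial algebra in $y$ over $\mathfrak{h}^0$ (resp. $\mathfrak{h}_t^0$). For $\bullet\in\{\overset{t}{\sqcup\!\sqcup},\overset{t}{*}\}$ define $\mathrm{reg}_\bullet:\mathfrak{h}_t^1\to\mathfrak{h}_t^0$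 by $\mathrm{reg}_\bullet\big(\sum_i w_i\bullet y^{\bullet i}\big)=w_0$ $(w_i\in\mathfrak{h}_t^0)$. **Operators.** Let $\sigma_t$ be the automorphism of the algebra $\mathfrak{h}_t$ with $\sigma_t(x)=x$, $\sigma_t(y)=tx+y$, and $S_t$ the $\mathbb{K}[t]$-linear map with $S_t(1)=1$, $S_t(wa)=\sigma_t(w)a$ for words $w$ and letters $a$; $S_{-t}=S_t^{-1}$ is given by the same formulas with $-t$ in place of $t$. For $n\ge 1$ let $\partial_n$ be the derivation with $\partial_n(x)=x(x+y)^{n-1}y=-\partial_n(y)$. For $m\ge0$ let $\sigma_m$ be the linear map on $\mathfrak{h}^1$ with $\sigma_m(1)=1$ and $$\sigma_m(z_{k_1}\cdots z_{k_n})=\sum_{\varepsilon_1+\cdots+\varepsilon_n=m,\ \varepsilon_i\ge0}z_{k_1+\varepsilon_1}\cdots z_{k_n+\varepsilon_n}.$$ Let $\tau$ be the antiautomorphism exchanging $x$ and $y$, and $\overline{\sigma_m}=\tau\circ\sigma_m\circ\tau$ on $\mathfrak{h}^0$. Extend these maps $\mathbb{K}[t]$-linearly and put, on $\mathfrak{h}_t^0$,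 $$\partial_n^t=S_{-t}\circ\partial_n\circ S_t,\qquad \sigma_m^t=S_{-t}\circ\sigma_m\circ S_t,\qquad \overline{\sigma_m}^{\,t}=S_{-t}\circ\overline{\sigma_m}\circ S_t .$$ **Maps.** Let $Z_R:\mathfrak{h}^0\to R$ be a $\mathbb{K}$-linear map with $Z_R(1)=1$ which satisfies the finite double shuffle relations $$Z_R(w_1 \sqcup\!\sqcup w_2)=Z_R(w_1)Z_R(w_2)=Z_R(w_1*w_2)\qquad(w_1,w_2\in\mathfrak{h}^0).$$ Let $Z_R^{\sqcup\!\sqcup}:(\mathfrak{h}^1,\sqcup\!\sqcup )\to R[T]$ and $Z_R^{*}:(\mathfrak{h}^1,*)\to R[T]$ be the unique $\mathbb{K}$-algebra homomorphisms which restrict to $Z_R$ on $\mathfrak{h}^0$ and map $y$ to $T$. Let $Z_R^t=Z_R\circ S_t:\mathfrak{h}_t^0\to R[t]$, where $Z_R$ is extended $\mathbb{K}[t]$-linearly, and let $Z_R^{t,\sqcup\!\sqcup}:(\mathfrak{h}_t^1,\overset{t}{\sqcup\!\sqcup})\to R[t,T]$ and $Z_R^{t,*}:(\mathfrak{h}_t^1,\overset{t}{*})\to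 R[t,T]$ be the unique $\mathbb{K}[t]$-algebra homomorphisms which restrict to $Z_R^t$ on $\mathfrak{h}_t^0$ and map $y$ to $T$. Let $\rho_R$ be the $R$-linear endomorphism of $R[T]$ with $$\rho_R(e^{Tu})=A_R(u)e^{Tu},\qquad A_R(u)=\exp\Big(\sum_{n\ge2}\frac{(-1)^n}{n}Z_R(z_n)u^n\Big),$$ extended $R[t]$-linearly to $R[t,T]$. Say that $Z_R$ satisfies the *extended double shuffle relations* if it satisfies the finite ones and $Z_R^{\sqcup\!\sqcup}(w)=\rho_R(Z_R^{*}(w))$ for all $w\in\mathfrak{h}^1$. **Theorem.** For every $Z_R$ as above the following are equivalent: - (0) $Z_R$ satisfies the extended double shuffle relations; - (1) $(Z_R^{t,\sqcup\!\sqcup}-\rho_R\circ Z_R^{t,*})(w_1)=0$ for all $w_1\in\mathfrak{h}_t^1$; - (2) $(Z_R^{t,\sqcup\!\sqcup}-\rho_R\circ Z_R^{t,*})(w_1)|_{T=0}=0$ for all $w_1\in\mathfrak{h}_t^1$; - (3) $Z_R^{t,\sqcup\!\sqcup}(w_1\overset{t}{\sqcup\!\sqcup}w_0-w_1\overset{t}{*}w_0)=0$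 for all $w_1\in\mathfrak{h}_t^1$, $w_0\in\mathfrak{h}_t^0$; - (3$'$) $Z_R^{t,*}(w_1\overset{t}{\sqcup\!\sqcup}w_0-w_1\overset{t}{*}w_0)=0$ for all $w_1\in\mathfrak{h}_t^1$, $w_0\in\mathfrak{h}_t^0$; - (4) $Z_R^t(\mathrm{reg}_{\overset{t}{\sqcup\!\sqcup}}(w_1\overset{t}{\sqcup\!\sqcup}w_0-w_1\overset{t}{*}w_0))=0$ for all $w_1\in\mathfrak{h}_t^1$, $w_0\in\mathfrak{h}_t^0$; - (4$'$) $Z_R^t(\mathrm{reg}_{\overset{t}{*}}(w_1\overset{t}{\sqcup\!\sqcup}w_0-w_1\overset{t}{*}w_0))=0$ for all $w_1\in\mathfrak{h}_t^1$, $w_0\in\mathfrak{h}_t^0$; - (5) $Z_R^t(\mathrm{reg}_{\overset{t}{\sqcup\!\sqcup}}(y^m\overset{t}{\sqcup\!\sqcup}w_0-y^m\overset{t}{*}w_0))=0$ for all $m\ge1$, $w_0\in\mathfrak{h}_t^0$; - (5$'$) $Z_R^t(\mathrm{reg}_{\overset{t}{*}}(y^m\overset{t}{\sqcup\!\sqcup}w_0-y^m\overset{t}{*}w_0))=0$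 for all $m\ge1$, $w_0\in\mathfrak{h}_t^0$; - (6) $Z_R^t(\partial_n^t(w_0))=0$ for all $n\ge1$, $w_0\in\mathfrak{h}_t^0$; - (7) $Z_R^t((\sigma_m^t-\overline{\sigma_m}^{\,t})(w_0))=0$ for all $m\ge0$, $w_0\in\mathfrak{h}_t^0$. -/

import Mathlib

open Polynomial

noncomputable section

namespace TMZV

/-- The alphabet `A = {x, y}`. -/
inductive Letter : Type
  | x
  | y

/-- The noncommutative polynomial algebra `k⟨x, y⟩`.  For `k = 𝕂` it is `𝔥`, and for `k = 𝕂[t]`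
it is `𝔥_t`. -/
abbrev H (k : Type*) [CommRing k] : Type _ := FreeAlgebra k Letter

section Words

variable (k : Type*) [CommRing k]

/-- A letter as an element of `k⟨x, y⟩`. -/
abbrev ltr (a : Letter) : H k := FreeAlgebra.ι k a

/-- A word as an element of `k⟨x, y⟩`. -/
def word (w : List Letter) : H k := (w.map (ltr k)).prod

@[simp] theorem word_nil : word k [] = 1 := rfl

@[simp] theorem word_cons (a : Letter) (w : List Letter) :
    word k (a :: w) = ltr k a * word k w := by simp [word]

theorem word_append (v w : List Letter) : word k (v ++ w) = word k v * word k w := by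
  simp [word]

/-- The words form a basis of `k⟨x, y⟩`, here indexed by lists of letters. -/
def wordBasis : Module.Basis (List Letter) k (H k) :=
  (FreeAlgebra.basisFreeMonoid k Letter).reindex FreeMonoid.toList

@[simp] theorem wordBasis_apply (w : List Letter) : wordBasis k w = word k w := by
  simp [wordBasis, FreeAlgebra.basisFreeMonoid, FreeAlgebra.equivMonoidAlgebraFreeMonoid,
    FreeMonoid.lift_apply, word]

variable {k}
variable {M : Type*} [AddCommGroup M] [Module k M]

/-- The linear map on `k⟨x, y⟩` with prescribed values on words. -/
def linExt (f : List Letter → M) : H k →ₗ[k] M := (wordBasis k).constr k f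

@[simp] theorem linExt_word (f : List Letter → M) (w : List Letter) :
    linExt f (word k w) = f w := by
  rw [← wordBasis_apply, linExt, Module.Basis.constr_basis]

/-- The bilinear map on `k⟨x, y⟩` with prescribed values on pairs of words. -/
def bilinExt (f : List Letter → List Letter → M) : H k →ₗ[k] H k →ₗ[k] M :=
  linExt fun u => linExt (f u)

@[simp] theorem bilinExt_word (f : List Letter → List Letter → M) (u v : List Letter) :
    bilinExt f (word k u) (word k v) = f u v := by simp [bilinExt]

theorem linear_mem (f : H k →ₗ[k] M) (q : Submodule k M) (h : ∀ w, f (word k w) ∈ q) (u : H k) :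
    f u ∈ q := by
  have hu : u ∈ Submodule.span k (Set.range (wordBasis k)) := by
    rw [(wordBasis k).span_eq]; trivial
  have hle : Submodule.span k (Set.range (wordBasis k)) ≤ q.comap f := by
    rw [Submodule.span_le]
    rintro _ ⟨w, rfl⟩
    simpa using h w
  exact hle hu

theorem bilinear_mem (f : H k →ₗ[k] H k →ₗ[k] M) (q : Submodule k M)
    (h : ∀ v w, f (word k v) (word k w) ∈ q) (u v : H k) : f u v ∈ q := by
  refine linear_mem (f.flip v) q (fun w => ?_) u
  exact linear_mem (f (word k w)) q (fun w' => h w w') v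

end Words

section Subalgebras

variable (k : Type*) [CommRing k]

/-- `k⟨x, y⟩ y`. -/
def hy : Submodule k (H k) := LinearMap.range (LinearMap.mulRight k (ltr k .y))

/-- `x k⟨x, y⟩ y`. -/
def xhy : Submodule k (H k) :=
  LinearMap.range (LinearMap.mulLeft k (ltr k .x) ∘ₗ LinearMap.mulRight k (ltr k .y))

/-- `𝔥¹ = k + k⟨x, y⟩ y`. -/
def h1 : Submodule k (H k) := Submodule.span k {1} ⊔ hy k

/-- `𝔥⁰ = k + x k⟨x, y⟩ y`. -/
def h0 : Submodule k (H k) := Submodule.span k {1} ⊔ xhy k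

variable {k}

theorem mem_hy {u : H k} : u ∈ hy k ↔ ∃ v, v * ltr k .y = u := by
  simp [hy, LinearMap.mem_range]

theorem mem_xhy {u : H k} : u ∈ xhy k ↔ ∃ v, ltr k .x * (v * ltr k .y) = u := by
  simp [xhy, LinearMap.mem_range]

theorem mul_mem_hy (u : H k) {v : H k} (hv : v ∈ hy k) : u * v ∈ hy k := by
  obtain ⟨w, rfl⟩ := mem_hy.1 hv
  exact mem_hy.2 ⟨u * w, by simp [mul_assoc]⟩

theorem x_mul_mem_xhy {v : H k} (hv : v ∈ hy k) : ltr k .x * v ∈ xhy k := by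
  obtain ⟨w, rfl⟩ := mem_hy.1 hv
  exact mem_xhy.2 ⟨w, rfl⟩

theorem mul_y_mem_hy (u : H k) : u * ltr k .y ∈ hy k := mem_hy.2 ⟨u, rfl⟩

theorem xhy_le_hy : xhy k ≤ hy k := by
  intro u hu
  obtain ⟨w, rfl⟩ := mem_xhy.1 hu
  exact mul_mem_hy _ (mul_y_mem_hy w)

theorem h0_le_h1 : h0 k ≤ h1 k := sup_le_sup_left xhy_le_hy _

theorem one_mem_h0 : (1 : H k) ∈ h0 k :=
  Submodule.mem_sup_left (Submodule.mem_span_singleton_self 1)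

theorem one_mem_h1 : (1 : H k) ∈ h1 k := h0_le_h1 one_mem_h0

theorem hy_le_h1 : hy k ≤ h1 k := le_sup_right

theorem xhy_le_h0 : xhy k ≤ h0 k := le_sup_right

theorem mem_h1 {u : H k} : u ∈ h1 k ↔ ∃ (c : k) (v : H k), u = c • 1 + v * ltr k .y := by
  simp only [h1, Submodule.mem_sup, Submodule.mem_span_singleton, mem_hy]
  constructor
  · rintro ⟨_, ⟨c, rfl⟩, _, ⟨v, rfl⟩, rfl⟩
    exact ⟨c, v, rfl⟩
  · rintro ⟨c, v, rfl⟩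
    exact ⟨_, ⟨c, rfl⟩, _, ⟨v, rfl⟩, rfl⟩

theorem mem_h0 {u : H k} :
    u ∈ h0 k ↔ ∃ (c : k) (v : H k), u = c • 1 + ltr k .x * (v * ltr k .y) := by
  simp only [h0, Submodule.mem_sup, Submodule.mem_span_singleton, mem_xhy]
  constructor
  · rintro ⟨_, ⟨c, rfl⟩, _, ⟨v, rfl⟩, rfl⟩
    exact ⟨c, v, rfl⟩
  · rintro ⟨c, v, rfl⟩
    exact ⟨_, ⟨c, rfl⟩, _, ⟨v, rfl⟩, rfl⟩

/-- A linear map fixing `1` and mapping `x k⟨x, y⟩ y` to itself preserves `𝔥⁰`. -/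
theorem map_mem_h0 (f : H k →ₗ[k] H k) (h : f 1 ∈ h0 k)
    (hf : ∀ v, f (ltr k .x * (v * ltr k .y)) ∈ xhy k) : ∀ u ∈ h0 k, f u ∈ h0 k := by
  intro u hu
  obtain ⟨c, v, rfl⟩ := mem_h0.1 hu
  rw [map_add, map_smul]
  exact add_mem (Submodule.smul_mem _ _ h) (xhy_le_h0 (hf v))

variable (k)

/-- The inclusion `𝔥⁰ → 𝔥¹`. -/
def incl : h0 k →ₗ[k] h1 k := Submodule.inclusion h0_le_h1

/-- `1` as an element of `𝔥¹`. -/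
def one1 : h1 k := ⟨1, one_mem_h1⟩

/-- `1` as an element of `𝔥⁰`. -/
def one0 : h0 k := ⟨1, one_mem_h0⟩

theorem y_pow_mem (m : ℕ) : ltr k .y ^ m ∈ h1 k := by
  cases m with
  | zero => simpa using one_mem_h1
  | succ m => rw [pow_succ]; exact hy_le_h1 (mul_y_mem_hy _)

/-- The concatenation power `yᵐ` as an element of `𝔥¹`. -/
def yPow (m : ℕ) : h1 k := ⟨ltr k .y ^ m, y_pow_mem k m⟩

/-- `z_n = xⁿ⁻¹ y` for `n ≥ 1`. -/
def z (n : ℕ) : H k := ltr k .x ^ (n - 1) * ltr k .y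

/-- `z_{k_1} ⋯ z_{k_n}`. -/
def zWord (l : List ℕ) : H k := (l.map (z k)).prod

variable {k}

theorem z_mem_hy (n : ℕ) : z k n ∈ hy k := mul_y_mem_hy _

theorem zWord_mem_hy {l : List ℕ} (hl : l ≠ []) : zWord k l ∈ hy k := by
  induction l with
  | nil => exact absurd rfl hl
  | cons a l ih =>
    rcases eq_or_ne l [] with rfl | h
    · simpa [zWord] using z_mem_hy a
    · have := mul_mem_hy (z k a) (ih h)
      simpa [zWord] using this

theorem z_eq {n : ℕ} (hn : 2 ≤ n) : z k n = ltr k .x * z k (n - 1) := by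
  obtain ⟨m, rfl⟩ := Nat.exists_eq_add_of_le' hn
  simp [z, pow_succ', mul_assoc]

theorem zWord_mem_xhy {a : ℕ} (l : List ℕ) (ha : 2 ≤ a) : zWord k (a :: l) ∈ xhy k := by
  have h : zWord k (a :: l) = ltr k .x * zWord k ((a - 1) :: l) := by
    simp [zWord, z_eq ha, mul_assoc]
  rw [h]
  exact x_mul_mem_xhy (zWord_mem_hy (by simp))

theorem z_one_mem : z k 1 ∈ h1 k := hy_le_h1 (z_mem_hy 1)

theorem x_pow_z_mem {n : ℕ} (hn : 2 ≤ n) : z k n ∈ h0 k := by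
  have := zWord_mem_xhy (k := k) [] hn
  exact xhy_le_h0 (by simpa [zWord] using this)

variable (k) in
/-- `z_n` as an element of `𝔥⁰`, for `n ≥ 2`. -/
def z0 (n : ℕ) (hn : 2 ≤ n) : h0 k := ⟨z k n, x_pow_z_mem hn⟩

end Subalgebras

/-! Words ending in `y` and their indices. -/

/-- The word is nonempty and its last letter is `y`. -/
def EndsY (w : List Letter) : Prop := w.getLast? = some .y

/-- Auxiliary function for `toIndex`: `c` counts the letters `x` read since the last `y`. -/
def toIndexAux : ℕ → List Letter → List ℕ
  | _, [] => []
  | c, .x :: w => toIndexAux (c + 1) w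
  | c, .y :: w => (c + 1) :: toIndexAux 0 w

/-- The list `[k_1, …, k_n]` of positive integers with `w = z_{k_1} ⋯ z_{k_n}`, for a word `w`
that is empty or ends in `y`. -/
def toIndex (w : List Letter) : List ℕ := toIndexAux 0 w

theorem word_eq_zWord_aux (k : Type*) [CommRing k] (w : List Letter) (c : ℕ) (hw : EndsY w) :
    ltr k .x ^ c * word k w = zWord k (toIndexAux c w) := by
  induction w generalizing c with
  | nil => simp [EndsY] at hw
  | cons a w ih =>
    rcases eq_or_ne w [] with rfl | h
    · cases a
      · simp [EndsY] at hw
      · simp [toIndexAux, zWord, z]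
    · have hw' : EndsY w := by
        obtain ⟨b, w, rfl⟩ := List.exists_cons_of_ne_nil h
        simpa [EndsY] using hw
      cases a
      · rw [toIndexAux, ← ih _ hw', word_cons, pow_succ, mul_assoc]
      · have := ih 0 hw'
        rw [toIndexAux]
        simp only [zWord, List.map_cons, List.prod_cons] at this ⊢
        rw [← this]
        simp [z, mul_assoc]

/-- `w = z_{k_1} ⋯ z_{k_n}` with `[k_1, …, k_n] = toIndex w`. -/
theorem word_eq_zWord (k : Type*) [CommRing k] (w : List Letter) (hw : w = [] ∨ EndsY w) :
    word k w = zWord k (toIndex w) := by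
  rcases hw with rfl | hw
  · simp [toIndex, toIndexAux, zWord]
  · simpa [toIndex] using word_eq_zWord_aux k w 0 hw

theorem endsY_append (w : List Letter) : EndsY (w ++ [.y]) := by simp [EndsY]

theorem endsY_of_cons {a : Letter} {w : List Letter} (h : EndsY (a :: w)) (hw : w ≠ []) :
    EndsY w := by
  obtain ⟨b, w, rfl⟩ := List.exists_cons_of_ne_nil hw
  simpa [EndsY] using h

theorem EndsY.ne_nil {w : List Letter} (h : EndsY w) : w ≠ [] := by
  rintro rfl; simp [EndsY] at h

theorem word_mem_hy {k : Type*} [CommRing k] {w : List Letter} (h : EndsY w) :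
    word k w ∈ hy k := by
  obtain ⟨v, rfl⟩ : ∃ v, w = v ++ [.y] := by
    rw [EndsY, List.getLast?_eq_some_iff] at h; exact h
  rw [word_append]
  simpa using mul_y_mem_hy (word k v)

theorem toIndexAux_head (w : List Letter) (c : ℕ) (h : EndsY w) :
    ∃ a l, toIndexAux c w = a :: l ∧ c + 1 ≤ a := by
  induction w generalizing c with
  | nil => simp [EndsY] at h
  | cons a w ih =>
    cases a
    · have hw : w ≠ [] := by rintro rfl; simp [EndsY] at h
      obtain ⟨a, l, h1, h2⟩ := ih (c + 1) (endsY_of_cons h hw)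
      exact ⟨a, l, by simpa [toIndexAux] using h1, by omega⟩
    · exact ⟨c + 1, toIndexAux 0 w, by simp [toIndexAux], le_rfl⟩

theorem toIndex_ne_nil {w : List Letter} (h : EndsY w) : toIndex w ≠ [] := by
  obtain ⟨a, l, h1, -⟩ := toIndexAux_head w 0 h
  simp [toIndex, h1]

theorem toIndex_x_cons {w : List Letter} (h : EndsY w) :
    ∃ a l, toIndex (.x :: w) = a :: l ∧ 2 ≤ a := by
  obtain ⟨a, l, h1, h2⟩ := toIndexAux_head w 1 h
  exact ⟨a, l, by simpa [toIndex, toIndexAux] using h1, h2⟩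

section Shuffle

variable {k : Type*} [CommRing k] (t : k)

/-- `ρ(x) = 0`, `ρ(y) = t x`. -/
def rhoLetter : Letter → H k
  | .x => 0
  | .y => t • ltr k .x

open Classical in
/-- The `t`-shuffle product of two words. -/
def shuffleWord : List Letter → List Letter → H k
  | [], v => word k v
  | a :: u, [] => word k (a :: u)
  | a :: u, b :: v =>
      ltr k a * shuffleWord u (b :: v) + ltr k b * shuffleWord (a :: u) v
        - (if u = [] then rhoLetter t a * (ltr k b * word k v) else 0)
        - (if v = [] then rhoLetter t b * (ltr k a * word k u) else 0)
  termination_by u v => u.length + v.length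

/-- The `t`-shuffle product on `k⟨x, y⟩`; `t = 0` gives the usual shuffle product. -/
def shuffle : H k →ₗ[k] H k →ₗ[k] H k := bilinExt (shuffleWord t)

theorem shuffle_one_left (u : H k) : shuffle t 1 u = u := by
  have h := linear_mem (shuffle t 1 - LinearMap.id) ⊥ (fun w => by
    rw [← word_nil]
    simp only [LinearMap.sub_apply, shuffle, bilinExt_word, shuffleWord, LinearMap.id_apply,
      sub_self, Submodule.zero_mem]) u
  simpa [sub_eq_zero] using h

theorem shuffle_one_right (u : H k) : shuffle t u 1 = u := by
  have h := linear_mem ((shuffle t).flip 1 - LinearMap.id) ⊥ (fun w => by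
    rw [← word_nil]
    cases w <;> simp only [LinearMap.sub_apply, LinearMap.flip_apply, shuffle, bilinExt_word,
      shuffleWord, LinearMap.id_apply, sub_self, Submodule.zero_mem]) u
  simpa [sub_eq_zero] using h

theorem shuffleWord_mem_hy : ∀ u v : List Letter, (u = [] ∨ EndsY u) → (v = [] ∨ EndsY v) →
    (u ≠ [] ∨ v ≠ []) → shuffleWord t u v ∈ hy k
  | [], v, _, hv, h => by
      simp only [shuffleWord]
      exact word_mem_hy (hv.resolve_left (by simpa using h))
  | a :: u, [], hu, _, _ => by
      simp only [shuffleWord]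
      exact word_mem_hy (hu.resolve_left (by simp))
  | a :: u, b :: v, hu, hv, _ => by
      have hu' := hu.resolve_left (by simp)
      have hv' := hv.resolve_left (by simp)
      have h1 : u = [] ∨ EndsY u := or_iff_not_imp_left.2 (endsY_of_cons hu')
      have h2 : v = [] ∨ EndsY v := or_iff_not_imp_left.2 (endsY_of_cons hv')
      rw [shuffleWord]
      refine sub_mem (sub_mem (add_mem ?_ ?_) ?_) ?_
      · exact mul_mem_hy _ (shuffleWord_mem_hy u (b :: v) h1 hv (by simp))
      · exact mul_mem_hy _ (shuffleWord_mem_hy (a :: u) v hu h2 (by simp))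
      · split_ifs
        · exact mul_mem_hy _ (by simpa using word_mem_hy (k := k) hv')
        · exact zero_mem _
      · split_ifs
        · exact mul_mem_hy _ (by simpa using word_mem_hy (k := k) hu')
        · exact zero_mem _
  termination_by u v => u.length + v.length

theorem word_mul_y (w : List Letter) : word k w * ltr k .y = word k (w ++ [.y]) := by
  simp [word_append]

theorem word_x_y (w : List Letter) :
    ltr k .x * (word k w * ltr k .y) = word k (.x :: (w ++ [.y])) := by
  simp [word_append]

theorem shuffle_mem_h1 {u v : H k} (hu : u ∈ h1 k) (hv : v ∈ h1 k) : shuffle t u v ∈ h1 k := by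
  obtain ⟨c, u, rfl⟩ := mem_h1.1 hu
  obtain ⟨d, v, rfl⟩ := mem_h1.1 hv
  have key : shuffle t (u * ltr k .y) (v * ltr k .y) ∈ hy k := by
    refine bilinear_mem ((shuffle t).compl₁₂ (LinearMap.mulRight k (ltr k .y))
      (LinearMap.mulRight k (ltr k .y))) (hy k) (fun w w' => ?_) u v
    simp only [LinearMap.compl₁₂_apply, LinearMap.mulRight_apply, word_mul_y, shuffle,
      bilinExt_word]
    exact shuffleWord_mem_hy t _ _ (.inr (endsY_append _)) (.inr (endsY_append _)) (by simp)
  simp only [map_add, map_smul, LinearMap.add_apply, LinearMap.smul_apply, shuffle_one_left,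
    shuffle_one_right]
  refine add_mem (Submodule.smul_mem _ _ (add_mem (Submodule.smul_mem _ _ one_mem_h1) ?_))
    (add_mem (Submodule.smul_mem _ _ ?_) (hy_le_h1 key))
  · exact hy_le_h1 (mul_y_mem_hy _)
  · exact hy_le_h1 (mul_y_mem_hy _)

theorem shuffle_mem_h0 {u v : H k} (hu : u ∈ h0 k) (hv : v ∈ h0 k) : shuffle t u v ∈ h0 k := by
  obtain ⟨c, u, rfl⟩ := mem_h0.1 hu
  obtain ⟨d, v, rfl⟩ := mem_h0.1 hv
  have key : shuffle t (ltr k .x * (u * ltr k .y)) (ltr k .x * (v * ltr k .y)) ∈ xhy k := by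
    refine bilinear_mem ((shuffle t).compl₁₂
      (LinearMap.mulLeft k (ltr k .x) ∘ₗ LinearMap.mulRight k (ltr k .y))
      (LinearMap.mulLeft k (ltr k .x) ∘ₗ LinearMap.mulRight k (ltr k .y)))
      (xhy k) (fun w w' => ?_) u v
    simp only [LinearMap.compl₁₂_apply, LinearMap.comp_apply, LinearMap.mulRight_apply,
      LinearMap.mulLeft_apply, word_x_y, shuffle, bilinExt_word]
    have e1 : EndsY (.x :: (w ++ [.y])) := by
      simpa using endsY_append (.x :: w)
    have e2 : EndsY (.x :: (w' ++ [.y])) := by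
      simpa using endsY_append (.x :: w')
    rw [shuffleWord]
    simp only [List.append_eq_nil_iff, List.cons_ne_nil, and_false, if_false, sub_zero]
    refine add_mem ?_ ?_
    · exact x_mul_mem_xhy (shuffleWord_mem_hy t _ _ (.inr (endsY_append _)) (.inr e2) (by simp))
    · exact x_mul_mem_xhy (shuffleWord_mem_hy t _ _ (.inr e1) (.inr (endsY_append _)) (by simp))
  simp only [map_add, map_smul, LinearMap.add_apply, LinearMap.smul_apply, shuffle_one_left,
    shuffle_one_right]
  refine add_mem (Submodule.smul_mem _ _ (add_mem (Submodule.smul_mem _ _ one_mem_h0) ?_))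
    (add_mem (Submodule.smul_mem _ _ ?_) (xhy_le_h0 key))
  · exact xhy_le_h0 (mem_xhy.2 ⟨_, rfl⟩)
  · exact xhy_le_h0 (mem_xhy.2 ⟨_, rfl⟩)

/-- The `t`-shuffle product on `𝔥¹`. -/
def shuffle1 (u v : h1 k) : h1 k := ⟨shuffle t u v, shuffle_mem_h1 t u.2 v.2⟩

/-- The `t`-shuffle product on `𝔥⁰`. -/
def shuffle0 (u v : h0 k) : h0 k := ⟨shuffle t u v, shuffle_mem_h0 t u.2 v.2⟩

end Shuffle

section Stuffle

variable {k : Type*} [CommRing k] (t : k)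

open Classical in
/-- The `t`-harmonic shuffle (stuffle) product of `z_{k_1} ⋯ z_{k_m}` and `z_{l_1} ⋯ z_{l_n}`, as a
function of the two indices. -/
def stuffleIndex : List ℕ → List ℕ → H k
  | [], v => zWord k v
  | a :: u, [] => zWord k (a :: u)
  | a :: u, b :: v =>
      z k a * stuffleIndex u (b :: v) + z k b * stuffleIndex (a :: u) v
        + (1 - 2 * t) • (z k (a + b) * stuffleIndex u v)
        + (if u = [] ∧ v = [] then 0
            else (t ^ 2 - t) • (ltr k .x ^ (a + b) * stuffleIndex u v))
  termination_by u v => u.length + v.length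

open Classical in
/-- The bilinear extension of the `t`-stuffle product of words that are empty or end in `y`.  Only
its restriction to `𝔥¹` is used; on pairs with a word outside `𝔥¹` its value is `0`. -/
def stuffle : H k →ₗ[k] H k →ₗ[k] H k :=
  bilinExt fun u v =>
    if (u = [] ∨ EndsY u) ∧ (v = [] ∨ EndsY v) then stuffleIndex t (toIndex u) (toIndex v) else 0

theorem stuffleIndex_mem_hy : ∀ u v : List ℕ, (u ≠ [] ∨ v ≠ []) → stuffleIndex t u v ∈ hy k
  | [], v, h => by
      simp only [stuffleIndex]
      exact zWord_mem_hy (by simpa using h)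
  | a :: u, [], _ => by
      simp only [stuffleIndex]
      exact zWord_mem_hy (by simp)
  | a :: u, b :: v, _ => by
      rw [stuffleIndex]
      refine add_mem (add_mem (add_mem ?_ ?_) ?_) ?_
      · exact mul_mem_hy _ (stuffleIndex_mem_hy u (b :: v) (by simp))
      · exact mul_mem_hy _ (stuffleIndex_mem_hy (a :: u) v (by simp))
      · refine Submodule.smul_mem _ _ ?_
        by_cases h : u = [] ∧ v = []
        · obtain ⟨rfl, rfl⟩ := h
          simpa [stuffleIndex, zWord] using z_mem_hy (a + b)
        · exact mul_mem_hy _ (stuffleIndex_mem_hy u v (by tauto))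
      · split_ifs with h
        · exact zero_mem _
        · exact Submodule.smul_mem _ _
            (mul_mem_hy _ (stuffleIndex_mem_hy u v (by tauto)))
  termination_by u v => u.length + v.length

theorem z_mul_mem_xhy {a : ℕ} (ha : 2 ≤ a) {u : H k} (hu : u ∈ hy k) : z k a * u ∈ xhy k := by
  rw [z_eq ha, mul_assoc]
  exact x_mul_mem_xhy (mul_mem_hy _ hu)

theorem stuffleIndex_mem_xhy (a b : ℕ) (u v : List ℕ) (ha : 2 ≤ a) (hb : 2 ≤ b) :
    stuffleIndex t (a :: u) (b :: v) ∈ xhy k := by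
  rw [stuffleIndex]
  refine add_mem (add_mem (add_mem ?_ ?_) ?_) ?_
  · exact z_mul_mem_xhy ha (stuffleIndex_mem_hy t u (b :: v) (by simp))
  · exact z_mul_mem_xhy hb (stuffleIndex_mem_hy t (a :: u) v (by simp))
  · refine Submodule.smul_mem _ _ ?_
    by_cases h : u = [] ∧ v = []
    · obtain ⟨rfl, rfl⟩ := h
      have := zWord_mem_xhy (k := k) [] (show 2 ≤ a + b by omega)
      simpa [stuffleIndex, zWord] using this
    · exact z_mul_mem_xhy (by omega) (stuffleIndex_mem_hy t u v (by tauto))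
  · split_ifs with h
    · exact zero_mem _
    · refine Submodule.smul_mem _ _ ?_
      obtain ⟨n, hn⟩ := Nat.exists_eq_add_of_le' (show 1 ≤ a + b by omega)
      rw [hn, pow_succ', mul_assoc]
      exact x_mul_mem_xhy (mul_mem_hy _ (stuffleIndex_mem_hy t u v (by tauto)))

theorem stuffle_one_one : stuffle t (1 : H k) 1 = 1 := by
  rw [← word_nil]
  simp only [stuffle, bilinExt_word]
  simp [toIndex, toIndexAux, stuffleIndex, zWord]

theorem stuffle_one_left (u : H k) (hu : u ∈ h1 k) : stuffle t 1 u = u := by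
  obtain ⟨c, u, rfl⟩ := mem_h1.1 hu
  have h := linear_mem ((stuffle t 1 - LinearMap.id) ∘ₗ LinearMap.mulRight k (ltr k .y)) ⊥
    (fun w => by
      have e := word_eq_zWord k _ (.inr (endsY_append w))
      rw [← word_nil]
      simp [-word_nil, word_mul_y, stuffle, endsY_append]
      rw [e]
      simp [toIndex, toIndexAux, stuffleIndex]) u
  simp only [Submodule.mem_bot, LinearMap.comp_apply, LinearMap.sub_apply, LinearMap.id_apply,
    sub_eq_zero, LinearMap.mulRight_apply] at h
  rw [map_add, map_smul, stuffle_one_one, h]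

theorem stuffleIndex_nil_right (u : List ℕ) : stuffleIndex t u [] = zWord k u := by
  cases u <;> simp [stuffleIndex]

theorem stuffle_one_right (u : H k) (hu : u ∈ h1 k) : stuffle t u 1 = u := by
  obtain ⟨c, u, rfl⟩ := mem_h1.1 hu
  have h := linear_mem (((stuffle t).flip 1 - LinearMap.id) ∘ₗ
    LinearMap.mulRight k (ltr k .y)) ⊥
    (fun w => by
      have e := word_eq_zWord k _ (.inr (endsY_append w))
      rw [← word_nil]
      simp [-word_nil, word_mul_y, stuffle, endsY_append]
      rw [e]
      have e0 : toIndex [] = [] := rfl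
      rw [e0, stuffleIndex_nil_right, sub_self]) u
  simp only [Submodule.mem_bot, LinearMap.comp_apply, LinearMap.sub_apply, LinearMap.id_apply,
    sub_eq_zero, LinearMap.mulRight_apply, LinearMap.flip_apply] at h
  rw [map_add, LinearMap.add_apply, map_smul, LinearMap.smul_apply, stuffle_one_one, h]

theorem stuffle_mem_h1 {u v : H k} (hu : u ∈ h1 k) (hv : v ∈ h1 k) : stuffle t u v ∈ h1 k := by
  obtain ⟨c, u, rfl⟩ := mem_h1.1 hu
  have key : stuffle t (u * ltr k .y) v ∈ h1 k := by
    obtain ⟨d, v, rfl⟩ := mem_h1.1 hv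
    have key' : stuffle t (u * ltr k .y) (v * ltr k .y) ∈ hy k := by
      refine bilinear_mem ((stuffle t).compl₁₂ (LinearMap.mulRight k (ltr k .y))
        (LinearMap.mulRight k (ltr k .y))) (hy k) (fun w w' => ?_) u v
      simp only [LinearMap.compl₁₂_apply, LinearMap.mulRight_apply, word_mul_y, stuffle,
        bilinExt_word, endsY_append, or_true, and_self, if_true]
      exact stuffleIndex_mem_hy t _ _ (.inl (toIndex_ne_nil (endsY_append _)))
    rw [map_add, map_smul, stuffle_one_right t _ (hy_le_h1 (mul_y_mem_hy _))]
    exact add_mem (Submodule.smul_mem _ _ (hy_le_h1 (mul_y_mem_hy _))) (hy_le_h1 key')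
  rw [map_add, map_smul, LinearMap.add_apply, LinearMap.smul_apply, stuffle_one_left t v hv]
  exact add_mem (Submodule.smul_mem _ _ hv) key

theorem stuffle_mem_h0 {u v : H k} (hu : u ∈ h0 k) (hv : v ∈ h0 k) : stuffle t u v ∈ h0 k := by
  obtain ⟨c, u, rfl⟩ := mem_h0.1 hu
  have hm : ∀ w : H k, ltr k .x * (w * ltr k .y) ∈ h0 k := fun w => xhy_le_h0 (mem_xhy.2 ⟨w, rfl⟩)
  have key : stuffle t (ltr k .x * (u * ltr k .y)) v ∈ h0 k := by
    obtain ⟨d, v, rfl⟩ := mem_h0.1 hv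
    have key' : stuffle t (ltr k .x * (u * ltr k .y)) (ltr k .x * (v * ltr k .y)) ∈ xhy k := by
      refine bilinear_mem ((stuffle t).compl₁₂
        (LinearMap.mulLeft k (ltr k .x) ∘ₗ LinearMap.mulRight k (ltr k .y))
        (LinearMap.mulLeft k (ltr k .x) ∘ₗ LinearMap.mulRight k (ltr k .y)))
        (xhy k) (fun w w' => ?_) u v
      have e1 : EndsY (.x :: (w ++ [.y])) := by simpa using endsY_append (.x :: w)
      have e2 : EndsY (.x :: (w' ++ [.y])) := by simpa using endsY_append (.x :: w')
      simp only [LinearMap.compl₁₂_apply, LinearMap.comp_apply, LinearMap.mulRight_apply,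
        LinearMap.mulLeft_apply, word_x_y, stuffle, bilinExt_word, e1, e2, or_true, and_self,
        if_true]
      obtain ⟨a, l, h1, h2⟩ := toIndex_x_cons (endsY_append w)
      obtain ⟨b, m, h3, h4⟩ := toIndex_x_cons (endsY_append w')
      rw [h1, h3]
      exact stuffleIndex_mem_xhy t a b l m h2 h4
    rw [map_add, map_smul, stuffle_one_right t _ (h0_le_h1 (hm u))]
    exact add_mem (Submodule.smul_mem _ _ (hm u)) (xhy_le_h0 key')
  rw [map_add, map_smul, LinearMap.add_apply, LinearMap.smul_apply,
    stuffle_one_left t v (h0_le_h1 hv)]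
  exact add_mem (Submodule.smul_mem _ _ hv) key

/-- The `t`-stuffle product on `𝔥¹`; `t = 0` gives the usual stuffle product. -/
def stuffle1 (u v : h1 k) : h1 k := ⟨stuffle t u v, stuffle_mem_h1 t u.2 v.2⟩

/-- The `t`-stuffle product on `𝔥⁰`. -/
def stuffle0 (u v : h0 k) : h0 k := ⟨stuffle t u v, stuffle_mem_h0 t u.2 v.2⟩

end Stuffle

section Operators

variable {k : Type*} [CommRing k]

/-- The algebra endomorphism `σ_t` of `k⟨x, y⟩` with `σ_t(x) = x`, `σ_t(y) = t x + y`. -/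
def sigmaHom (t : k) : H k →ₐ[k] H k :=
  FreeAlgebra.lift k fun a =>
    match a with
    | .x => ltr k .x
    | .y => t • ltr k .x + ltr k .y

/-- The linear map `S_t` with `S_t(1) = 1` and `S_t(w a) = σ_t(w) a` for words `w` and
letters `a`. -/
def S (t : k) : H k →ₗ[k] H k :=
  linExt fun w =>
    match w.getLast? with
    | none => 1
    | some a => sigmaHom t (word k w.dropLast) * ltr k a

theorem S_one (t : k) : S t 1 = 1 := by
  rw [← word_nil, S, linExt_word]; rfl

theorem S_mul_letter (t : k) (u : H k) (a : Letter) :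
    S t (u * ltr k a) = sigmaHom t u * ltr k a := by
  have h := linear_mem (S t ∘ₗ LinearMap.mulRight k (ltr k a)
    - LinearMap.mulRight k (ltr k a) ∘ₗ (sigmaHom t).toLinearMap) ⊥ (fun w => by
      have e : word k w * ltr k a = word k (w ++ [a]) := by simp [word_append]
      simp only [LinearMap.sub_apply, LinearMap.comp_apply, LinearMap.mulRight_apply, e]
      simp [S]) u
  simpa [sub_eq_zero] using h

theorem S_mem_h0 (t : k) : ∀ u ∈ h0 k, S t u ∈ h0 k := by
  refine map_mem_h0 (S t) (by rw [S_one]; exact one_mem_h0) fun v => ?_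
  rw [← mul_assoc, S_mul_letter, map_mul]
  exact mem_xhy.2 ⟨sigmaHom t v, by simp [sigmaHom, mul_assoc]⟩

/-- `S_t` on `𝔥⁰`. -/
def S0 (t : k) : h0 k →ₗ[k] h0 k := (S t).restrict (S_mem_h0 t)

/-- `∂_n` on letters: `∂_n(x) = x (x + y)ⁿ⁻¹ y`, `∂_n(y) = - x (x + y)ⁿ⁻¹ y`, for `n ≥ 1`. -/
def derLetter (n : ℕ) : Letter → H k
  | .x => ltr k .x * (ltr k .x + ltr k .y) ^ (n - 1) * ltr k .y
  | .y => -(ltr k .x * (ltr k .x + ltr k .y) ^ (n - 1) * ltr k .y)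

/-- `∂_n` on words, by the Leibniz rule. -/
def derWord (n : ℕ) : List Letter → H k
  | [] => 0
  | a :: w => derLetter n a * word k w + ltr k a * derWord n w

/-- The derivation `∂_n` of `k⟨x, y⟩`. -/
def der (n : ℕ) : H k →ₗ[k] H k := linExt (derWord n)

theorem derWord_append (n : ℕ) (v w : List Letter) :
    derWord (k := k) n (v ++ w) = derWord n v * word k w + word k v * derWord n w := by
  induction v with
  | nil => simp [derWord]
  | cons a v ih => simp [derWord, ih, word_append, mul_add, add_mul, mul_assoc, add_assoc]

/-- `∂_n` is a derivation. -/
theorem der_mul (n : ℕ) (u v : H k) : der n (u * v) = der n u * v + u * der n v := by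
  have h := bilinear_mem ((LinearMap.mul k (H k)).compr₂ (der n)
    - (LinearMap.mul k (H k)).compl₁₂ (der n) LinearMap.id
    - (LinearMap.mul k (H k)).compl₁₂ LinearMap.id (der n)) ⊥ (fun v w => by
      simp only [LinearMap.sub_apply, LinearMap.compr₂_apply, LinearMap.compl₁₂_apply,
        LinearMap.mul_apply', LinearMap.id_apply, ← word_append, der, linExt_word, derWord_append]
      simp) u v
  rw [Submodule.mem_bot] at h
  change der n (u * v) - der n u * v - u * der n v = 0 at h
  rwa [sub_sub, sub_eq_zero] at h

theorem der_letter (n : ℕ) (a : Letter) : der n (ltr k a) = derLetter n a := by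
  have e : ltr k a = word k [a] := by simp
  rw [e, der, linExt_word]
  simp [derWord]

theorem der_mem_h0 (n : ℕ) : ∀ u ∈ h0 k, der n u ∈ h0 k := by
  refine map_mem_h0 (der n) ?_ fun v => ?_
  · have e : (1 : H k) = word k [] := rfl
    rw [e, der, linExt_word]
    exact zero_mem _
  · have hx : derLetter (k := k) n .x
        = ltr k .x * ((ltr k .x + ltr k .y) ^ (n - 1) * ltr k .y) := by
      simp [derLetter, mul_assoc]
    have hy' : derLetter (k := k) n .y
        = (-(ltr k .x * (ltr k .x + ltr k .y) ^ (n - 1))) * ltr k .y := by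
      simp [derLetter]
    rw [der_mul, der_mul, der_letter, der_letter, hx, mul_assoc]
    refine add_mem (x_mul_mem_xhy (mul_mem_hy _ (mul_y_mem_hy _)))
      (x_mul_mem_xhy (add_mem (mul_y_mem_hy _) (mul_mem_hy _ ?_)))
    rw [hy']
    exact mul_y_mem_hy _

/-- `∂_n` on `𝔥⁰`. -/
def der0 (n : ℕ) : h0 k →ₗ[k] h0 k := (der n).restrict (der_mem_h0 n)

/-- `∂_nᵗ = S_{-t} ∘ ∂_n ∘ S_t` on `𝔥⁰`. -/
def derT (t : k) (n : ℕ) : h0 k →ₗ[k] h0 k := S0 (-t) ∘ₗ der0 n ∘ₗ S0 t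

/-- The sum of `z_{k_1 + ε_1} ⋯ z_{k_n + ε_n}` over all `ε_1, …, ε_n ≥ 0` with
`ε_1 + ⋯ + ε_n = m`. -/
def sigmaIndex (m : ℕ) (l : List ℕ) : H k :=
  ∑ ε ∈ Finset.Nat.antidiagonalTuple l.length m, zWord k (List.ofFn fun i => l.get i + ε i)

open Classical in
/-- The linear map `σ_m`, with `σ_m(1) = 1`.  Only its restriction to `𝔥¹` is used; words outside
`𝔥¹` are sent to `0`. -/
def sigma (m : ℕ) : H k →ₗ[k] H k :=
  linExt fun w => if w = [] then 1 else if EndsY w then sigmaIndex m (toIndex w) else 0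

theorem sigmaIndex_mem_xhy (m a : ℕ) (l : List ℕ) (ha : 2 ≤ a) :
    sigmaIndex m (a :: l) ∈ xhy k := by
  refine Submodule.sum_mem _ fun ε _ => ?_
  have : 2 ≤ a + ε 0 := by omega
  simpa [List.ofFn_succ] using zWord_mem_xhy (k := k) _ this

theorem sigma_mem_h0 (m : ℕ) : ∀ u ∈ h0 k, sigma m u ∈ h0 k := by
  refine map_mem_h0 (sigma m) ?_ fun v => ?_
  · have e : (1 : H k) = word k [] := rfl
    rw [e, sigma, linExt_word]
    simpa using one_mem_h0
  · refine linear_mem (sigma m ∘ₗ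
      (LinearMap.mulLeft k (ltr k .x) ∘ₗ LinearMap.mulRight k (ltr k .y))) (xhy k)
      (fun w => ?_) v
    have e1 : EndsY (.x :: (w ++ [.y])) := by simpa using endsY_append (.x :: w)
    simp only [LinearMap.comp_apply, LinearMap.mulRight_apply, LinearMap.mulLeft_apply, word_x_y,
      sigma, linExt_word, e1, List.cons_ne_nil, if_true, if_false]
    obtain ⟨a, l, h1, h2⟩ := toIndex_x_cons (endsY_append w)
    rw [h1]
    exact sigmaIndex_mem_xhy m a l h2

/-- `σ_m` on `𝔥⁰`. -/
def sigma0 (m : ℕ) : h0 k →ₗ[k] h0 k := (sigma m).restrict (sigma_mem_h0 m)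

/-- The antiautomorphism `τ` of `k⟨x, y⟩` exchanging `x` and `y`, as an algebra map into the
opposite algebra. -/
def tauHom : H k →ₐ[k] (H k)ᵐᵒᵖ :=
  FreeAlgebra.lift k fun a =>
    match a with
    | .x => MulOpposite.op (ltr k .y)
    | .y => MulOpposite.op (ltr k .x)

/-- `τ` as a linear endomorphism of `k⟨x, y⟩`. -/
def tau : H k →ₗ[k] H k :=
  (MulOpposite.opLinearEquiv k).symm.toLinearMap ∘ₗ tauHom.toLinearMap

theorem tau_mem_h0 : ∀ u ∈ h0 k, tau u ∈ h0 k := by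
  refine map_mem_h0 tau (by simpa [tau] using one_mem_h0) fun v => ?_
  exact mem_xhy.2 ⟨tau v, by simp [tau, tauHom, mul_assoc]⟩

/-- `τ` on `𝔥⁰`. -/
def tau0 : h0 k →ₗ[k] h0 k := tau.restrict tau_mem_h0

/-- `τ ∘ σ_m ∘ τ` on `𝔥⁰`. -/
def sigmaBar0 (m : ℕ) : h0 k →ₗ[k] h0 k := tau0 ∘ₗ sigma0 m ∘ₗ tau0

/-- `σ_mᵗ = S_{-t} ∘ σ_m ∘ S_t` on `𝔥⁰`. -/
def sigmaT (t : k) (m : ℕ) : h0 k →ₗ[k] h0 k := S0 (-t) ∘ₗ sigma0 m ∘ₗ S0 t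

/-- `S_{-t} ∘ (τ ∘ σ_m ∘ τ) ∘ S_t` on `𝔥⁰`. -/
def sigmaBarT (t : k) (m : ℕ) : h0 k →ₗ[k] h0 k := S0 (-t) ∘ₗ sigmaBar0 m ∘ₗ S0 t

end Operators

section Regularization

variable {k : Type*} [CommRing k]

/-- The powers of `y` under a product on `𝔥¹`. -/
def yProdPow (mul : h1 k → h1 k → h1 k) : ℕ → h1 k
  | 0 => one1 k
  | i + 1 => mul (yPow k 1) (yProdPow mul i)

/-- `w = ∑ᵢ wᵢ • y^{• i}` with `wᵢ ∈ 𝔥⁰`, for a product `•` on `𝔥¹`. -/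
def IsExpansion (mul : h1 k → h1 k → h1 k) (w : h1 k) (c : ℕ →₀ h0 k) : Prop :=
  w = c.sum fun i wi => mul (incl k wi) (yProdPow mul i)

/-- The regularization `𝔥¹ → 𝔥⁰` with respect to a product `•` on `𝔥¹`: it sends
`w = ∑ᵢ wᵢ • y^{• i}` to `w₀`.  The products it is used for make `𝔥¹` a polynomial algebra
`𝔥⁰[y]`, so that the expansion exists and is unique. -/
def reg (mul : h1 k → h1 k → h1 k) (w : h1 k) : h0 k :=
  Classical.epsilon (IsExpansion mul w) 0

variable {S : Type*} [CommRing S] [Algebra k S]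

/-- `F` is a homomorphism of `k`-algebras from `𝔥¹` with the product `•` to `S[T]` which restricts
to `ζ` on `𝔥⁰` and maps `y` to `T`. -/
structure IsRegHom (mul : h1 k → h1 k → h1 k) (ζ : h0 k →ₗ[k] S) (F : h1 k →ₗ[k] S[X]) :
    Prop where
  map_one : F (one1 k) = 1
  map_mul : ∀ u v, F (mul u v) = F u * F v
  restrict : ∀ w, F (incl k w) = C (ζ w)
  map_y : F (yPow k 1) = X

/-- The unique homomorphism of algebras from `𝔥¹` with the product `•` to `S[T]` which restricts to
`ζ` on `𝔥⁰` and maps `y` to `T`. -/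
def regHom (mul : h1 k → h1 k → h1 k) (ζ : h0 k →ₗ[k] S) : h1 k →ₗ[k] S[X] :=
  Classical.epsilon (IsRegHom mul ζ)

/-- The `S`-linear endomorphism `ρ` of `S[T]` with `ρ(e^{Tu}) = A(u) e^{Tu}` for a power series
`A ∈ S[[u]]`, that is, `ρ(Tⁿ) = ∑_{i + j = n} (n! / j!) A_i Tʲ`. -/
def rho (A : PowerSeries S) : S[X] →ₗ[S] S[X] :=
  (Polynomial.basisMonomials S).constr S fun n =>
    ∑ p ∈ Finset.HasAntidiagonal.antidiagonal n, C (((n.descFactorial p.1 : ℕ) : S) * PowerSeries.coeff p.1 A) *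
      X ^ p.2

end Regularization

section DoubleShuffle

variable {K R : Type*} [Field K] [CharZero K] [CommRing R] [Algebra K R]

/-- The finite double shuffle relations for `Z_R : 𝔥⁰ → R`, with the normalization `Z_R(1) = 1`. -/
structure DoubleShuffle (Z : h0 K →ₗ[K] R) : Prop where
  map_one : Z (one0 K) = 1
  shuffle : ∀ w₁ w₂, Z (shuffle0 0 w₁ w₂) = Z w₁ * Z w₂
  stuffle : ∀ w₁ w₂, Z (stuffle0 0 w₁ w₂) = Z w₁ * Z w₂

/-- `A_R(u) = exp (∑_{n ≥ 2} (-1)ⁿ / n ζ_R(n) uⁿ)`, where `ζ_R(n) = Z_R(z_n)`. -/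
def expSeries (Z : h0 K →ₗ[K] R) : PowerSeries R :=
  (PowerSeries.exp K).subst (PowerSeries.mk fun n =>
    if hn : 2 ≤ n then ((-1) ^ n / (n : K)) • Z (z0 K n hn) else 0 : PowerSeries R)

/-- The homomorphism `(𝔥¹, shuffle) → R[T]` extending `Z_R`. -/
def Zsh (Z : h0 K →ₗ[K] R) := regHom (shuffle1 0) Z

/-- The homomorphism `(𝔥¹, stuffle) → R[T]` extending `Z_R`. -/
def Zst (Z : h0 K →ₗ[K] R) := regHom (stuffle1 0) Z

/-- The extended double shuffle relations: the finite double shuffle relations together with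
the comparison of the two regularizations. -/
structure ExtendedDoubleShuffle (Z : h0 K →ₗ[K] R) : Prop extends DoubleShuffle Z where
  comparison : ∀ w : h1 K, Zsh Z w - rho (expSeries Z) (Zst Z w) = 0

attribute [local instance] Polynomial.algebra

open Classical in
/-- The `K[t]`-linear extension `𝔥_t⁰ = 𝔥⁰[t] → R[t]` of `Z_R`. -/
def Zext (Z : h0 K →ₗ[K] R) : h0 K[X] →ₗ[K[X]] R[X] :=
  (linExt fun w => if h : word K w ∈ h0 K then C (Z ⟨word K w, h⟩) else 0).domRestrict (h0 K[X])

/-- `Z_Rᵗ = Z_R ∘ S_t : 𝔥_t⁰ → R[t]`. -/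
def Zt (Z : h0 K →ₗ[K] R) : h0 K[X] →ₗ[K[X]] R[X] := Zext Z ∘ₗ S0 X

/-- The homomorphism `(𝔥_t¹, t-shuffle) → R[t][T]` extending `Z_Rᵗ`. -/
def Ztsh (Z : h0 K →ₗ[K] R) := regHom (shuffle1 X) (Zt Z)

/-- The homomorphism `(𝔥_t¹, t-stuffle) → R[t][T]` extending `Z_Rᵗ`. -/
def Ztst (Z : h0 K →ₗ[K] R) := regHom (stuffle1 X) (Zt Z)

/-- The extension of `ρ_R` to an `R[t]`-linear endomorphism of `R[t][T]`. -/
def rhoT (Z : h0 K →ₗ[K] R) : R[X][X] →ₗ[R[X]] R[X][X] :=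
  rho ((expSeries Z).map C)

end DoubleShuffle

end TMZV

end

open Polynomial

noncomputable section

namespace TMZV

/-! ### The usual shuffle product, and deletion of a leading `y` -/

section Shuffle

variable {k : Type*} [CommRing k]

/-! The operator `S_t` removes `t` from the problem. It is an automorphism of `𝔥¹` that fixes `1`
and `y`, preserves `𝔥⁰`, and carries the `t`-products to the usual ones (`S_shuffle`, `S_stuffle`).
Over the base ring `K[t]`, with `ζ` the `K[t]`-linear extension of `Z_R`, every condition on the
`t`-objects is therefore equivalent to the corresponding condition at `t = 0`.

At `t = 0` deletion of a leading `y` is a locally nilpotent derivation `d` of `𝔥¹` for both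
products, with kernel `𝔥⁰` and `d y = 1`. In characteristic zero this makes `𝔥¹` a polynomial ring
`𝔥⁰[y]` for each product (`SliceProduct`), so the extensions `F` (shuffle) and `G` (stuffle) of `ζ`
exist and are unique, and regularization is evaluation at `T = 0`. The concatenation powers satisfy
`d yᵐ⁺¹ = yᵐ`, so they act as divided powers for both products at once, and many statements need
checking only on `yᵐ`.

The two products are compared by the identity `(1 - yu)⁻¹ * w = (1 - yu)⁻¹ ⧢ Δ(w)` (`stSeries_eq`),
where `Δ` is the algebra map with `Δ(x) = x(1 + yu)⁻¹` and `Δ(x + y) = x + y`. Applying `F` and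
setting `T = 0` turns `yᵐ * w` into `ζ(Δ_m w)`. All conditions are tied to one hub, `DeltaVanishes`:
`ζ ∘ Δ_m = 0` for `m ≥ 1`. The differential equation `u dΔ/du = Δ ∘ ∑ (-1)ⁿ ∂_n uⁿ`
(`eulerDer_deltaHom`) relates the hub to the derivations, and the factorization `∑ (-1)ᵐ σ̄_m uᵐ = Δ
∘ ∑ (-1)ᵐ σ_m uᵐ` on `x𝔥y` (`sigmaBarSeries_eq`) relates it to the Ohno-type relations. The map `ρ`
enters through `ρ(G(yᵐ)) = F(yᵐ)` (`rho_map_yPow_stuffle`), a consequence of Newton's identities for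
the stuffle product. `comparison_tfae` collects these equivalences.

Finally the vanishing of `ζ ∘ ∂_n` can be tested on words, so it holds over `K[t]` exactly when it
holds over `K`; this links the interpolated conditions to the extended double shuffle relations. -/

theorem ext_word {M : Type*} [AddCommGroup M] [Module k M] {f g : H k →ₗ[k] M}
    (h : ∀ w, f (word k w) = g (word k w)) : f = g :=
  (wordBasis k).ext fun w => by simpa using h w

theorem letter_induction {p : H k → Prop} (hadd : ∀ u v, p u → p v → p (u + v))
    (hsmul : ∀ (c : k) u, p u → p (c • u)) (hone : p 1)
    (hmul : ∀ a u, p u → p (ltr k a * u)) (u : H k) : p u := by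
  have h0 : p 0 := by simpa using hsmul 0 1 hone
  have hw : ∀ w, p (word k w) := fun w => by
    induction w with
    | nil => exact hone
    | cons a w ih => rw [word_cons]; exact hmul _ _ ih
  exact linear_mem LinearMap.id
    { carrier := {u | p u}, add_mem' := hadd _ _, zero_mem' := h0, smul_mem' := hsmul } hw u

theorem rhoLetter_zero (a : Letter) : rhoLetter (0 : k) a = 0 := by cases a <;> simp [rhoLetter]

/-- For `t = 0` the correction terms of the recursion vanish. What remains is bilinear in the tails,
so it passes from words to arbitrary elements. -/
theorem shuffle_letter (a b : Letter) (u v : H k) :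
    shuffle 0 (ltr k a * u) (ltr k b * v) =
      ltr k a * shuffle 0 u (ltr k b * v) + ltr k b * shuffle 0 (ltr k a * u) v := by
  have h := bilinear_mem
    ((shuffle (0 : k)).compl₁₂ (LinearMap.mulLeft k (ltr k a)) (LinearMap.mulLeft k (ltr k b))
      - ((shuffle (0 : k)).compl₁₂ LinearMap.id (LinearMap.mulLeft k (ltr k b))).compr₂
        (LinearMap.mulLeft k (ltr k a))
      - ((shuffle (0 : k)).compl₁₂ (LinearMap.mulLeft k (ltr k a)) LinearMap.id).compr₂
        (LinearMap.mulLeft k (ltr k b))) ⊥ (fun v w => by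
      simp only [LinearMap.sub_apply, LinearMap.compr₂_apply, LinearMap.compl₁₂_apply,
        LinearMap.mulLeft_apply, LinearMap.id_apply, ← word_cons]
      simp only [shuffle, bilinExt_word]
      rw [shuffleWord]
      simp [rhoLetter_zero]) u v
  simp only [Submodule.mem_bot, LinearMap.sub_apply, LinearMap.compl₁₂_apply,
    LinearMap.mulLeft_apply, sub_sub, sub_eq_zero] at h
  exact h

theorem shuffle_comm (u v : H k) : shuffle 0 u v = shuffle 0 v u := by
  induction u using letter_induction generalizing v with
  | hadd u u' h h' => simp [h, h']
  | hsmul c u h => simp [h]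
  | hone => rw [shuffle_one_left, shuffle_one_right]
  | hmul a u hu =>
    induction v using letter_induction with
    | hadd u u' h h' => simp [h, h']
    | hsmul c u h => simp [h]
    | hone => rw [shuffle_one_left, shuffle_one_right]
    | hmul b v hv => rw [shuffle_letter, shuffle_letter, hu, hv, add_comm]

theorem shuffle_assoc (u v w : H k) :
    shuffle 0 (shuffle 0 u v) w = shuffle 0 u (shuffle 0 v w) := by
  induction u using letter_induction generalizing v w with
  | hadd u u' h h' => simp [h, h']
  | hsmul c u h => simp [h]
  | hone => simp only [shuffle_one_left]
  | hmul a u hu =>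
    induction v using letter_induction generalizing w with
    | hadd u u' h h' => simp [h, h']
    | hsmul c u h => simp [h]
    | hone => simp only [shuffle_one_left, shuffle_one_right]
    | hmul b v hv =>
      induction w using letter_induction with
      | hadd u u' h h' => simp [h, h']
      | hsmul c u h => simp [h]
      | hone => simp only [shuffle_one_right]
      | hmul c w hw =>
        -- After expansion the two terms with leading letter `c` combine to `c((au ⧢ bv) ⧢ w)`, to
        -- which the induction on `w` applies; the other terms are covered by the inductions on `u`
        -- and `v`.
        rw [shuffle_letter a b u v, map_add, LinearMap.add_apply, shuffle_letter, shuffle_letter,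
          shuffle_letter b c v w, map_add, shuffle_letter, shuffle_letter, hu, hv,
          shuffle_letter b c v w, map_add, mul_add, add_add_add_comm, ← mul_add (ltr k c),
          ← LinearMap.add_apply, ← map_add, ← shuffle_letter a b u v, hw]
        abel

variable (k) in
/-- Left deletion of the letter `y`: `1 ↦ 0`, `x w ↦ 0`, `y w ↦ w`. -/
def delY : H k →ₗ[k] H k :=
  linExt fun w =>
    match w with
    | [] => 0
    | .x :: _ => 0
    | .y :: w => word k w

@[simp] theorem delY_one : delY k 1 = 0 := by
  rw [← word_nil, delY, linExt_word]

@[simp] theorem delY_x_mul (u : H k) : delY k (ltr k .x * u) = 0 := by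
  have h : delY k ∘ₗ LinearMap.mulLeft k (ltr k .x) = 0 := ext_word fun w => by
    simp only [LinearMap.comp_apply, LinearMap.mulLeft_apply, ← word_cons, delY, linExt_word,
      LinearMap.zero_apply]
  exact LinearMap.congr_fun h u

@[simp] theorem delY_y_mul (u : H k) : delY k (ltr k .y * u) = u := by
  have h : delY k ∘ₗ LinearMap.mulLeft k (ltr k .y) = LinearMap.id := ext_word fun w => by
    simp only [LinearMap.comp_apply, LinearMap.mulLeft_apply, ← word_cons, delY, linExt_word,
      LinearMap.id_apply]
  exact LinearMap.congr_fun h u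

/-- In the shuffle recursion the leading letter of a product comes from one of the two factors, so
deleting a leading `y` obeys the Leibniz rule. -/
theorem delY_shuffle (u v : H k) :
    delY k (shuffle 0 u v) = shuffle 0 (delY k u) v + shuffle 0 u (delY k v) := by
  induction u using letter_induction with
  | hadd u u' h h' => simp only [map_add, LinearMap.add_apply, h, h']; abel
  | hsmul c u h => simp [h]
  | hone => simp [shuffle_one_left]
  | hmul a u hu =>
    clear hu
    induction v using letter_induction with
    | hadd u u' h h' => simp only [map_add, h, h']; abel
    | hsmul c u h => simp [h]
    | hone => simp [shuffle_one_right]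
    | hmul b v _ => cases a <;> cases b <;> simp [shuffle_letter]

theorem exists_delY_pow_eq_zero (u : H k) : ∃ n, ∀ m, n ≤ m → (delY k ^ m) u = 0 := by
  induction u using letter_induction with
  | hadd u u' h h' =>
    obtain ⟨n, h⟩ := h
    obtain ⟨n', h'⟩ := h'
    exact ⟨max n n', fun m hm => by
      rw [map_add, h m (le_trans (le_max_left _ _) hm), h' m (le_trans (le_max_right _ _) hm),
        add_zero]⟩
  | hsmul c u h =>
    obtain ⟨n, h⟩ := h
    exact ⟨n, fun m hm => by rw [map_smul, h m hm, smul_zero]⟩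
  | hone =>
    refine ⟨1, fun m hm => ?_⟩
    obtain ⟨m, rfl⟩ := Nat.exists_eq_add_of_le' hm
    rw [pow_succ, Module.End.mul_apply, delY_one, map_zero]
  | hmul a u h =>
    obtain ⟨n, h⟩ := h
    refine ⟨n + 1, fun m hm => ?_⟩
    obtain ⟨m, rfl⟩ := Nat.exists_eq_add_of_le' hm
    rw [← add_assoc, pow_succ, Module.End.mul_apply]
    cases a
    · rw [delY_x_mul, map_zero]
    · rw [delY_y_mul, h _ (Nat.le_add_left _ _)]

theorem delY_mem_h1 : ∀ u ∈ h1 k, delY k u ∈ h1 k := by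
  intro u hu
  obtain ⟨c, u, rfl⟩ := mem_h1.1 hu
  rw [map_add, map_smul, delY_one, smul_zero, zero_add]
  induction u using letter_induction with
  | hadd u u' h h' =>
    rw [add_mul, map_add]
    exact add_mem (h (mem_h1.2 ⟨c, u, rfl⟩)) (h' (mem_h1.2 ⟨c, u', rfl⟩))
  | hsmul a u h =>
    rw [smul_mul_assoc, map_smul]
    exact Submodule.smul_mem _ _ (h (mem_h1.2 ⟨c, u, rfl⟩))
  | hone =>
    have := delY_y_mul (1 : H k)
    rw [mul_one] at this
    rw [one_mul, this]
    exact one_mem_h1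
  | hmul a u h =>
    rw [mul_assoc]
    cases a
    · rw [delY_x_mul]; exact zero_mem _
    · rw [delY_y_mul]; exact hy_le_h1 (mul_y_mem_hy u)

theorem delY_eq_zero_of_mem_h0 {u : H k} (hu : u ∈ h0 k) : delY k u = 0 := by
  obtain ⟨c, u, rfl⟩ := mem_h0.1 hu
  simp

/-- Every element is the sum of a constant, a left multiple of `x` and a left multiple of `y`. -/
theorem exists_eq_letters (u : H k) :
    ∃ (c : k) (v : H k), u = c • 1 + ltr k .x * v + ltr k .y * delY k u := by
  induction u using letter_induction with
  | hadd u u' h h' =>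
    obtain ⟨c, v, h⟩ := h
    obtain ⟨c', v', h'⟩ := h'
    refine ⟨c + c', v + v', ?_⟩
    rw [map_add, mul_add, mul_add, add_smul]
    nth_rewrite 1 [h, h']
    abel
  | hsmul a u h =>
    obtain ⟨c, v, h⟩ := h
    refine ⟨a * c, a • v, ?_⟩
    nth_rewrite 1 [h]
    simp [mul_smul]
  | hone => exact ⟨1, 0, by simp⟩
  | hmul a u h =>
    cases a
    · exact ⟨0, u, by simp⟩
    · exact ⟨0, 0, by simp⟩

theorem mem_h0_of_delY_eq_zero {u : H k} (hu : u ∈ h1 k) (h : delY k u = 0) : u ∈ h0 k := by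
  obtain ⟨c, u, rfl⟩ := mem_h1.1 hu
  obtain ⟨d, v, hv⟩ := exists_eq_letters u
  rw [hv] at h ⊢
  simp only [add_mul, map_add, map_smul, delY_one, smul_zero, zero_add, smul_mul_assoc, one_mul,
    mul_assoc, delY_x_mul, delY_y_mul] at h ⊢
  have e : delY k (ltr k .y) = 1 := by simpa using delY_y_mul (1 : H k)
  -- The hypothesis reads `d + (delY u) y = 0`. Multiplied by `y` on the left, it cancels every part
  -- of the element outside `k + x𝔥y`.
  have h' : d • ltr k .y + ltr k .y * (delY k u * ltr k .y) = 0 := by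
    have := congrArg (fun z => ltr k .y * z) h
    simpa only [e, mul_add, mul_smul_comm, mul_one, mul_zero, add_zero] using this
  refine mem_h0.2 ⟨c, v, ?_⟩
  rw [add_right_comm (d • _), h', zero_add]

end Shuffle

/-! ### The usual stuffle product -/

section Stuffle

variable {k : Type*} [CommRing k]

/-- The word `z_{k_1} ⋯ z_{k_n}`. -/
def ofIndex : List ℕ → List Letter
  | [] => []
  | n :: l => List.replicate (n - 1) .x ++ .y :: ofIndex l

theorem toIndexAux_replicate (m c : ℕ) (w : List Letter) :
    toIndexAux c (List.replicate m .x ++ .y :: w) = (c + m + 1) :: toIndexAux 0 w := by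
  induction m generalizing c with
  | zero => simp [toIndexAux]
  | succ m ih => simp [List.replicate_succ, toIndexAux, ih]; omega

theorem toIndex_ofIndex {l : List ℕ} (hl : ∀ n ∈ l, 1 ≤ n) : toIndex (ofIndex l) = l := by
  induction l with
  | nil => simp [ofIndex, toIndex, toIndexAux]
  | cons n l ih =>
    have := hl n (by simp)
    have ih := ih fun m hm => hl m (by simp [hm])
    rw [toIndex] at ih
    rw [ofIndex, toIndex, toIndexAux_replicate, ih]
    simp; omega

theorem ofIndex_endsY (l : List ℕ) : ofIndex l = [] ∨ EndsY (ofIndex l) := by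
  induction l with
  | nil => exact .inl rfl
  | cons n l ih =>
    right
    rcases ih with h | h
    · rw [ofIndex, h]; exact endsY_append _
    · rw [EndsY] at h
      rw [EndsY, ofIndex, List.getLast?_append, List.getLast?_cons, h]
      rfl

theorem word_ofIndex (l : List ℕ) : word k (ofIndex l) = zWord k l := by
  induction l with
  | nil => rfl
  | cons n l ih =>
    rw [ofIndex, word_append, word_cons, ih]
    simp [zWord, z, word, mul_assoc]

theorem stuffle_zWord (t : k) {l l' : List ℕ} (hl : ∀ n ∈ l, 1 ≤ n) (hl' : ∀ n ∈ l', 1 ≤ n) :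
    stuffle t (zWord k l) (zWord k l') = stuffleIndex t l l' := by
  rw [← word_ofIndex l, ← word_ofIndex l', stuffle, bilinExt_word,
    if_pos ⟨ofIndex_endsY l, ofIndex_endsY l'⟩, toIndex_ofIndex hl, toIndex_ofIndex hl']

theorem one_le_of_mem_toIndexAux (w : List Letter) (c : ℕ) : ∀ n ∈ toIndexAux c w, 1 ≤ n := by
  induction w generalizing c with
  | nil => simp [toIndexAux]
  | cons a w ih =>
    cases a
    · exact ih (c + 1)
    · simp only [toIndexAux, List.mem_cons, forall_eq_or_imp]
      exact ⟨by omega, ih 0⟩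

@[simp] theorem zWord_nil : zWord k [] = 1 := rfl

@[simp] theorem zWord_cons (n : ℕ) (l : List ℕ) : zWord k (n :: l) = z k n * zWord k l := by
  simp [zWord]

theorem zWord_mem_h1 (l : List ℕ) : zWord k l ∈ h1 k := by
  rcases eq_or_ne l [] with rfl | h
  · exact one_mem_h1
  · exact hy_le_h1 (zWord_mem_hy h)

theorem h1_le_of_zWord_mem (q : Submodule k (H k))
    (h : ∀ l, (∀ n ∈ l, 1 ≤ n) → zWord k l ∈ q) : h1 k ≤ q := by
  intro u hu
  obtain ⟨c, u, rfl⟩ := mem_h1.1 hu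
  refine add_mem (q.smul_mem _ (h [] (by simp))) ?_
  refine linear_mem (LinearMap.mulRight k (ltr k .y)) q (fun w => ?_) u
  rw [LinearMap.mulRight_apply, word_mul_y, word_eq_zWord k _ (.inr (endsY_append w))]
  exact h _ (one_le_of_mem_toIndexAux _ _)

theorem z_mul_mem_h1 (n : ℕ) {u : H k} (hu : u ∈ h1 k) : z k n * u ∈ h1 k := by
  obtain ⟨c, u, rfl⟩ := mem_h1.1 hu
  refine mem_h1.2 ⟨0, c • ltr k .x ^ (n - 1) + z k n * u, ?_⟩
  simp [mul_add, add_mul, z, mul_assoc]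

theorem h1_induction {p : H k → Prop} (hadd : ∀ u v, p u → p v → p (u + v))
    (hsmul : ∀ (c : k) u, p u → p (c • u)) (hone : p 1)
    (hmul : ∀ n, 1 ≤ n → ∀ u ∈ h1 k, p u → p (z k n * u)) : ∀ u ∈ h1 k, p u := by
  have h0 : p 0 := by simpa using hsmul 0 1 hone
  refine h1_le_of_zWord_mem
    { carrier := {u | p u}, add_mem' := hadd _ _, zero_mem' := h0, smul_mem' := hsmul }
    fun l hl => ?_
  induction l with
  | nil => exact hone
  | cons n l ih =>
    rw [zWord_cons]
    exact hmul n (hl n (by simp)) _ (zWord_mem_h1 l) (ih fun m hm => hl m (by simp [hm]))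

/-- On `z`-words this is the definition at `t = 0`; it is then extended linearly in one argument at
a time. Positivity is needed because `z k 0 = z k 1`, so an index is recovered from its word only if
its entries are at least `1`. -/
theorem stuffle_z {a b : ℕ} (ha : 1 ≤ a) (hb : 1 ≤ b) {u v : H k} (hu : u ∈ h1 k)
    (hv : v ∈ h1 k) :
    stuffle 0 (z k a * u) (z k b * v) =
      z k a * stuffle 0 u (z k b * v) + z k b * stuffle 0 (z k a * u) v
        + z k (a + b) * stuffle 0 u v := by
  have key : ∀ l l', (∀ n ∈ l, 1 ≤ n) → (∀ n ∈ l', 1 ≤ n) →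
      stuffle 0 (z k a * zWord k l) (z k b * zWord k l') =
      z k a * stuffle 0 (zWord k l) (z k b * zWord k l')
        + z k b * stuffle 0 (z k a * zWord k l) (zWord k l')
        + z k (a + b) * stuffle 0 (zWord k l) (zWord k l') := by
    intro l l' hl hl'
    simp only [← zWord_cons]
    have h1 : ∀ n ∈ a :: l, 1 ≤ n := by simpa using ⟨ha, hl⟩
    have h2 : ∀ n ∈ b :: l', 1 ≤ n := by simpa using ⟨hb, hl'⟩
    rw [stuffle_zWord _ h1 h2, stuffle_zWord _ hl h2, stuffle_zWord _ h1 hl',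
      stuffle_zWord _ hl hl', stuffleIndex]
    simp
  have hadd : ∀ {A B C D A' B' C' D' : H k}, A = B + C + D → A' = B' + C' + D' →
      A + A' = (B + B') + (C + C') + (D + D') := by
    rintro A B C D A' B' C' D' rfl rfl; abel
  let q (v : H k) : Submodule k (H k) :=
    { carrier := {u | stuffle 0 (z k a * u) (z k b * v) =
        z k a * stuffle 0 u (z k b * v) + z k b * stuffle 0 (z k a * u) v
        + z k (a + b) * stuffle 0 u v}
      add_mem' := fun {u u'} h h' => by
        simp only [Set.mem_ofPred_eq] at h h' ⊢
        simp only [mul_add, map_add, LinearMap.add_apply]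
        exact hadd h h'
      zero_mem' := by simp
      smul_mem' := fun c u h => by
        simp only [Set.mem_ofPred_eq] at h ⊢
        simp only [mul_smul_comm, map_smul, LinearMap.smul_apply, h, smul_add] }
  let q' (u : H k) : Submodule k (H k) :=
    { carrier := {v | stuffle 0 (z k a * u) (z k b * v) =
        z k a * stuffle 0 u (z k b * v) + z k b * stuffle 0 (z k a * u) v
        + z k (a + b) * stuffle 0 u v}
      add_mem' := fun {u u'} h h' => by
        simp only [Set.mem_ofPred_eq] at h h' ⊢
        simp only [mul_add, map_add]
        exact hadd h h'
      zero_mem' := by simp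
      smul_mem' := fun c u h => by
        simp only [Set.mem_ofPred_eq] at h ⊢
        simp only [mul_smul_comm, map_smul, h, smul_add] }
  refine h1_le_of_zWord_mem (q v) (fun l hl => ?_) hu
  exact h1_le_of_zWord_mem (q' (zWord k l)) (fun l' hl' => key l l' hl hl') hv

theorem stuffle_comm : ∀ u ∈ h1 k, ∀ v ∈ h1 k, stuffle 0 u v = stuffle 0 v u := by
  refine h1_induction (fun u u' h h' v hv => by simp [h v hv, h' v hv])
    (fun c u h v hv => by simp [h v hv])
    (fun v hv => by rw [stuffle_one_left _ _ hv, stuffle_one_right _ _ hv])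
    (fun n hn u hu ihu => ?_)
  refine h1_induction (fun v v' h h' => by simp [h, h']) (fun c v h => by simp [h])
    (by rw [stuffle_one_left _ _ (z_mul_mem_h1 n hu), stuffle_one_right _ _ (z_mul_mem_h1 n hu)])
    (fun m hm v hv ihv => ?_)
  rw [stuffle_z hn hm hu hv, stuffle_z hm hn hv hu, ihu _ (z_mul_mem_h1 m hv), ihv, ihu _ hv,
    add_comm n m, add_comm (z k n * _)]

/-- Both bracketings reduce to the same seven terms, one for each nonempty subset of `{a, b, c}`:
the leading index is the sum over the subset, followed by the product of what is left. -/
theorem stuffle_assoc : ∀ u ∈ h1 k, ∀ v ∈ h1 k, ∀ w ∈ h1 k,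
    stuffle 0 (stuffle 0 u v) w = stuffle 0 u (stuffle 0 v w) := by
  refine h1_induction (fun u u' h h' v hv w hw => by simp [h v hv w hw, h' v hv w hw])
    (fun c u h v hv w hw => by simp [h v hv w hw])
    (fun v hv w hw => by
      rw [stuffle_one_left _ _ hv, stuffle_one_left _ _ (stuffle_mem_h1 0 hv hw)])
    (fun a ha u hu ihu => ?_)
  have hau := z_mul_mem_h1 a hu
  refine h1_induction (fun v v' h h' w hw => by simp [h w hw, h' w hw])
    (fun c v h w hw => by simp [h w hw])
    (fun w hw => by rw [stuffle_one_right _ _ hau, stuffle_one_left _ _ hw])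
    (fun b hb v hv ihv => ?_)
  have hbv := z_mul_mem_h1 b hv
  refine h1_induction (fun w w' h h' => by simp [h, h']) (fun c w h => by simp [h])
    (by rw [stuffle_one_right _ _ hbv, stuffle_one_right _ _ (stuffle_mem_h1 0 hau hbv)])
    (fun c hc w hw ihw => ?_)
  have hcw := z_mul_mem_h1 c hw
  have e1 : stuffle 0 (stuffle 0 (z k a * u) (z k b * v)) (z k c * w) =
      z k a * stuffle 0 u (stuffle 0 (z k b * v) (z k c * w))
      + z k b * stuffle 0 (z k a * u) (stuffle 0 v (z k c * w))
      + z k (a + b) * stuffle 0 u (stuffle 0 v (z k c * w))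
      + z k c * stuffle 0 (z k a * u) (stuffle 0 (z k b * v) w)
      + z k (a + c) * stuffle 0 u (stuffle 0 (z k b * v) w)
      + z k (b + c) * stuffle 0 (z k a * u) (stuffle 0 v w)
      + z k (a + b + c) * stuffle 0 u (stuffle 0 v w) := by
    -- `ihw` rebrackets the term led by `z_c`, the only one in which the first two factors are both
    -- intact.
    rw [← ihw, stuffle_z ha hb hu hv]
    simp only [map_add, LinearMap.add_apply]
    rw [stuffle_z ha hc (stuffle_mem_h1 0 hu hbv) hw, stuffle_z hb hc (stuffle_mem_h1 0 hau hv) hw,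
      stuffle_z (by omega : 1 ≤ a + b) hc (stuffle_mem_h1 0 hu hv) hw,
      ihu _ hbv _ hcw, ihv _ hcw, ihu _ hv _ hcw, ihu _ hbv _ hw, ihv _ hw, ihu _ hv _ hw]
    simp only [mul_add]
    abel
  have e2 : stuffle 0 (z k a * u) (stuffle 0 (z k b * v) (z k c * w)) =
      z k a * stuffle 0 u (stuffle 0 (z k b * v) (z k c * w))
      + z k b * stuffle 0 (z k a * u) (stuffle 0 v (z k c * w))
      + z k (a + b) * stuffle 0 u (stuffle 0 v (z k c * w))
      + z k c * stuffle 0 (z k a * u) (stuffle 0 (z k b * v) w)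
      + z k (a + c) * stuffle 0 u (stuffle 0 (z k b * v) w)
      + z k (b + c) * stuffle 0 (z k a * u) (stuffle 0 v w)
      + z k (a + b + c) * stuffle 0 u (stuffle 0 v w) := by
    rw [stuffle_z hb hc hv hw]
    simp only [map_add]
    rw [stuffle_z ha hb hu (stuffle_mem_h1 0 hv hcw), stuffle_z ha hc hu (stuffle_mem_h1 0 hbv hw),
      stuffle_z ha (by omega : 1 ≤ b + c) hu (stuffle_mem_h1 0 hv hw), add_assoc a b c]
    simp only [mul_add]
    abel
  rw [e1, e2]

theorem delY_z_one_mul (u : H k) : delY k (z k 1 * u) = u := by simp [z]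

theorem delY_z_mul {n : ℕ} (hn : 2 ≤ n) (u : H k) : delY k (z k n * u) = 0 := by
  rw [z_eq hn, mul_assoc, delY_x_mul]

/-- The contracted term `z_{n+m}` has `n + m ≥ 2`, so it starts with `x` and is deleted. The other
two terms behave as for the shuffle product. -/
theorem delY_stuffle : ∀ u ∈ h1 k, ∀ v ∈ h1 k,
    delY k (stuffle 0 u v) = stuffle 0 (delY k u) v + stuffle 0 u (delY k v) := by
  refine h1_induction
    (fun u u' h h' v hv => by
      simp only [map_add, LinearMap.add_apply, h v hv, h' v hv]; abel)
    (fun c u h v hv => by simp [h v hv])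
    (fun v hv => by
      simp [stuffle_one_left _ _ hv, stuffle_one_left _ _ (delY_mem_h1 v hv)])
    (fun n hn u hu ihu => ?_)
  clear ihu
  have hnu := z_mul_mem_h1 n hu
  refine h1_induction (fun v v' h h' => by simp only [map_add, h, h']; abel)
    (fun c v h => by simp [h])
    (by simp [stuffle_one_right _ _ hnu, stuffle_one_right _ _ (delY_mem_h1 _ hnu)])
    (fun m hm v hv ihv => ?_)
  rw [stuffle_z hn hm hu hv, map_add, map_add, delY_z_mul (by omega : 2 ≤ n + m), add_zero]
  rcases hn.eq_or_lt with rfl | hn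
  · rcases hm.eq_or_lt with rfl | hm
    · simp only [delY_z_one_mul]
    · simp only [delY_z_one_mul, delY_z_mul hm, map_zero]
  · rcases hm.eq_or_lt with rfl | hm
    · simp only [delY_z_one_mul, delY_z_mul hn, map_zero, LinearMap.zero_apply]
    · simp only [delY_z_mul hn, delY_z_mul hm, map_zero, LinearMap.zero_apply]

end Stuffle

/-! ### Polynomial structure from a derivation with a slice; regularization -/

section SliceProduct

variable {k : Type*} [CommRing k]

/-- A commutative algebra structure `(mul, 1)` on `𝔥¹` with subalgebra `𝔥⁰`, together with a locally
nilpotent derivation `d` with kernel `𝔥⁰` and `d y = 1`. -/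
structure SliceProduct (mul : h1 k → h1 k → h1 k) (d : h1 k →ₗ[k] h1 k) : Prop where
  add_left : ∀ u v w, mul (u + v) w = mul u w + mul v w
  smul_left : ∀ (c : k) u v, mul (c • u) v = c • mul u v
  comm : ∀ u v, mul u v = mul v u
  assoc : ∀ u v w, mul (mul u v) w = mul u (mul v w)
  one_mul : ∀ u, mul (one1 k) u = u
  mul_mem : ∀ a b : h0 k, ∃ c : h0 k, mul (incl k a) (incl k b) = incl k c
  leibniz : ∀ u v, d (mul u v) = mul (d u) v + mul u (d v)
  map_y : d (yPow k 1) = one1 k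
  ker : ∀ w, d w = 0 ↔ ∃ c, incl k c = w
  nilpotent : ∀ w, ∃ n, (d ^ n) w = 0

theorem incl_injective : Function.Injective (incl k) :=
  Submodule.inclusion_injective h0_le_h1

variable {mul : h1 k → h1 k → h1 k} {d : h1 k →ₗ[k] h1 k}

theorem pow_apply_seq {W : ℕ → h1 k} (hW : ∀ m, d (W (m + 1)) = W m) (n m : ℕ) :
    (d ^ n) (W (n + m)) = W m := by
  induction n with
  | zero => simp
  | succ n ih => rw [pow_succ, Module.End.mul_apply, add_right_comm, hW, ih]

namespace SliceProduct

variable (h : SliceProduct mul d)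
include h

/-- The product as a bilinear map. -/
def bilin : h1 k →ₗ[k] h1 k →ₗ[k] h1 k :=
  LinearMap.mk₂ k mul h.add_left h.smul_left
    (fun u v w => by rw [h.comm, h.add_left, h.comm v, h.comm w])
    (fun c u v => by rw [h.comm, h.smul_left, h.comm v])

theorem bilin_apply (u v : h1 k) : h.bilin u v = mul u v := rfl

theorem mul_one (u : h1 k) : mul u (one1 k) = u := by rw [h.comm, h.one_mul]

theorem mul_mul_mul_comm (a b c e : h1 k) :
    mul (mul a b) (mul c e) = mul (mul a c) (mul b e) := by
  rw [h.assoc, ← h.assoc b, h.comm b, h.assoc c, ← h.assoc]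

theorem d_incl (c : h0 k) : d (incl k c) = 0 := (h.ker _).2 ⟨c, rfl⟩

theorem d_one : d (one1 k) = 0 := h.d_incl (one0 k)

theorem d_incl_mul (c : h0 k) (u : h1 k) : d (mul (incl k c) u) = mul (incl k c) (d u) := by
  rw [h.leibniz, h.d_incl, ← h.bilin_apply 0, map_zero, LinearMap.zero_apply, zero_add]

theorem pow_incl_mul (n : ℕ) (c : h0 k) (u : h1 k) :
    (d ^ n) (mul (incl k c) u) = mul (incl k c) ((d ^ n) u) := by
  induction n generalizing u with
  | zero => simp
  | succ n ih => rw [pow_succ, Module.End.mul_apply, h.d_incl_mul, ih]; rfl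

/-- `𝔥¹` is spanned over `𝔥⁰` by any sequence of divided powers with respect to `d`. -/
theorem mem_of_seq {W : ℕ → h1 k} (h0 : W 0 = one1 k) (hW : ∀ m, d (W (m + 1)) = W m)
    (q : Submodule k (h1 k)) (hq : ∀ m c, mul (incl k c) (W m) ∈ q) (w : h1 k) : w ∈ q := by
  obtain ⟨n, hn⟩ := h.nilpotent w
  induction n generalizing w with
  | zero => simp at hn; rw [hn]; exact zero_mem _
  | succ n ih =>
    rw [pow_succ', Module.End.mul_apply] at hn
    obtain ⟨c, hc⟩ := (h.ker _).1 hn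
    -- The top derivative of `w` is some `c ∈ 𝔥⁰`, and `c • W n` has the same `n`-th derivative, so
    -- subtracting it lowers the order of nilpotency.
    have := ih (w - mul (incl k c) (W n)) (by
      have e := pow_apply_seq hW n 0
      rw [map_sub, h.pow_incl_mul, ← hc]
      rw [add_zero] at e
      rw [e, h0, h.mul_one, sub_self])
    simpa using add_mem this (hq n c)

theorem yProdPow_add (i j : ℕ) :
    mul (yProdPow mul i) (yProdPow mul j) = yProdPow mul (i + j) := by
  induction i with
  | zero => rw [yProdPow, h.one_mul, zero_add]
  | succ i ih => rw [yProdPow, h.assoc, ih, add_right_comm, yProdPow]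

theorem d_yProdPow (i : ℕ) : d (yProdPow mul (i + 1)) = ((i + 1 : ℕ) : k) • yProdPow mul i := by
  induction i with
  | zero => simp [yProdPow, h.mul_one, h.map_y]
  | succ i ih =>
    rw [yProdPow, h.leibniz, h.map_y, h.one_mul, ih, ← h.bilin_apply, map_smul, h.bilin_apply]
    change yProdPow mul (i + 1) + _ • yProdPow mul (i + 1) = _
    push_cast
    module

/-- `∑ᵢ cᵢ • y^{• i}` as a linear function of `c`. -/
def expand : (ℕ →₀ h0 k) →ₗ[k] h1 k :=
  Finsupp.lsum k fun i => h.bilin.flip (yProdPow mul i) ∘ₗ incl k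

theorem expand_apply (c : ℕ →₀ h0 k) :
    h.expand c = c.sum fun i wi => mul (incl k wi) (yProdPow mul i) := by
  rw [expand, Finsupp.lsum_apply]; rfl

theorem expand_single (i : ℕ) (c : h0 k) :
    h.expand (Finsupp.single i c) = mul (incl k c) (yProdPow mul i) := by
  rw [expand, Finsupp.lsum_single]; rfl

theorem pow_yProdPow (n : ℕ) : (d ^ n) (yProdPow mul n) = (n.factorial : k) • one1 k := by
  induction n with
  | zero => simp [yProdPow]
  | succ n ih =>
    rw [pow_succ, Module.End.mul_apply, h.d_yProdPow, map_smul, ih, smul_smul, Nat.factorial_succ]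
    push_cast; rfl

theorem pow_yProdPow_of_lt {i n : ℕ} (hi : i < n) : (d ^ n) (yProdPow mul i) = 0 := by
  obtain ⟨m, rfl⟩ := Nat.exists_eq_add_of_lt hi
  rw [show i + m + 1 = m + 1 + i by omega, pow_add, Module.End.mul_apply, h.pow_yProdPow,
    map_smul, pow_succ, Module.End.mul_apply, h.d_one, map_zero, smul_zero]

variable [Algebra ℚ k]

/-- Makes `mem_of_seq` applicable to the powers of `y`; the division by `m!` needs the rational
scalars. -/
theorem divided_yProdPow (m : ℕ) :
    d (algebraMap ℚ k (m + 1).factorial⁻¹ • yProdPow mul (m + 1)) =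
      algebraMap ℚ k (m.factorial : ℚ)⁻¹ • yProdPow mul m := by
  rw [map_smul, h.d_yProdPow, smul_smul, ← map_natCast (algebraMap ℚ k), ← map_mul]
  congr 2
  rw [Nat.factorial_succ]
  have : (m.factorial : ℚ) ≠ 0 := by positivity
  have : ((m : ℚ) + 1) ≠ 0 := by positivity
  push_cast
  field_simp

theorem expand_surjective : Function.Surjective h.expand := by
  intro w
  rw [← LinearMap.mem_range]
  refine h.mem_of_seq (W := fun m => algebraMap ℚ k (m.factorial : ℚ)⁻¹ • yProdPow mul m)
    (by simp [yProdPow]) h.divided_yProdPow _ (fun m c => ?_) w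
  rw [← h.bilin_apply, map_smul, h.bilin_apply]
  exact Submodule.smul_mem _ _ ⟨_, h.expand_single m c⟩

theorem expand_injective : Function.Injective h.expand := by
  rw [injective_iff_map_eq_zero]
  intro c hc
  by_contra hne
  have hs : c.support.Nonempty := Finsupp.support_nonempty_iff.2 hne
  set n := c.support.max' hs with hn
  have hmem : n ∈ c.support := Finset.max'_mem _ _
  -- With `n` the top degree, `dⁿ` kills all lower terms and returns `n!` times the top coefficient.
  have e : (d ^ n) (h.expand c) = (n.factorial : k) • incl k (c n) := by
    rw [expand_apply, Finsupp.sum, map_sum, Finset.sum_eq_single n]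
    · rw [h.pow_incl_mul, h.pow_yProdPow, ← h.bilin_apply, map_smul, h.bilin_apply, h.mul_one]
    · intro i hi hin
      have : i < n := lt_of_le_of_ne (Finset.le_max' _ _ hi) hin
      rw [h.pow_incl_mul, h.pow_yProdPow_of_lt this, ← h.bilin_apply, map_zero]
    · intro hn; exact absurd hmem hn
  rw [hc, map_zero] at e
  have e2 : incl k (c n) = 0 := by
    have hu : algebraMap ℚ k (n.factorial : ℚ)⁻¹ * (n.factorial : k) = 1 := by
      rw [← map_natCast (algebraMap ℚ k), ← map_mul,
        inv_mul_cancel₀ (by exact_mod_cast n.factorial_ne_zero), map_one]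
    rw [← one_smul k (incl k (c n)), ← hu, mul_smul, ← e, smul_zero]
  exact (Finsupp.mem_support_iff.1 hmem) (incl_injective (by rw [e2, map_zero]))

/-- The linear equivalence between `𝔥¹` and coefficient sequences in `𝔥⁰`. -/
def equiv : (ℕ →₀ h0 k) ≃ₗ[k] h1 k :=
  LinearEquiv.ofBijective h.expand ⟨h.expand_injective, h.expand_surjective⟩

/-- Existence and uniqueness of the expansion pin down the arbitrary choice made in `reg`. -/
theorem reg_eq (w : h1 k) : reg mul w = h.equiv.symm w 0 := by
  have hex : ∃ c, IsExpansion mul w c :=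
    ⟨h.equiv.symm w, by
      rw [IsExpansion, ← h.expand_apply]; exact (h.equiv.apply_symm_apply w).symm⟩
  have := Classical.epsilon_spec hex
  rw [IsExpansion, ← h.expand_apply] at this
  rw [reg]
  congr 1
  exact ((LinearEquiv.symm_apply_eq _).2 this).symm

variable {S : Type*} [CommRing S] [Algebra k S] {ζ : h0 k →ₗ[k] S}

theorem regHom_unique {F G : h1 k →ₗ[k] S[X]} (hF : IsRegHom mul ζ F) (hG : IsRegHom mul ζ G) :
    F = G := by
  have hP : ∀ m, F (yProdPow mul m) = G (yProdPow mul m) := by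
    intro m
    induction m with
    | zero => rw [yProdPow, hF.map_one, hG.map_one]
    | succ m ih => rw [yProdPow, hF.map_mul, hG.map_mul, ih, hF.map_y, hG.map_y]
  ext1 w
  obtain ⟨c, rfl⟩ := h.expand_surjective w
  rw [expand_apply, Finsupp.sum, map_sum, map_sum]
  exact Finset.sum_congr rfl fun i _ => by
    rw [hF.map_mul, hG.map_mul, hF.restrict, hG.restrict, hP]

/-- The homomorphism is `∑ cᵢ • y^{• i} ↦ ∑ ζ(cᵢ) Tⁱ`. Multiplicativity of `ζ` is phrased through a
witness `c`, since `mul` takes values in `𝔥¹` only. -/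
theorem exists_isRegHom (h1 : ζ (one0 k) = 1)
    (hζ : ∀ a b c, mul (incl k a) (incl k b) = incl k c → ζ c = ζ a * ζ b) :
    ∃ F : TMZV.h1 k →ₗ[k] S[X], IsRegHom mul ζ F := by
  let Φ : (ℕ →₀ h0 k) →ₗ[k] S[X] :=
    Finsupp.lsum k fun i => ((Polynomial.monomial i).restrictScalars k) ∘ₗ ζ
  let F := Φ ∘ₗ h.equiv.symm.toLinearMap
  have hF : ∀ i c, F (mul (incl k c) (yProdPow mul i)) = Polynomial.monomial i (ζ c) := by
    intro i c
    rw [← h.expand_single]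
    change Φ (h.equiv.symm (h.equiv _)) = _
    rw [LinearEquiv.symm_apply_apply, Finsupp.lsum_single]; rfl
  have hF1 : F (one1 k) = 1 := by
    have := hF 0 (one0 k)
    rw [yProdPow, h.mul_one, h1] at this
    exact this
  refine ⟨F, hF1, fun u v => ?_, fun w => ?_, ?_⟩
  · obtain ⟨c, rfl⟩ := h.expand_surjective u
    obtain ⟨e, rfl⟩ := h.expand_surjective v
    rw [expand_apply, expand_apply, Finsupp.sum, Finsupp.sum, ← h.bilin_apply,
      map_sum h.bilin, LinearMap.sum_apply, map_sum F, map_sum F, Finset.sum_mul]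
    refine Finset.sum_congr rfl fun i _ => ?_
    rw [map_sum, map_sum, map_sum, Finset.mul_sum]
    refine Finset.sum_congr rfl fun j _ => ?_
    obtain ⟨f, hf⟩ := h.mul_mem (c i) (e j)
    rw [h.bilin_apply, h.mul_mul_mul_comm, h.yProdPow_add, hf, hF, hF, hF,
      Polynomial.monomial_mul_monomial, hζ _ _ _ hf]
  · have := hF 0 w
    rwa [yProdPow, h.mul_one] at this
  · have := hF 1 (one0 k)
    rw [yProdPow, yProdPow, h.mul_one, h1] at this
    change F (mul (one1 k) _) = _ at this
    rw [h.one_mul] at this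
    exact this

theorem isRegHom_regHom (h1 : ζ (one0 k) = 1)
    (hζ : ∀ a b c, mul (incl k a) (incl k b) = incl k c → ζ c = ζ a * ζ b) :
    IsRegHom mul ζ (regHom mul ζ) :=
  Classical.epsilon_spec (h.exists_isRegHom h1 hζ)

/-- A homomorphism sends `∑ wᵢ • y^{• i}` to `∑ ζ(wᵢ) Tⁱ`, whose constant term is `ζ(w₀)`. This
turns conditions on `reg` into conditions at `T = 0`. -/
theorem apply_reg {F : h1 k →ₗ[k] S[X]} (hF : IsRegHom mul ζ F) (w : h1 k) :
    ζ (reg mul w) = (F w).eval 0 := by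
  rw [h.reg_eq]
  obtain ⟨c, rfl⟩ := h.equiv.surjective w
  rw [LinearEquiv.symm_apply_apply]
  change _ = (F (h.expand c)).eval 0
  have hP : ∀ m, F (yProdPow mul m) = X ^ m := by
    intro m
    induction m with
    | zero => rw [yProdPow, hF.map_one, pow_zero]
    | succ m ih => rw [yProdPow, hF.map_mul, ih, hF.map_y, pow_succ']
  rw [expand_apply, Finsupp.sum, map_sum, Polynomial.eval_finsetSum]
  simp only [hF.map_mul, hF.restrict, hP, Polynomial.eval_mul, Polynomial.eval_C,
    Polynomial.eval_pow, Polynomial.eval_X]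
  rw [Finset.sum_eq_single 0]
  · simp
  · intro i _ hi; simp [hi]
  · intro h0; simp [Finsupp.notMem_support_iff.1 h0]

end SliceProduct

theorem delY_pow_restrict (n : ℕ) (w : h1 k) :
    ((((delY k).restrict delY_mem_h1) ^ n) w : H k) = (delY k ^ n) w := by
  induction n generalizing w with
  | zero => rfl
  | succ n ih => rw [pow_succ, pow_succ, Module.End.mul_apply, Module.End.mul_apply, ih]; rfl

variable (k) in
/-- Left deletion of `y` on `𝔥¹`. -/
def del1 : h1 k →ₗ[k] h1 k := (delY k).restrict delY_mem_h1

theorem del1_coe (w : h1 k) : (del1 k w : H k) = delY k w := rfl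

theorem del1_ker (w : h1 k) : del1 k w = 0 ↔ ∃ c, incl k c = w := by
  rw [← Subtype.coe_inj, del1_coe]
  constructor
  · intro h
    exact ⟨⟨w, mem_h0_of_delY_eq_zero w.2 h⟩, rfl⟩
  · rintro ⟨c, rfl⟩
    exact delY_eq_zero_of_mem_h0 c.2

theorem del1_nilpotent (w : h1 k) : ∃ n, (del1 k ^ n) w = 0 := by
  obtain ⟨n, hn⟩ := exists_delY_pow_eq_zero (w : H k)
  exact ⟨n, Subtype.ext ((delY_pow_restrict n w).trans (hn n le_rfl))⟩

/-- The concatenation powers of `y` are divided powers with respect to the derivation, whichever of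
the two products is used. -/
theorem del1_yPow (m : ℕ) : del1 k (yPow k (m + 1)) = yPow k m := by
  refine Subtype.ext ?_
  change delY k (ltr k .y ^ (m + 1)) = ltr k .y ^ m
  rw [pow_succ', delY_y_mul]

theorem yPow_zero : yPow k 0 = one1 k := Subtype.ext (pow_zero _)

theorem sliceProduct_shuffle : SliceProduct (shuffle1 (0 : k)) (del1 k) where
  add_left u v w := Subtype.ext (by simp [shuffle1])
  smul_left c u v := Subtype.ext (by simp [shuffle1])
  comm u v := Subtype.ext (shuffle_comm _ _)
  assoc u v w := Subtype.ext (shuffle_assoc _ _ _)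
  one_mul u := Subtype.ext (shuffle_one_left _ _)
  mul_mem a b := ⟨shuffle0 0 a b, rfl⟩
  leibniz u v := Subtype.ext (delY_shuffle _ _)
  map_y := (del1_yPow 0).trans yPow_zero
  ker := del1_ker
  nilpotent := del1_nilpotent

theorem sliceProduct_stuffle : SliceProduct (stuffle1 (0 : k)) (del1 k) where
  add_left u v w := Subtype.ext (by simp [stuffle1])
  smul_left c u v := Subtype.ext (by simp [stuffle1])
  comm u v := Subtype.ext (stuffle_comm _ u.2 _ v.2)
  assoc u v w := Subtype.ext (stuffle_assoc _ u.2 _ v.2 _ w.2)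
  one_mul u := Subtype.ext (stuffle_one_left _ _ u.2)
  mul_mem a b := ⟨stuffle0 0 a b, rfl⟩
  leibniz u v := Subtype.ext (delY_stuffle _ u.2 _ v.2)
  map_y := (del1_yPow 0).trans yPow_zero
  ker := del1_ker
  nilpotent := del1_nilpotent

/-- Transport of the structure along a linear automorphism preserving `1`, `y` and `𝔥⁰`. -/
theorem SliceProduct.transport {mul' : h1 k → h1 k → h1 k} (h : SliceProduct mul d)
    (e : h1 k ≃ₗ[k] h1 k) (e0 : h0 k ≃ₗ[k] h0 k) (he0 : ∀ c, e (incl k c) = incl k (e0 c))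
    (he1 : e0 (one0 k) = one0 k) (hey : e (yPow k 1) = yPow k 1)
    (hmul : ∀ u v, e (mul' u v) = mul (e u) (e v)) :
    SliceProduct mul' (e.symm.toLinearMap ∘ₗ d ∘ₗ e.toLinearMap) := by
  have he1' : e (one1 k) = one1 k := by
    have := he0 (one0 k)
    rw [he1] at this
    exact this
  have hpow : ∀ n w, ((e.symm.toLinearMap ∘ₗ d ∘ₗ e.toLinearMap) ^ n) w = e.symm ((d ^ n) (e w)) := by
    intro n
    induction n with
    | zero => simp
    | succ n ih => intro w; rw [pow_succ, Module.End.mul_apply, ih, pow_succ]; simp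
  have hmul' : ∀ u v, mul' u v = e.symm (mul (e u) (e v)) := fun u v => by
    rw [← hmul, LinearEquiv.symm_apply_apply]
  refine ⟨?_, ?_, ?_, ?_, ?_, ?_, ?_, ?_, ?_, ?_⟩
  · intro u v w; simp only [hmul', map_add, h.add_left]
  · intro c u v; simp only [hmul', map_smul, h.smul_left]
  · intro u v; rw [hmul', hmul', h.comm]
  · intro u v w; simp only [hmul', LinearEquiv.apply_symm_apply, h.assoc]
  · intro u; rw [hmul', he1', h.one_mul, LinearEquiv.symm_apply_apply]
  · intro a b
    obtain ⟨c, hc⟩ := h.mul_mem (e0 a) (e0 b)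
    refine ⟨e0.symm c, ?_⟩
    rw [hmul', he0, he0, hc, LinearEquiv.symm_apply_eq, he0, LinearEquiv.apply_symm_apply]
  · intro u v
    simp only [LinearMap.comp_apply, LinearEquiv.coe_coe, hmul', LinearEquiv.apply_symm_apply,
      h.leibniz, map_add]
  · simp only [LinearMap.comp_apply, LinearEquiv.coe_coe]
    rw [hey, h.map_y, LinearEquiv.symm_apply_eq, he1']
  · intro w
    simp only [LinearMap.comp_apply, LinearEquiv.coe_coe]
    rw [LinearEquiv.symm_apply_eq, map_zero, h.ker]
    constructor
    · rintro ⟨c, hc⟩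
      exact ⟨e0.symm c, by apply e.injective; rw [he0, LinearEquiv.apply_symm_apply, hc]⟩
    · rintro ⟨c, rfl⟩
      exact ⟨e0 c, (he0 c).symm⟩
  · intro w
    obtain ⟨n, hn⟩ := h.nilpotent (e w)
    exact ⟨n, by rw [hpow, hn, map_zero]⟩

end SliceProduct

/-! ### `S_t` carries the `t`-products to the usual products -/

section Interpolation

variable {k : Type*} [CommRing k]

variable (k) in
/-- The constant term. -/
def augm : H k →ₐ[k] k := FreeAlgebra.lift k fun _ => 0

@[simp] theorem augm_ltr (a : Letter) : augm k (ltr k a) = 0 := by simp [augm]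

@[simp] theorem augm_z (n : ℕ) : augm k (z k n) = 0 := by simp [z]

theorem augm_of_mem_hy {u : H k} (hu : u ∈ hy k) : augm k u = 0 := by
  obtain ⟨v, rfl⟩ := mem_hy.1 hu
  simp

/-- Obtained from `h1_induction` applied to `u - ε(u)·1`, with `ε` the constant term. -/
theorem hy_induction {p : H k → Prop} (hadd : ∀ u v, p u → p v → p (u + v))
    (hsmul : ∀ (c : k) u, p u → p (c • u))
    (hmul : ∀ n, 1 ≤ n → ∀ u ∈ h1 k, p (z k n * u)) : ∀ u ∈ hy k, p u := by
  have h0 : p 0 := by simpa using hsmul 0 _ (hmul 1 le_rfl 1 one_mem_h1)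
  have key : ∀ u ∈ h1 k, p (u - augm k u • 1) := by
    refine h1_induction (fun u v hu hv => ?_) (fun c u hu => ?_) (by simpa using h0)
      (fun n hn u hu _ => by simpa using hmul n hn u hu)
    · have := hadd _ _ hu hv
      rw [map_add, add_smul]
      convert this using 1
      abel
    · have := hsmul c _ hu
      rw [map_smul, smul_assoc, ← smul_sub]
      exact this
  intro u hu
  have := key u (hy_le_h1 hu)
  rwa [augm_of_mem_hy hu, zero_smul, sub_zero] at this

@[simp] theorem sigmaHom_x (t : k) : sigmaHom t (ltr k .x) = ltr k .x := by simp [sigmaHom]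

@[simp] theorem sigmaHom_y (t : k) :
    sigmaHom t (ltr k .y) = t • ltr k .x + ltr k .y := by simp [sigmaHom]

theorem sigmaHom_neg_comp (t : k) (u : H k) : sigmaHom (-t) (sigmaHom t u) = u := by
  have : (sigmaHom (-t)).comp (sigmaHom t) = AlgHom.id k (H k) := by
    refine FreeAlgebra.hom_ext (funext fun a => ?_)
    cases a <;> simp
  exact DFunLike.congr_fun this u

theorem word_mul_ltr (w : List Letter) (a : Letter) :
    word k w * ltr k a = word k (w ++ [a]) := by simp [word_append]

/-- `S_t` is `σ_t` on all letters but the last. If `v` has no constant term, the last letter lies in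
`v`; the constant part of `v` leaves it in `u`, which is what the correction accounts for. -/
theorem S_mul (t : k) (u v : H k) :
    S t (u * v) = sigmaHom t u * S t v + augm k v • (S t u - sigmaHom t u) := by
  have h : S t ∘ₗ LinearMap.mulLeft k u =
      LinearMap.mulLeft k (sigmaHom t u) ∘ₗ S t
        + (augm k).toLinearMap.smulRight (S t u - sigmaHom t u) := ext_word fun w => by
    rcases List.eq_nil_or_concat w with rfl | ⟨w, a, rfl⟩
    · simp [S_one]
    · rw [List.concat_eq_append, ← word_mul_ltr]
      simp only [LinearMap.comp_apply, LinearMap.mulLeft_apply, LinearMap.add_apply,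
        LinearMap.smulRight_apply, AlgHom.toLinearMap_apply, map_mul, augm_ltr, mul_zero,
        zero_smul, add_zero]
      rw [← mul_assoc, S_mul_letter, S_mul_letter, map_mul, mul_assoc]
  exact LinearMap.congr_fun h v

theorem S_mul_of_augm (t : k) (u : H k) {v : H k} (hv : augm k v = 0) :
    S t (u * v) = sigmaHom t u * S t v := by rw [S_mul, hv, zero_smul, add_zero]

theorem S_ltr (t : k) (a : Letter) : S t (ltr k a) = ltr k a := by
  simpa using S_mul_letter t 1 a

theorem S_neg_comp (t : k) (u : H k) : S (-t) (S t u) = u := by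
  have h : S (-t) ∘ₗ S t = LinearMap.id := ext_word fun w => by
    rcases List.eq_nil_or_concat w with rfl | ⟨w, a, rfl⟩
    · simp [S_one]
    · rw [List.concat_eq_append, ← word_mul_ltr, LinearMap.comp_apply, S_mul_letter, S_mul_letter,
        sigmaHom_neg_comp, LinearMap.id_apply]
  exact LinearMap.congr_fun h u

theorem S_comp_neg (t : k) (u : H k) : S t (S (-t) u) = u := by
  simpa using S_neg_comp (-t) u

theorem S_mem_hy (t : k) {u : H k} (hu : u ∈ hy k) : S t u ∈ hy k := by
  obtain ⟨v, rfl⟩ := mem_hy.1 hu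
  rw [S_mul_letter]
  exact mul_y_mem_hy _

theorem S_mem_h1 (t : k) : ∀ u ∈ h1 k, S t u ∈ h1 k := by
  intro u hu
  obtain ⟨c, u, rfl⟩ := mem_h1.1 hu
  rw [map_add, map_smul, S_one, S_mul_letter]
  exact mem_h1.2 ⟨c, _, rfl⟩

/-- `S_t` as an automorphism of `𝔥¹`. -/
def S1 (t : k) : h1 k ≃ₗ[k] h1 k :=
  LinearEquiv.ofLinearMap ((S t).restrict (S_mem_h1 t)) ((S (-t)).restrict (S_mem_h1 (-t)))
    (by ext1 u; exact Subtype.ext (S_comp_neg t u))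
    (by ext1 u; exact Subtype.ext (S_neg_comp t u))

theorem S1_coe (t : k) (u : h1 k) : (S1 t u : H k) = S t u := rfl

/-- `S_t` as an automorphism of `𝔥⁰`. -/
def S0Equiv (t : k) : h0 k ≃ₗ[k] h0 k :=
  LinearEquiv.ofLinearMap (S0 t) (S0 (-t))
    (by ext1 u; exact Subtype.ext (S_comp_neg t u))
    (by ext1 u; exact Subtype.ext (S_neg_comp t u))

theorem S0_comp_neg (t : k) (u : h0 k) : S0 t (S0 (-t) u) = u := Subtype.ext (S_comp_neg t u)

theorem S1_incl (t : k) (c : h0 k) : S1 t (incl k c) = incl k (S0 t c) := rfl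

theorem S0_one (t : k) : S0 t (one0 k) = one0 k := Subtype.ext (S_one t)

theorem yPow_coe (m : ℕ) : (yPow k m : H k) = ltr k .y ^ m := rfl

theorem S1_y (t : k) : S1 t (yPow k 1) = yPow k 1 := by
  refine Subtype.ext ?_
  rw [S1_coe, yPow_coe, pow_one, S_ltr]

/-- The shuffle recursion is linear in each leading letter, so it survives the substitution of
`σ_t(a)` and `σ_t(b)`. -/
theorem shuffle_sigmaHom_letter (t : k) (a b : Letter) (u v : H k) :
    shuffle 0 (sigmaHom t (ltr k a) * u) (sigmaHom t (ltr k b) * v) =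
      sigmaHom t (ltr k a) * shuffle 0 u (sigmaHom t (ltr k b) * v)
        + sigmaHom t (ltr k b) * shuffle 0 (sigmaHom t (ltr k a) * u) v := by
  cases a <;> cases b <;>
    simp only [sigmaHom_x, sigmaHom_y, add_mul, smul_mul_assoc, map_add, map_smul,
      LinearMap.add_apply, LinearMap.smul_apply, shuffle_letter, mul_add, mul_smul_comm] <;>
    module

/-- The case where the left factor is a single letter, which `S_t` leaves unchanged because it is a
last letter. -/
theorem shuffle_letter_sigmaHom (t : k) (a b : Letter) (v : H k) :
    shuffle 0 (ltr k a) (sigmaHom t (ltr k b) * v) =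
      ltr k a * (sigmaHom t (ltr k b) * v)
        + sigmaHom t (ltr k b) * shuffle 0 (ltr k a) v := by
  have h : ∀ c, shuffle 0 (ltr k a) (ltr k c * v) =
      ltr k a * (ltr k c * v) + ltr k c * shuffle 0 (ltr k a) v := fun c => by
    simpa [shuffle_one_left] using shuffle_letter a c 1 v
  cases b
  · simp only [sigmaHom_x, h]
  · simp only [sigmaHom_y, add_mul, smul_mul_assoc, map_add, map_smul, h, mul_add, mul_smul_comm]
    module

theorem shuffle_letter_letter (a b : Letter) :
    shuffle 0 (ltr k a) (ltr k b) = ltr k a * ltr k b + ltr k b * ltr k a := by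
  simpa [shuffle_one_left, shuffle_one_right] using shuffle_letter a b (1 : H k) 1

theorem rhoLetter_eq (t : k) (a : Letter) : rhoLetter t a = sigmaHom t (ltr k a) - ltr k a := by
  cases a <;> simp [rhoLetter]

theorem sigmaHom_rhoLetter (t : k) (a : Letter) :
    sigmaHom t (rhoLetter t a) = rhoLetter t a := by
  cases a <;> simp [rhoLetter]

theorem augm_word {w : List Letter} (hw : w ≠ []) : augm k (word k w) = 0 := by
  obtain ⟨a, w, rfl⟩ := List.exists_cons_of_ne_nil hw
  simp

theorem augm_rhoLetter (t : k) (a : Letter) : augm k (rhoLetter t a) = 0 := by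
  cases a <;> simp [rhoLetter]

theorem augm_shuffleWord (t : k) (u v : List Letter) (h : u ≠ [] ∨ v ≠ []) :
    augm k (shuffleWord t u v) = 0 := by
  rcases u with _ | ⟨a, u⟩
  · rw [shuffleWord]; exact augm_word (by simpa using h)
  · rcases v with _ | ⟨b, v⟩
    · rw [shuffleWord]; exact augm_word (by simp)
    · rw [shuffleWord]
      split_ifs <;> simp [augm_rhoLetter]

/-- If `u` is empty, the `t`-recursion applied through `S_t` produces `σ_t(a)`, whereas the last
letter `a` should stay fixed. The discrepancy is `σ_t(a) - a = ρ(a)`, exactly the `δ`-term of the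
`t`-shuffle product; likewise for `v`. Hence four cases. -/
theorem S_shuffleWord (t : k) : ∀ u v : List Letter,
    S t (shuffleWord t u v) = shuffle 0 (S t (word k u)) (S t (word k v))
  | [], v => by rw [shuffleWord, word_nil, S_one, shuffle_one_left]
  | a :: u, [] => by rw [shuffleWord, word_nil, S_one, shuffle_one_right]
  | a :: u, b :: v => by
      have ih1 := S_shuffleWord t u (b :: v)
      have ih2 := S_shuffleWord t (a :: u) v
      have hS : ∀ a (w : List Letter), w ≠ [] →
          S t (ltr k a * word k w) = sigmaHom t (ltr k a) * S t (word k w) :=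
        fun a w hw => S_mul_of_augm t _ (augm_word hw)
      have hρ : ∀ a b (w : List Letter), S t (rhoLetter t a * (ltr k b * word k w)) =
          rhoLetter t a * S t (ltr k b * word k w) := fun a b w => by
        rw [S_mul_of_augm t _ (by simp), sigmaHom_rhoLetter]
      rw [shuffleWord, map_sub, map_sub, map_add,
        S_mul_of_augm t _ (augm_shuffleWord t _ _ (by simp)),
        S_mul_of_augm t _ (augm_shuffleWord t _ _ (by simp)), ih1, ih2]
      simp only [word_cons]
      by_cases hu : u = [] <;> by_cases hv : v = []
      · subst hu hv
        simp only [if_true, hρ]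
        simp only [word_nil, mul_one, S_ltr, S_one, shuffle_one_left, shuffle_one_right,
          shuffle_letter_letter, rhoLetter_eq]
        noncomm_ring
      · subst hu
        simp only [if_true, if_neg hv, hρ, hS _ _ hv, map_zero]
        simp only [word_nil, mul_one, S_ltr, S_one, shuffle_one_left,
          shuffle_letter_sigmaHom, rhoLetter_eq]
        noncomm_ring
      · subst hv
        simp only [if_true, if_neg hu, hρ, hS _ _ hu, map_zero]
        simp only [word_nil, mul_one, S_ltr, S_one, shuffle_one_right]
        rw [shuffle_comm _ (ltr k b), shuffle_comm _ (ltr k b),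
          shuffle_letter_sigmaHom, rhoLetter_eq]
        noncomm_ring
      · simp only [if_neg hu, if_neg hv, hS _ _ hu, hS _ _ hv, map_zero, sub_zero]
        rw [shuffle_sigmaHom_letter]
  termination_by u v => u.length + v.length

theorem S_shuffle (t : k) (u v : H k) : S t (shuffle t u v) = shuffle 0 (S t u) (S t v) := by
  have h := bilinear_mem ((shuffle t).compr₂ (S t) - (shuffle 0).compl₁₂ (S t) (S t)) ⊥
    (fun u v => by
      rw [Submodule.mem_bot, LinearMap.sub_apply, LinearMap.sub_apply, LinearMap.compr₂_apply,
        LinearMap.compl₁₂_apply, sub_eq_zero, ← S_shuffleWord, shuffle, bilinExt_word]) u v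
  rwa [Submodule.mem_bot, LinearMap.sub_apply, LinearMap.sub_apply, LinearMap.compr₂_apply,
    LinearMap.compl₁₂_apply, sub_eq_zero] at h

theorem S1_shuffle1 (t : k) (u v : h1 k) :
    S1 t (shuffle1 t u v) = shuffle1 0 (S1 t u) (S1 t v) := Subtype.ext (S_shuffle t u v)

theorem x_pow_mul_z (a : ℕ) {b : ℕ} (hb : 1 ≤ b) : ltr k .x ^ a * z k b = z k (a + b) := by
  rw [z, z, ← mul_assoc, ← pow_add, Nat.add_sub_assoc hb]

theorem x_pow_mul_z_mul (a : ℕ) {b : ℕ} (hb : 1 ≤ b) (u : H k) :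
    ltr k .x ^ a * (z k b * u) = z k (a + b) * u := by
  rw [← mul_assoc, x_pow_mul_z a hb]

theorem x_pow_mul_x_pow_mul (a b : ℕ) (u : H k) :
    ltr k .x ^ a * (ltr k .x ^ b * u) = ltr k .x ^ (a + b) * u := by
  rw [← mul_assoc, pow_add]

/-- Left multiplication by `xᵃ` raises the first index of `u` by `a`. Expanding both `xᵃu * z_b v`
and `xᵃ(u * z_b v)` by the recursion, the contracted terms agree; the latter has the surplus
`z_{a+b}(u * v)`, whence the minus sign. -/
theorem stuffle_x_pow_z (a : ℕ) {b : ℕ} (hb : 1 ≤ b) {v : H k} (hv : v ∈ h1 k) :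
    ∀ u ∈ hy k, stuffle 0 (ltr k .x ^ a * u) (z k b * v) =
      ltr k .x ^ a * stuffle 0 u (z k b * v) + z k b * stuffle 0 (ltr k .x ^ a * u) v
        - z k (a + b) * stuffle 0 u v := by
  refine hy_induction (fun u u' h h' => ?_) (fun c u h => ?_) (fun n hn u hu => ?_)
  · simp only [mul_add, map_add, LinearMap.add_apply, h, h']; abel
  · simp only [mul_smul_comm, map_smul, LinearMap.smul_apply, h, smul_sub, smul_add]
  · have han : 1 ≤ a + n := by omega
    rw [x_pow_mul_z_mul a hn, stuffle_z han hb hu hv, stuffle_z hn hb hu hv, mul_add, mul_add,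
      x_pow_mul_z_mul a hn, x_pow_mul_z_mul a hb, x_pow_mul_z_mul a (by omega : 1 ≤ n + b),
      add_assoc a n b]
    abel

theorem stuffle_x_pow_x_pow (a b : ℕ) :
    ∀ u ∈ hy k, ∀ v ∈ hy k, stuffle 0 (ltr k .x ^ a * u) (ltr k .x ^ b * v) =
      ltr k .x ^ a * stuffle 0 u (ltr k .x ^ b * v)
        + ltr k .x ^ b * stuffle 0 (ltr k .x ^ a * u) v
        - ltr k .x ^ (a + b) * stuffle 0 u v := by
  refine hy_induction (fun u u' h h' v hv => ?_) (fun c u h v hv => ?_) (fun n hn u hu => ?_)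
  · simp only [mul_add, map_add, LinearMap.add_apply, h v hv, h' v hv]; abel
  · simp only [mul_smul_comm, map_smul, LinearMap.smul_apply, h v hv, smul_sub, smul_add]
  · refine hy_induction (fun v v' h h' => ?_) (fun c v h => ?_) (fun m hm v hv => ?_)
    · simp only [mul_add, map_add, h, h']; abel
    · simp only [mul_smul_comm, map_smul, h, smul_sub, smul_add]
    · have han : 1 ≤ a + n := by omega
      have hbm : 1 ≤ b + m := by omega
      rw [x_pow_mul_z_mul a hn, x_pow_mul_z_mul b hm, stuffle_z han hbm hu hv,
        stuffle_z hn hbm hu hv, stuffle_z han hm hu hv, stuffle_z hn hm hu hv]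
      simp only [mul_add]
      rw [x_pow_mul_z_mul a hn, x_pow_mul_z_mul a hbm,
        x_pow_mul_z_mul a (by omega : 1 ≤ n + (b + m)), x_pow_mul_z_mul b han,
        x_pow_mul_z_mul b hm, x_pow_mul_z_mul b (by omega : 1 ≤ a + n + m),
        x_pow_mul_z_mul (a + b) hn, x_pow_mul_z_mul (a + b) hm,
        x_pow_mul_z_mul (a + b) (by omega : 1 ≤ n + m),
        show b + (a + n) = a + b + n by omega, show a + (b + m) = a + b + m by omega,
        show a + n + (b + m) = a + b + (n + m) by omega,
        show a + (n + (b + m)) = a + b + (n + m) by omega,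
        show b + (a + n + m) = a + b + (n + m) by omega]
      abel

/-- The last coefficient collects `z_{a+b}` from the `z`-`z` term, `-t z_{a+b}` from each mixed term
and `-t² xᵃ⁺ᵇ` from the `x`-`x` term. It equals `(1 - 2t) σ_t(z_{a+b}) + (t² - t) xᵃ⁺ᵇ`, which
explains the coefficients of the `t`-stuffle product. -/
theorem stuffle_sigmaHom_sigmaHom (t : k) {a b : ℕ} (ha : 1 ≤ a) (hb : 1 ≤ b) {u v : H k}
    (hu : u ∈ hy k) (hv : v ∈ hy k) :
    stuffle 0 ((t • ltr k .x ^ a + z k a) * u) ((t • ltr k .x ^ b + z k b) * v) =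
      (t • ltr k .x ^ a + z k a) * stuffle 0 u ((t • ltr k .x ^ b + z k b) * v)
      + (t • ltr k .x ^ b + z k b) * stuffle 0 ((t • ltr k .x ^ a + z k a) * u) v
      + ((1 - 2 * t) • z k (a + b) - t ^ 2 • ltr k .x ^ (a + b)) * stuffle 0 u v := by
  have h1 := stuffle_x_pow_z a hb (hy_le_h1 hv) u hu
  have h2 := stuffle_x_pow_z b ha (hy_le_h1 hu) v hv
  have hxa := hy_le_h1 (mul_mem_hy (ltr k .x ^ a) hu)
  have hxb := hy_le_h1 (mul_mem_hy (ltr k .x ^ b) hv)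
  rw [stuffle_comm _ hxb _ (z_mul_mem_h1 a (hy_le_h1 hu)),
    stuffle_comm _ (hy_le_h1 hv) _ (z_mul_mem_h1 a (hy_le_h1 hu)),
    stuffle_comm _ hxb _ (hy_le_h1 hu), stuffle_comm _ (hy_le_h1 hv) _ (hy_le_h1 hu),
    add_comm b a] at h2
  simp only [add_mul, smul_mul_assoc, map_add, map_smul, LinearMap.add_apply,
    LinearMap.smul_apply, stuffle_x_pow_x_pow a b u hu v hv, h1, h2,
    stuffle_z ha hb (hy_le_h1 hu) (hy_le_h1 hv), mul_add, mul_smul_comm, sub_mul]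
  module

theorem stuffle_z_sigmaHom (t : k) {a b : ℕ} (ha : 1 ≤ a) (hb : 1 ≤ b) {v : H k}
    (hv : v ∈ hy k) :
    stuffle 0 (z k a) ((t • ltr k .x ^ b + z k b) * v) =
      z k a * ((t • ltr k .x ^ b + z k b) * v)
      + (t • ltr k .x ^ b + z k b) * stuffle 0 (z k a) v + (1 - t) • (z k (a + b) * v) := by
  have h2 := stuffle_x_pow_z b ha one_mem_h1 v hv
  have hxb := hy_le_h1 (mul_mem_hy (ltr k .x ^ b) hv)
  have hza : z k a ∈ h1 k := hy_le_h1 (z_mem_hy a)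
  rw [mul_one, stuffle_one_right _ _ hxb, stuffle_one_right _ _ (hy_le_h1 hv),
    stuffle_comm _ hxb _ hza, stuffle_comm _ (hy_le_h1 hv) _ hza, add_comm b a] at h2
  have h1 := stuffle_z ha hb one_mem_h1 (hy_le_h1 hv)
  rw [mul_one, stuffle_one_left _ _ (z_mul_mem_h1 b (hy_le_h1 hv)),
    stuffle_one_left _ _ (hy_le_h1 hv)] at h1
  simp only [add_mul, smul_mul_assoc, map_add, map_smul, h1, h2, mul_add, mul_smul_comm]
  module

theorem stuffle_z_z {a b : ℕ} (ha : 1 ≤ a) (hb : 1 ≤ b) :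
    stuffle 0 (z k a) (z k b) = z k a * z k b + z k b * z k a + z k (a + b) := by
  have h := stuffle_z ha hb (one_mem_h1 (k := k)) one_mem_h1
  rwa [mul_one, mul_one, stuffle_one_left _ _ (hy_le_h1 (z_mem_hy b)),
    stuffle_one_right _ _ (hy_le_h1 (z_mem_hy a)), stuffle_one_left _ _ one_mem_h1, mul_one] at h

theorem sigmaHom_z (t : k) {a : ℕ} (ha : 1 ≤ a) :
    sigmaHom t (z k a) = t • ltr k .x ^ a + z k a := by
  obtain ⟨n, rfl⟩ := Nat.exists_eq_add_of_le' ha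
  simp [z, mul_add, pow_succ]

theorem S_z (t : k) (a : ℕ) : S t (z k a) = z k a := by
  rw [z, S_mul_letter, map_pow, sigmaHom_x]

theorem augm_zWord {l : List ℕ} (hl : l ≠ []) : augm k (zWord k l) = 0 :=
  augm_of_mem_hy (zWord_mem_hy hl)

theorem augm_stuffleIndex (t : k) {l l' : List ℕ} (h : l ≠ [] ∨ l' ≠ []) :
    augm k (stuffleIndex t l l') = 0 :=
  augm_of_mem_hy (stuffleIndex_mem_hy t l l' h)

/-- `S_t` acts as `σ_t` on a leading `z_a` followed by something, but fixes a lone `z_a`. If both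
tails are empty, `t xᵃ z_b + t xᵇ z_a = 2t z_{a+b}` already turns `1 - 2t` into `1`, so the term
with `t² - t` has to be absent there. -/
theorem S_stuffleIndex (t : k) : ∀ l l' : List ℕ, (∀ n ∈ l, 1 ≤ n) → (∀ n ∈ l', 1 ≤ n) →
    S t (stuffleIndex t l l') = stuffle 0 (S t (zWord k l)) (S t (zWord k l'))
  | [], l', _, _ => by
      rw [stuffleIndex, zWord_nil, S_one, stuffle_one_left _ _ (S_mem_h1 t _ (zWord_mem_h1 l'))]
  | a :: l, [], _, _ => by
      rw [stuffleIndex, zWord_nil, S_one, stuffle_one_right _ _ (S_mem_h1 t _ (zWord_mem_h1 _))]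
  | a :: l, b :: l', hl, hl' => by
      have ha : 1 ≤ a := hl a (by simp)
      have hb : 1 ≤ b := hl' b (by simp)
      have hl0 : ∀ n ∈ l, 1 ≤ n := fun n hn => hl n (by simp [hn])
      have hl0' : ∀ n ∈ l', 1 ≤ n := fun n hn => hl' n (by simp [hn])
      have ih1 := S_stuffleIndex t l (b :: l') hl0 hl'
      have ih2 := S_stuffleIndex t (a :: l) l' hl hl0'
      have ih3 := S_stuffleIndex t l l' hl0 hl0'
      have hab : 1 ≤ a + b := by omega
      have hS : ∀ {c : ℕ} (_ : 1 ≤ c) {w : H k}, augm k w = 0 →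
          S t (z k c * w) = (t • ltr k .x ^ c + z k c) * S t w := fun hc w hw => by
        rw [S_mul_of_augm t _ hw, sigmaHom_z t hc]
      have hx : ∀ (c : ℕ) {w : H k}, augm k w = 0 →
          S t (ltr k .x ^ c * w) = ltr k .x ^ c * S t w := fun c w hw => by
        rw [S_mul_of_augm t _ hw, map_pow, sigmaHom_x]
      rw [stuffleIndex, map_add, map_add, map_add, map_smul,
        hS ha (augm_stuffleIndex t (by simp)), hS hb (augm_stuffleIndex t (by simp)), ih1, ih2]
      simp only [zWord_cons]
      by_cases hu : l = [] <;> by_cases hv : l' = []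
      · subst hu hv
        simp only [and_self, if_true, stuffleIndex, zWord_nil, mul_one, S_z, S_one, map_zero,
          stuffle_one_left _ _ (hy_le_h1 (z_mem_hy b)),
          stuffle_one_right _ _ (hy_le_h1 (z_mem_hy a)), stuffle_z_z ha hb, add_mul,
          smul_mul_assoc, x_pow_mul_z a hb, x_pow_mul_z b ha, add_comm b a]
        module
      · subst hu
        have h0 := augm_zWord (k := k) hv
        have hS1 : S t (zWord k l') ∈ hy k := S_mem_hy t (zWord_mem_hy hv)
        have h2 : (t • ltr k .x ^ b + z k b) * S t (zWord k l') ∈ h1 k :=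
          hy_le_h1 (mul_mem_hy _ hS1)
        simp only [hv, and_false, if_false, stuffleIndex, zWord_nil, mul_one, S_z, S_one, map_smul,
          hS hab h0, hS hb h0, hx _ h0, stuffle_one_left _ _ h2, stuffle_z_sigmaHom t ha hb hS1]
        simp only [add_mul, smul_mul_assoc, mul_add, mul_smul_comm,
          x_pow_mul_z_mul a hb, x_pow_mul_x_pow_mul]
        module
      · subst hv
        have h0 := augm_zWord (k := k) hu
        have hS1 : S t (zWord k l) ∈ hy k := S_mem_hy t (zWord_mem_hy hu)
        have h2 : (t • ltr k .x ^ a + z k a) * S t (zWord k l) ∈ h1 k :=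
          hy_le_h1 (mul_mem_hy _ hS1)
        simp only [hu, false_and, if_false, stuffleIndex_nil_right, zWord_nil, mul_one, S_z, S_one,
          map_smul, hS hab h0, hS ha h0, hx _ h0, stuffle_one_right _ _ h2]
        rw [stuffle_comm _ h2 _ (hy_le_h1 (z_mem_hy b)),
          stuffle_comm _ (hy_le_h1 hS1) _ (hy_le_h1 (z_mem_hy b)), stuffle_z_sigmaHom t hb ha hS1]
        simp only [add_mul, smul_mul_assoc, mul_add, mul_smul_comm, add_comm b a,
          x_pow_mul_z_mul b ha, x_pow_mul_x_pow_mul]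
        module
      · have h0 := augm_stuffleIndex t (.inl hu : l ≠ [] ∨ l' ≠ [])
        simp only [hu, false_and, if_false, map_smul, hS hab h0, hx _ h0,
          hS ha (augm_zWord hu), hS hb (augm_zWord hv), ih3,
          stuffle_sigmaHom_sigmaHom t ha hb (S_mem_hy t (zWord_mem_hy hu))
            (S_mem_hy t (zWord_mem_hy hv))]
        simp only [add_mul, sub_mul, smul_mul_assoc]
        module
  termination_by l l' => l.length + l'.length

theorem S_stuffle (t : k) {u v : H k} (hu : u ∈ h1 k) (hv : v ∈ h1 k) :
    S t (stuffle t u v) = stuffle 0 (S t u) (S t v) := by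
  let f : H k →ₗ[k] H k →ₗ[k] H k := (stuffle t).compr₂ (S t) - (stuffle 0).compl₁₂ (S t) (S t)
  have hf : ∀ u v, f u v = S t (stuffle t u v) - stuffle 0 (S t u) (S t v) := fun _ _ => rfl
  suffices f u v = 0 from sub_eq_zero.1 ((hf u v).symm.trans this)
  refine h1_le_of_zWord_mem (LinearMap.ker (f.flip v)) (fun l hl => ?_) hu
  refine h1_le_of_zWord_mem (LinearMap.ker (f (zWord k l))) (fun l' hl' => ?_) hv
  rw [LinearMap.mem_ker, hf, stuffle_zWord t hl hl', S_stuffleIndex t l l' hl hl', sub_self]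

theorem S1_stuffle1 (t : k) (u v : h1 k) :
    S1 t (stuffle1 t u v) = stuffle1 0 (S1 t u) (S1 t v) := Subtype.ext (S_stuffle t u.2 v.2)

theorem sliceProduct_shuffle_interpolated (t : k) : SliceProduct (shuffle1 t)
    ((S1 t).symm.toLinearMap ∘ₗ del1 k ∘ₗ (S1 t).toLinearMap) :=
  sliceProduct_shuffle.transport (S1 t) (S0Equiv t) (S1_incl t) (S0_one t) (S1_y t) (S1_shuffle1 t)

theorem sliceProduct_stuffle_interpolated (t : k) : SliceProduct (stuffle1 t)
    ((S1 t).symm.toLinearMap ∘ₗ del1 k ∘ₗ (S1 t).toLinearMap) :=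
  sliceProduct_stuffle.transport (S1 t) (S0Equiv t) (S1_incl t) (S0_one t) (S1_y t) (S1_stuffle1 t)

theorem S1_yPow_zero (t : k) : S1 t (yPow k 0) = one1 k := by
  rw [yPow_zero]; exact Subtype.ext (S_one t)

/-- `S_t(yᵐ) = (tx + y)ᵐ⁻¹ y` for `m ≥ 1`, and the part beginning with `x` is deleted. Thus the
`S_t(yᵐ)` are again divided powers, which lets conditions tested only on `yᵐ` for the `t`-products
suffice. -/
theorem del1_S1_yPow (t : k) (m : ℕ) : del1 k (S1 t (yPow k (m + 1))) = S1 t (yPow k m) := by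
  refine Subtype.ext ?_
  change delY k (S t (ltr k .y ^ (m + 1))) = S t (ltr k .y ^ m)
  rcases m with _ | m
  · rw [zero_add, pow_one, S_ltr, pow_zero, S_one, ← mul_one (ltr k .y), delY_y_mul]
  · rw [pow_succ' _ (m + 1), S_mul_of_augm t _ (by simp), sigmaHom_y, add_mul, smul_mul_assoc,
      map_add, map_smul, delY_x_mul, smul_zero, zero_add, delY_y_mul]

theorem S1_isRegHom {mul mul' : h1 k → h1 k → h1 k} {R : Type*} [CommRing R] [Algebra k R]
    {ζ : h0 k →ₗ[k] R} (t : k) (hmul : ∀ u v, S1 t (mul' u v) = mul (S1 t u) (S1 t v))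
    {F : h1 k →ₗ[k] R[X]} (hF : IsRegHom mul ζ F) :
    IsRegHom mul' (ζ ∘ₗ S0 t) (F ∘ₗ (S1 t).toLinearMap) where
  map_one := by
    rw [LinearMap.comp_apply, LinearEquiv.coe_coe, ← yPow_zero, S1_yPow_zero, hF.map_one]
  map_mul u v := by simp only [LinearMap.comp_apply, LinearEquiv.coe_coe, hmul, hF.map_mul]
  restrict w := by
    simp only [LinearMap.comp_apply, LinearEquiv.coe_coe, S1_incl, hF.restrict]
  map_y := by simp only [LinearMap.comp_apply, LinearEquiv.coe_coe, S1_y, hF.map_y]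

end Interpolation

/-! ### Power series with noncommutative coefficients -/

section FormalSeries

open Finset

theorem sum_antidiagonal_assoc {M : Type*} [AddCommMonoid M] (f : ℕ → ℕ → ℕ → M) (n : ℕ) :
    ∑ p ∈ antidiagonal n, ∑ q ∈ antidiagonal p.1, f q.1 q.2 p.2 =
      ∑ p ∈ antidiagonal n, ∑ q ∈ antidiagonal p.2, f p.1 q.1 q.2 := by
  rw [sum_sigma', sum_sigma']
  refine sum_bij' (fun a _ => ⟨(a.2.1, a.2.2 + a.1.2), (a.2.2, a.1.2)⟩)
    (fun a _ => ⟨(a.1.1 + a.2.1, a.2.2), (a.1.1, a.2.1)⟩) ?_ ?_ ?_ ?_ ?_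
  · rintro ⟨⟨a, b⟩, ⟨c, e⟩⟩ h
    simp only [mem_sigma, HasAntidiagonal.mem_antidiagonal] at h ⊢
    simp; omega
  · rintro ⟨⟨a, b⟩, ⟨c, e⟩⟩ h
    simp only [mem_sigma, HasAntidiagonal.mem_antidiagonal] at h ⊢
    simp; omega
  · rintro ⟨⟨a, b⟩, ⟨c, e⟩⟩ h
    simp only [mem_sigma, HasAntidiagonal.mem_antidiagonal] at h
    obtain ⟨-, rfl⟩ := h
    rfl
  · rintro ⟨⟨a, b⟩, ⟨c, e⟩⟩ h
    simp only [mem_sigma, HasAntidiagonal.mem_antidiagonal] at h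
    obtain ⟨-, rfl⟩ := h
    rfl
  · intro _ _; rfl

variable {k : Type*} [CommRing k] {A : Type*} [Ring A] [Algebra k A]

/-- The extension of a linear map `A → A⟦u⟧` to a `u`-linear map `A⟦u⟧ → A⟦u⟧`. -/
def seriesExt (f : A →ₗ[k] PowerSeries A) : PowerSeries A →+ PowerSeries A where
  toFun g := PowerSeries.mk fun n =>
    ∑ p ∈ antidiagonal n, PowerSeries.coeff p.1 (f (PowerSeries.coeff p.2 g))
  map_zero' := by ext n; simp
  map_add' g g' := by ext n; simp [sum_add_distrib]

theorem coeff_seriesExt (f : A →ₗ[k] PowerSeries A) (g : PowerSeries A) (n : ℕ) :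
    PowerSeries.coeff n (seriesExt f g) =
      ∑ p ∈ antidiagonal n, PowerSeries.coeff p.1 (f (PowerSeries.coeff p.2 g)) := by
  simp [seriesExt]

theorem seriesExt_C (f : A →ₗ[k] PowerSeries A) (a : A) :
    seriesExt f (PowerSeries.C a) = f a := by
  ext n
  rw [coeff_seriesExt, sum_eq_single (n, 0)]
  · simp
  · rintro ⟨i, j⟩ h hne
    have : j ≠ 0 := by
      rintro rfl
      simp at h
      exact hne (by rw [h])
    simp [PowerSeries.coeff_C_of_ne_zero this]
  · simp

theorem seriesExt_one (f : A →ₗ[k] PowerSeries A) : seriesExt f 1 = f 1 := by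
  rw [← map_one PowerSeries.C, seriesExt_C]

theorem seriesExt_X_mul (f : A →ₗ[k] PowerSeries A) (g : PowerSeries A) :
    seriesExt f (PowerSeries.X * g) = PowerSeries.X * seriesExt f g := by
  ext n
  rcases n with _ | n
  · simp [coeff_seriesExt]
  · rw [PowerSeries.coeff_succ_X_mul, coeff_seriesExt, Nat.sum_antidiagonal_succ',
      coeff_seriesExt]
    simp

/-- Multiplication rules valid on coefficients extend to series; `α` stays on the left since the
coefficients need not commute. -/
theorem seriesExt_C_mul (f : A →ₗ[k] PowerSeries A) (a : A) (α : PowerSeries A)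
    (h : ∀ w, f (a * w) = α * f w) (g : PowerSeries A) :
    seriesExt f (PowerSeries.C a * g) = α * seriesExt f g := by
  ext n
  rw [coeff_seriesExt, PowerSeries.coeff_mul]
  simp only [PowerSeries.coeff_C_mul, h]
  simp only [PowerSeries.coeff_mul, coeff_seriesExt, mul_sum]
  exact sum_antidiagonal_assoc
    (fun i j l => PowerSeries.coeff i α * PowerSeries.coeff j (f (PowerSeries.coeff l g))) n

theorem seriesExt_mul_C (f : A →ₗ[k] PowerSeries A) (b : A) (β : PowerSeries A)
    (h : ∀ w, f (w * b) = f w * β) (g : PowerSeries A) :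
    seriesExt f (g * PowerSeries.C b) = seriesExt f g * β := by
  ext n
  rw [coeff_seriesExt, PowerSeries.coeff_mul]
  simp only [PowerSeries.coeff_mul_C, h]
  simp only [PowerSeries.coeff_mul, coeff_seriesExt, sum_mul]
  rw [sum_antidiagonal_assoc (fun i j l => PowerSeries.coeff i (f (PowerSeries.coeff j g)) *
    PowerSeries.coeff l β) n, sum_antidiagonal_assoc (fun i j l => PowerSeries.coeff i
      (f (PowerSeries.coeff l g)) * PowerSeries.coeff j β) n]
  refine sum_congr rfl fun p _ => ?_
  exact Finset.Nat.sum_antidiagonal_swap (f := fun q => PowerSeries.coeff p.1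
    (f (PowerSeries.coeff q.1 g)) * PowerSeries.coeff q.2 β)

/-- `u d/du`. -/
def eulerDer : PowerSeries A →+ PowerSeries A where
  toFun g := PowerSeries.mk fun n => n • PowerSeries.coeff n g
  map_zero' := by ext n; simp
  map_add' g g' := by ext n; simp

theorem coeff_eulerDer (g : PowerSeries A) (n : ℕ) :
    PowerSeries.coeff n (eulerDer g) = n • PowerSeries.coeff n g := by simp [eulerDer]

theorem eulerDer_mul (f g : PowerSeries A) :
    eulerDer (f * g) = eulerDer f * g + f * eulerDer g := by
  ext n
  rw [map_add, coeff_eulerDer, PowerSeries.coeff_mul, PowerSeries.coeff_mul,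
    PowerSeries.coeff_mul, smul_sum, ← sum_add_distrib]
  refine sum_congr rfl fun p hp => ?_
  rw [HasAntidiagonal.mem_antidiagonal] at hp
  rw [coeff_eulerDer, coeff_eulerDer, smul_mul_assoc, mul_smul_comm, ← add_smul, hp]

theorem eulerDer_C (a : A) : eulerDer (PowerSeries.C a) = 0 := by
  ext n
  rw [coeff_eulerDer, PowerSeries.coeff_C]
  split_ifs with h
  · simp [h]
  · simp

theorem eulerDer_X : eulerDer (PowerSeries.X : PowerSeries A) = PowerSeries.X := by
  ext n
  rw [coeff_eulerDer, PowerSeries.coeff_X]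
  split_ifs with h
  · simp [h]
  · simp

/-- `(1 - a u)⁻¹`. -/
def geomSeries (a : A) : PowerSeries A := PowerSeries.mk fun n => a ^ n

theorem one_sub_mul_geomSeries (a : A) :
    (1 - PowerSeries.X * PowerSeries.C a) * geomSeries a = 1 := by
  ext n
  rw [sub_mul, one_mul, mul_assoc, map_sub]
  rcases n with _ | n
  · simp [geomSeries]
  · rw [PowerSeries.coeff_succ_X_mul, PowerSeries.coeff_C_mul]
    simp [geomSeries, pow_succ', PowerSeries.coeff_one]

theorem geomSeries_mul_one_sub (a : A) :
    geomSeries a * (1 - PowerSeries.X * PowerSeries.C a) = 1 := by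
  ext n
  rw [mul_sub, mul_one, PowerSeries.X_mul, ← mul_assoc, map_sub]
  rcases n with _ | n
  · simp [geomSeries]
  · rw [PowerSeries.coeff_succ_mul_X, PowerSeries.coeff_mul_C]
    simp [geomSeries, pow_succ, PowerSeries.coeff_one]

theorem one_add_mul_geomSeries_neg (a : A) :
    (1 + PowerSeries.X * PowerSeries.C a) * geomSeries (-a) = 1 := by
  simpa using one_sub_mul_geomSeries (-a)

theorem geomSeries_neg_mul_one_add (a : A) :
    geomSeries (-a) * (1 + PowerSeries.X * PowerSeries.C a) = 1 := by
  simpa using geomSeries_mul_one_sub (-a)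

theorem geomSeries_mul_C (a : A) :
    geomSeries a * PowerSeries.C a = PowerSeries.C a * geomSeries a := by
  ext n
  simp only [geomSeries, PowerSeries.coeff_mul_C, PowerSeries.coeff_mk, PowerSeries.coeff_C_mul]
  exact ((Commute.refl a).pow_left n).eq

theorem geomSeries_neg_mul_C (a : A) :
    geomSeries (-a) * PowerSeries.C a = PowerSeries.C a * geomSeries (-a) := by
  have := geomSeries_mul_C (-a)
  simpa using this

end FormalSeries

/-! ### Comparison of the two products by the map `Δ` -/

section Comparison

open Finset

theorem mul_X_mul {A : Type*} [Semiring A] (f g : PowerSeries A) :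
    f * (PowerSeries.X * g) = PowerSeries.X * (f * g) := by
  rw [← mul_assoc, ← PowerSeries.X_mul, mul_assoc]

variable {k : Type*} [CommRing k]

variable (k) in
/-- The letter `x` as a constant power series. -/
abbrev cx : PowerSeries (H k) := PowerSeries.C (ltr k .x)

variable (k) in
/-- The letter `y` as a constant power series. -/
abbrev cy : PowerSeries (H k) := PowerSeries.C (ltr k .y)

variable (k) in
/-- The algebra map `Δ` with `Δ(x) = x (1 + y u)⁻¹` and `Δ(x + y) = x + y`. -/
def deltaHom : H k →ₐ[k] PowerSeries (H k) :=
  FreeAlgebra.lift k fun a =>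
    match a with
    | .x => cx k * geomSeries (-ltr k .y)
    | .y => cx k + cy k - cx k * geomSeries (-ltr k .y)

theorem deltaHom_x : deltaHom k (ltr k .x) = cx k * geomSeries (-ltr k .y) := by simp [deltaHom]

theorem deltaHom_y' :
    deltaHom k (ltr k .y) = cx k + cy k - cx k * geomSeries (-ltr k .y) := by simp [deltaHom]

theorem deltaHom_add : deltaHom k (ltr k .x + ltr k .y) =
    PowerSeries.C (ltr k .x + ltr k .y) := by
  rw [map_add, deltaHom_x, deltaHom_y', map_add]; abel

theorem geomSeries_neg_eq {A : Type*} [Ring A] (a : A) :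
    geomSeries (-a) = 1 - PowerSeries.X * (PowerSeries.C a * geomSeries (-a)) := by
  have := one_add_mul_geomSeries_neg a
  rw [add_mul, one_mul, mul_assoc] at this
  exact eq_sub_of_add_eq this

/-- Follows from `1 - (1 + yu)⁻¹ = (1 + yu)⁻¹ yu`. In this form `Δ(y)` visibly ends in `y`, which is
needed for `Δ` to preserve `𝔥⁰`. -/
theorem deltaHom_y : deltaHom k (ltr k .y) =
    cy k + PowerSeries.X * (cx k * (geomSeries (-ltr k .y) * cy k)) := by
  rw [deltaHom_y', geomSeries_neg_mul_C]
  nth_rewrite 1 [geomSeries_neg_eq]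
  rw [mul_sub, mul_one, mul_X_mul]
  abel

variable (k) in
/-- `w ↦ (1 - y u)⁻¹ ⧢ w`. -/
def shSeries : H k →ₗ[k] PowerSeries (H k) where
  toFun w := PowerSeries.mk fun m => shuffle 0 (ltr k .y ^ m) w
  map_add' v w := by ext n; simp
  map_smul' c w := by ext n; simp

theorem coeff_shSeries (m : ℕ) (w : H k) :
    PowerSeries.coeff m (shSeries k w) = shuffle 0 (ltr k .y ^ m) w := by simp [shSeries]

theorem shSeries_one : shSeries k 1 = geomSeries (ltr k .y) := by
  ext n; simp [coeff_shSeries, geomSeries, shuffle_one_right]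

/-- Summing `yᵐ⁺¹ ⧢ aw = y(yᵐ ⧢ aw) + a(yᵐ⁺¹ ⧢ w)` over `m` gives `(1 - yu) Φ(aw) = a Φ(w)` for
`Φ(w) = (1 - yu)⁻¹ ⧢ w`. -/
theorem shSeries_letter_mul (a : Letter) (w : H k) :
    shSeries k (ltr k a * w) =
      (geomSeries (ltr k .y) * PowerSeries.C (ltr k a)) * shSeries k w := by
  have h : (1 - PowerSeries.X * cy k) * shSeries k (ltr k a * w) =
      PowerSeries.C (ltr k a) * shSeries k w := by
    ext n
    rw [sub_mul, one_mul, mul_assoc, map_sub]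
    rcases n with _ | n
    · simp [coeff_shSeries, shuffle_one_left]
    · rw [PowerSeries.coeff_succ_X_mul, PowerSeries.coeff_C_mul, PowerSeries.coeff_C_mul,
        coeff_shSeries, coeff_shSeries, coeff_shSeries, pow_succ', shuffle_letter,
        add_sub_cancel_left]
  rw [mul_assoc, ← h, ← mul_assoc, geomSeries_mul_one_sub, one_mul]

variable (k) in
/-- `w ↦ (1 - y u)⁻¹ * w`, with the stuffle product. -/
def stSeries (w : H k) : PowerSeries (H k) :=
  PowerSeries.mk fun m => stuffle 0 (ltr k .y ^ m) w

theorem coeff_stSeries (m : ℕ) (w : H k) :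
    PowerSeries.coeff m (stSeries k w) = stuffle 0 (ltr k .y ^ m) w := by simp [stSeries]

theorem z_one : z k 1 = ltr k .y := by simp [z]

/-- The stuffle analogue of `shSeries_letter_mul`; the contraction of `z_n` with a `y` contributes
`z_{n+1} u`. -/
theorem stSeries_z_mul {n : ℕ} (hn : 1 ≤ n) {w : H k} (hw : w ∈ h1 k) :
    stSeries k (z k n * w) = geomSeries (ltr k .y) *
      ((PowerSeries.C (z k n) + PowerSeries.X * PowerSeries.C (z k (n + 1))) * stSeries k w) := by
  have h : (1 - PowerSeries.X * cy k) * stSeries k (z k n * w) =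
      (PowerSeries.C (z k n) + PowerSeries.X * PowerSeries.C (z k (n + 1))) * stSeries k w := by
    ext m
    rw [sub_mul, one_mul, mul_assoc, map_sub, add_mul, map_add, mul_assoc]
    rcases m with _ | m
    · simp [coeff_stSeries, stuffle_one_left _ _ hw, stuffle_one_left _ _ (z_mul_mem_h1 n hw)]
    · rw [PowerSeries.coeff_succ_X_mul, PowerSeries.coeff_succ_X_mul, PowerSeries.coeff_C_mul,
        PowerSeries.coeff_C_mul, PowerSeries.coeff_C_mul,
        coeff_stSeries, coeff_stSeries, coeff_stSeries, coeff_stSeries, pow_succ', ← z_one,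
        stuffle_z le_rfl hn (by rw [z_one]; exact y_pow_mem k m) hw, add_comm 1 n]
      abel
  rw [← h, ← mul_assoc, geomSeries_mul_one_sub, one_mul]

theorem seriesExt_shSeries_deltaHom_x (g : PowerSeries (H k)) :
    seriesExt (shSeries k) (deltaHom k (ltr k .x) * g) = geomSeries (ltr k .y) *
      (cx k * ((1 - PowerSeries.X * cy k) * seriesExt (shSeries k) g)) := by
  have hg : g = geomSeries (-ltr k .y) * g +
      PowerSeries.X * (cy k * (geomSeries (-ltr k .y) * g)) := by
    rw [← mul_assoc (cy k), ← mul_assoc, ← add_mul, ← mul_assoc, ← one_add_mul,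
      one_add_mul_geomSeries_neg, one_mul]
  set g' := geomSeries (-ltr k .y) * g with hg'
  -- Since `g = (1 + yu) g'`, this is `1 + u(1 - yu)⁻¹ y = (1 - yu)⁻¹`. Hence a factor `Δ(x)`
  -- becomes the conjugate `(1 - yu)⁻¹ x (1 - yu)`.
  have h1 : seriesExt (shSeries k) g = geomSeries (ltr k .y) * seriesExt (shSeries k) g' := by
    have h3 := geomSeries_mul_one_sub (ltr k .y)
    rw [mul_sub, mul_one, sub_eq_iff_eq_add] at h3
    rw [hg, map_add, seriesExt_X_mul,
      seriesExt_C_mul _ _ _ (shSeries_letter_mul .y)]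
    nth_rewrite 2 [h3]
    simp only [add_mul, one_mul, mul_X_mul, mul_assoc]
  rw [deltaHom_x, mul_assoc, ← hg', seriesExt_C_mul _ _ _ (shSeries_letter_mul .x), h1,
    ← mul_assoc (1 - _), one_sub_mul_geomSeries, one_mul, mul_assoc]

theorem seriesExt_shSeries_deltaHom_y (g : PowerSeries (H k)) :
    seriesExt (shSeries k) (deltaHom k (ltr k .y) * g) = geomSeries (ltr k .y) *
      ((cy k + PowerSeries.X * (cx k * cy k)) * seriesExt (shSeries k) g) := by
  have h : deltaHom k (ltr k .y) * g = cx k * g + cy k * g - deltaHom k (ltr k .x) * g := by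
    rw [deltaHom_y', deltaHom_x]; noncomm_ring
  rw [h, map_sub, map_add, seriesExt_shSeries_deltaHom_x,
    seriesExt_C_mul _ _ _ (shSeries_letter_mul .x), seriesExt_C_mul _ _ _ (shSeries_letter_mul .y)]
  simp only [mul_sub, sub_mul, mul_add, add_mul, mul_assoc, one_mul, mul_X_mul]
  abel

/-- The conjugates of `x` by `1 - yu` telescope along `z_n = xⁿ⁻¹y`, and the result is the recursion
of `stSeries_z_mul`. -/
theorem seriesExt_shSeries_deltaHom_z {n : ℕ} (hn : 1 ≤ n) (g : PowerSeries (H k)) :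
    seriesExt (shSeries k) (deltaHom k (z k n) * g) = geomSeries (ltr k .y) *
      ((PowerSeries.C (z k n) + PowerSeries.X * PowerSeries.C (z k (n + 1))) *
        seriesExt (shSeries k) g) := by
  induction n, hn using Nat.le_induction with
  | base =>
    rw [z_one, seriesExt_shSeries_deltaHom_y]
    simp [z]
  | succ n hn ih =>
    have e : ∀ m, 1 ≤ m → z k (m + 1) = ltr k .x * z k m := fun m hm => z_eq (by omega)
    rw [e n hn, map_mul (deltaHom k), mul_assoc, seriesExt_shSeries_deltaHom_x, ih, e (n + 1) (by omega), e n hn,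
      ← mul_assoc (1 - _), one_sub_mul_geomSeries, one_mul]
    simp only [map_mul, add_mul, mul_add, mul_assoc, mul_X_mul]

/-- `(1 - y u)⁻¹ * w = (1 - y u)⁻¹ ⧢ Δ(w)`. -/
theorem stSeries_eq : ∀ w ∈ h1 k, stSeries k w = seriesExt (shSeries k) (deltaHom k w) := by
  refine h1_induction (fun u v hu hv => ?_) (fun c u hu => ?_) ?_ (fun n hn u hu ih => ?_)
  · rw [map_add, map_add, ← hu, ← hv]
    ext m; simp [coeff_stSeries]
  · have : seriesExt (shSeries k) (deltaHom k (c • u)) =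
        c • seriesExt (shSeries k) (deltaHom k u) := by
      ext m
      rw [map_smul, PowerSeries.coeff_smul, coeff_seriesExt, coeff_seriesExt, smul_sum]
      simp
    rw [this, ← hu]
    ext m; simp [coeff_stSeries]
  · rw [map_one, seriesExt_one, shSeries_one]
    ext m
    rw [coeff_stSeries, stuffle_one_right _ _ (y_pow_mem k m)]
    simp [geomSeries]
  -- Both sides obey the same recursion under left multiplication by `z_n`.
  · rw [stSeries_z_mul hn hu, ih, map_mul, seriesExt_shSeries_deltaHom_z hn]

variable (k) in
/-- The coefficients of `Δ`. -/
def delta (m : ℕ) : H k →ₗ[k] H k where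
  toFun w := PowerSeries.coeff m (deltaHom k w)
  map_add' v w := by simp
  map_smul' c w := by simp

theorem stuffle_y_pow (m : ℕ) {w : H k} (hw : w ∈ h1 k) :
    stuffle 0 (ltr k .y ^ m) w =
      ∑ p ∈ antidiagonal m, shuffle 0 (ltr k .y ^ p.1) (delta k p.2 w) := by
  rw [← coeff_stSeries, stSeries_eq w hw, coeff_seriesExt]
  simp only [coeff_shSeries]
  rfl

theorem delta_zero (w : H k) : delta k 0 w = w := by
  have h : ((PowerSeries.constantCoeff (R := H k)).comp (deltaHom k).toRingHom) = RingHom.id _ := by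
    have h' : (AlgHom.mk ((PowerSeries.constantCoeff (R := H k)).comp (deltaHom k).toRingHom)
        (fun c => by
          change PowerSeries.constantCoeff (deltaHom k (algebraMap k (H k) c)) = _
          rw [AlgHom.commutes, Algebra.algebraMap_eq_smul_one, Algebra.algebraMap_eq_smul_one]
          simp) : H k →ₐ[k] H k) = AlgHom.id k _ := by
      refine FreeAlgebra.hom_ext (funext fun a => ?_)
      cases a
      · change PowerSeries.constantCoeff (deltaHom k (ltr k .x)) = ltr k .x
        rw [deltaHom_x]
        simp [geomSeries, ← PowerSeries.coeff_zero_eq_constantCoeff_apply]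
      · change PowerSeries.constantCoeff (deltaHom k (ltr k .y)) = ltr k .y
        rw [deltaHom_y]
        simp
    exact congrArg AlgHom.toRingHom h'
  have := DFunLike.congr_fun h w
  exact (PowerSeries.coeff_zero_eq_constantCoeff_apply _).trans this

theorem delta_one {m : ℕ} (hm : m ≠ 0) : delta k m 1 = 0 := by
  change PowerSeries.coeff m (deltaHom k 1) = 0
  rw [map_one, PowerSeries.coeff_one, if_neg hm]

theorem delta_mem_h0 (m : ℕ) : ∀ u ∈ h0 k, delta k m u ∈ h0 k := by
  refine map_mem_h0 _ ?_ fun v => ?_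
  · rcases eq_or_ne m 0 with rfl | hm
    · rw [delta_zero]; exact one_mem_h0
    · rw [delta_one hm]; exact zero_mem _
  -- The middle factor is read off from `Δ(xvy) = x · (1 + yu)⁻¹ Δ(v) (1 + u x(1 + yu)⁻¹) · y`.
  · refine mem_xhy.2 ⟨PowerSeries.coeff m (geomSeries (-ltr k .y) * deltaHom k v *
      (1 + PowerSeries.X * (cx k * geomSeries (-ltr k .y)))), ?_⟩
    change _ = PowerSeries.coeff m (deltaHom k _)
    rw [← PowerSeries.coeff_mul_C, ← PowerSeries.coeff_C_mul, map_mul (deltaHom k),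
      map_mul (deltaHom k), deltaHom_x,
      deltaHom_y]
    congr 1
    simp only [mul_add, add_mul, mul_assoc, mul_one, mul_X_mul]

variable (k) in
/-- `Δ_m` on `𝔥⁰`. -/
def delta0 (m : ℕ) : h0 k →ₗ[k] h0 k := (delta k m).restrict (delta_mem_h0 m)

theorem delta0_zero (w : h0 k) : delta0 k 0 w = w := Subtype.ext (delta_zero _)

theorem stuffle1_yPow (m : ℕ) (w : h0 k) :
    stuffle1 0 (yPow k m) (incl k w) =
      ∑ p ∈ antidiagonal m, shuffle1 0 (yPow k p.1) (incl k (delta0 k p.2 w)) := by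
  refine Subtype.ext ?_
  rw [AddSubmonoidClass.coe_finsetSum]
  exact stuffle_y_pow m (h0_le_h1 w.2)

end Comparison

/-! ### `Δ` and the derivations `∂_n` -/

section Derivations

open Finset

variable {k : Type*} [CommRing k]

theorem der_one (n : ℕ) : der n (1 : H k) = 0 := by
  rw [← word_nil, der, linExt_word]; rfl

variable (k) in
/-- `∑_{n ≥ 1} (-1)ⁿ ∂_n uⁿ`. -/
def derSeries : H k →ₗ[k] PowerSeries (H k) where
  toFun w := PowerSeries.mk fun n => if n = 0 then 0 else (-1 : k) ^ n • der n w
  map_add' v w := by ext n; simp; split_ifs <;> simp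
  map_smul' c w := by ext n; simp [smul_comm c]

theorem coeff_derSeries (n : ℕ) (w : H k) : PowerSeries.coeff n (derSeries k w) =
    if n = 0 then 0 else (-1 : k) ^ n • der n w := by simp [derSeries]

theorem derSeries_mul (v w : H k) : derSeries k (v * w) =
    derSeries k v * PowerSeries.C w + PowerSeries.C v * derSeries k w := by
  ext n
  rw [map_add, PowerSeries.coeff_mul_C, PowerSeries.coeff_C_mul, coeff_derSeries, coeff_derSeries,
    coeff_derSeries]
  split_ifs
  · simp
  · rw [der_mul, smul_add, smul_mul_assoc, mul_smul_comm]

variable (k) in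
/-- `x (1 + (x + y) u)⁻¹ y u`. -/
def derSeriesX : PowerSeries (H k) :=
  PowerSeries.X * (cx k * (geomSeries (-(ltr k .x + ltr k .y)) * cy k))

theorem coeff_derSeriesX (n : ℕ) : PowerSeries.coeff (n + 1) (derSeriesX k) =
    -((-1 : k) ^ (n + 1) • derLetter (n + 1) .x) := by
  rw [derSeriesX, PowerSeries.coeff_succ_X_mul, PowerSeries.coeff_C_mul, PowerSeries.coeff_mul_C,
    geomSeries, PowerSeries.coeff_mk, neg_pow, pow_succ, derLetter, Nat.add_sub_cancel, mul_assoc,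
    mul_assoc]
  rcases neg_one_pow_eq_or (H k) n with h | h <;> rcases Nat.even_or_odd n with hn | hn <;>
    simp [hn.neg_one_pow]

theorem derSeries_x : derSeries k (ltr k .x) = -derSeriesX k := by
  ext n
  rcases n with _ | n
  · simp [coeff_derSeries, derSeriesX]
  · rw [coeff_derSeries, if_neg (Nat.succ_ne_zero n), der_letter, map_neg, coeff_derSeriesX,
      neg_neg]

theorem derSeries_y : derSeries k (ltr k .y) = derSeriesX k := by
  ext n
  rcases n with _ | n
  · simp [coeff_derSeries, derSeriesX]
  · rw [coeff_derSeries, if_neg (Nat.succ_ne_zero n), der_letter, coeff_derSeriesX, derLetter,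
      derLetter, smul_neg]

variable (k) in
/-- The `u`-linear extension of `Δ`. -/
def deltaExt : PowerSeries (H k) →+ PowerSeries (H k) := seriesExt (deltaHom k).toLinearMap

theorem deltaExt_C_mul (v : H k) (g : PowerSeries (H k)) :
    deltaExt k (PowerSeries.C v * g) = deltaHom k v * deltaExt k g :=
  seriesExt_C_mul _ _ _ (fun w => map_mul (deltaHom k) v w) g

theorem deltaExt_mul_C (v : H k) (g : PowerSeries (H k)) :
    deltaExt k (g * PowerSeries.C v) = deltaExt k g * deltaHom k v :=
  seriesExt_mul_C _ _ _ (fun w => map_mul (deltaHom k) w v) g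

theorem deltaExt_C (v : H k) : deltaExt k (PowerSeries.C v) = deltaHom k v := seriesExt_C _ v

theorem deltaExt_X_mul (g : PowerSeries (H k)) :
    deltaExt k (PowerSeries.X * g) = PowerSeries.X * deltaExt k g := seriesExt_X_mul _ g

theorem coeff_deltaExt (g : PowerSeries (H k)) (n : ℕ) :
    PowerSeries.coeff n (deltaExt k g) =
      ∑ p ∈ antidiagonal n, delta k p.1 (PowerSeries.coeff p.2 g) := coeff_seriesExt _ g n

theorem deltaExt_geomSeries : deltaExt k (geomSeries (-(ltr k .x + ltr k .y))) =
    geomSeries (-(ltr k .x + ltr k .y)) := by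
  have h : deltaExt k ((1 + PowerSeries.X * PowerSeries.C (ltr k .x + ltr k .y)) *
      geomSeries (-(ltr k .x + ltr k .y))) =
      (1 + PowerSeries.X * PowerSeries.C (ltr k .x + ltr k .y)) *
        deltaExt k (geomSeries (-(ltr k .x + ltr k .y))) := by
    rw [add_mul, add_mul, one_mul, one_mul, mul_assoc, mul_assoc, map_add (deltaExt k),
      deltaExt_X_mul, deltaExt_C_mul, deltaHom_add]
  have h1 : deltaExt k 1 = 1 := by
    rw [← map_one PowerSeries.C, deltaExt_C, map_one, map_one]
  rw [one_add_mul_geomSeries_neg, h1] at h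
  have h2 := congrArg (fun f => geomSeries (-(ltr k .x + ltr k .y)) * f) h
  rw [mul_one, ← mul_assoc, geomSeries_neg_mul_one_add, one_mul] at h2
  exact h2.symm

/-- Equivalent to the factorization `Δ(y) = (1 + (x + y)u) y (1 + yu)⁻¹`. -/
theorem geomSeries_mul_deltaHom_y :
    geomSeries (-(ltr k .x + ltr k .y)) * deltaHom k (ltr k .y) =
      cy k * geomSeries (-ltr k .y) := by
  have h : deltaHom k (ltr k .y) = (1 + PowerSeries.X * PowerSeries.C (ltr k .x + ltr k .y)) *
      (cy k * geomSeries (-ltr k .y)) := by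
    have h2 : cy k * geomSeries (-ltr k .y) +
        PowerSeries.X * (cy k * (cy k * geomSeries (-ltr k .y))) = cy k := by
      rw [← mul_X_mul, ← mul_add]
      nth_rewrite 1 [geomSeries_neg_eq]
      rw [sub_add_cancel, mul_one]
    rw [deltaHom_y, geomSeries_neg_mul_C, map_add]
    nth_rewrite 1 [← h2]
    simp only [add_mul, one_mul, mul_add, mul_assoc]
    abel
  rw [h, ← mul_assoc, geomSeries_neg_mul_one_add, one_mul]

theorem eulerDer_geomSeries_neg (a : H k) : eulerDer (geomSeries (-a)) =
    -(PowerSeries.X * (geomSeries (-a) * (PowerSeries.C a * geomSeries (-a)))) := by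
  have h := congrArg eulerDer (one_add_mul_geomSeries_neg a)
  rw [eulerDer_mul, map_add, ← map_one PowerSeries.C, eulerDer_C, eulerDer_mul, eulerDer_C,
    eulerDer_X, mul_zero, add_zero, zero_add, map_one] at h
  have h2 := geomSeries_neg_mul_one_add a
  rw [← one_mul (eulerDer _), ← h2, mul_assoc, eq_neg_of_add_eq_zero_right h]
  rw [mul_neg, mul_assoc, mul_X_mul]

/-- A differential equation in place of an exponential formula for `Δ`, so that commutation of the
`∂_n` is not needed. Both sides satisfy the Leibniz rule along `Δ`, which leaves the letters; both
kill `x + y`, which reduces `y` to `x`. -/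
theorem eulerDer_deltaHom (w : H k) :
    eulerDer (deltaHom k w) = deltaExt k (derSeries k w) := by
  have hx : eulerDer (deltaHom k (ltr k .x)) = -deltaExt k (derSeriesX k) := by
    rw [derSeriesX, deltaExt_X_mul, deltaExt_C_mul, deltaExt_mul_C, deltaExt_geomSeries,
      geomSeries_mul_deltaHom_y, deltaHom_x, eulerDer_mul, eulerDer_C, zero_mul, zero_add,
      eulerDer_geomSeries_neg, mul_neg, mul_X_mul, mul_assoc]
  induction w using letter_induction with
  | hadd u v hu hv => simp only [map_add, hu, hv]
  | hsmul c u hu =>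
    ext n
    have := congrArg (PowerSeries.coeff n) hu
    rw [coeff_eulerDer, coeff_deltaExt] at this
    rw [map_smul (deltaHom k), map_smul (derSeries k), coeff_eulerDer, PowerSeries.coeff_smul,
      smul_comm, this,
      coeff_deltaExt, smul_sum]
    simp
  | hone =>
    have : derSeries k 1 = 0 := by ext n; simp [coeff_derSeries, der_one]
    rw [this, map_zero, map_one, ← map_one PowerSeries.C, eulerDer_C]
  | hmul a u hu =>
    have ha : eulerDer (deltaHom k (ltr k a)) = deltaExt k (derSeries k (ltr k a)) := by
      cases a
      · rw [hx, derSeries_x, map_neg]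
      · rw [derSeries_y, deltaHom_y', ← deltaHom_x, map_sub, hx, map_add, eulerDer_C, eulerDer_C,
          add_zero, zero_sub, neg_neg]
    rw [map_mul (deltaHom k), eulerDer_mul, ha, hu, derSeries_mul, map_add (deltaExt k),
      deltaExt_C_mul, deltaExt_mul_C]

theorem smul_delta0 (m : ℕ) (w : h0 k) :
    (m : k) • delta0 k m w = ∑ p ∈ antidiagonal m,
      if p.2 = 0 then 0 else (-1 : k) ^ p.2 • delta0 k p.1 (der0 p.2 w) := by
  refine Subtype.ext ?_
  rw [AddSubmonoidClass.coe_finsetSum]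
  have h := congrArg (PowerSeries.coeff m) (eulerDer_deltaHom (w : H k))
  rw [coeff_eulerDer, coeff_deltaExt] at h
  rw [Submodule.coe_smul, Nat.cast_smul_eq_nsmul]
  refine h.trans (sum_congr rfl fun p _ => ?_)
  rw [coeff_derSeries]
  split_ifs
  · simp
  · rw [map_smul]; rfl

variable {R : Type*} [CommRing R] [Algebra k R] (ζ : h0 k →ₗ[k] R)

/-- The coefficients of the differential equation give `m Δ_m = ∑_{j ≥ 1} (-1)ʲ Δ_{m-j} ∂_j`, a
triangular system with leading term `(-1)ᵐ ∂_m` because `Δ_0 = id`. Division by `m` is needed only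
to recover `Δ_m` from the `∂_j`. -/
theorem delta0_iff_der0 [Algebra ℚ k] :
    (∀ m, m ≠ 0 → ∀ w, ζ (delta0 k m w) = 0) ↔ ∀ n, 1 ≤ n → ∀ w, ζ (der0 n w) = 0 := by
  have key : ∀ m, m ≠ 0 → (∀ j, j ≠ 0 → j < m → ∀ w, ζ (delta0 k j w) = 0) → ∀ w,
      (m : k) • ζ (delta0 k m w) = (-1 : k) ^ m • ζ (der0 m w) := by
    intro m hm ih w
    rw [← map_smul, smul_delta0, map_sum, sum_eq_single (0, m)]
    · rw [if_neg hm, map_smul, delta0_zero]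
    · rintro ⟨i, j⟩ hij hne
      rw [HasAntidiagonal.mem_antidiagonal] at hij
      simp only at hij ⊢
      split_ifs with hj
      · exact map_zero _
      · have hi : i ≠ 0 := by
          rintro rfl
          exact hne (by rw [← hij, zero_add])
        rw [map_smul, ih i hi (by omega), smul_zero]
    · intro h; exact absurd (by simp) h
  constructor
  · intro h m hm w
    have := key m (by omega) (fun j hj _ => h j hj) w
    rw [h m (by omega), smul_zero] at this
    have h2 : (-1 : k) ^ m • (-1 : k) ^ m • ζ (der0 m w) = 0 := by rw [← this, smul_zero]
    rwa [smul_smul, ← mul_pow, neg_one_mul, neg_neg, one_pow, one_smul] at h2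
  · intro h m
    induction m using Nat.strong_induction_on with
    | _ m ih =>
      intro hm w
      have := key m hm (fun j hj hjm => ih j hjm hj) w
      rw [h m (by omega), smul_zero] at this
      have hu : algebraMap ℚ k (m : ℚ)⁻¹ * (m : k) = 1 := by
        rw [← map_natCast (algebraMap ℚ k), ← map_mul,
          inv_mul_cancel₀ (by exact_mod_cast hm), map_one]
      rw [← one_smul k (ζ _), ← hu, mul_smul, this, smul_zero]

end Derivations

/-! ### `Δ` and the maps `σ_m`, `τ σ_m τ` -/

section Ohno

open Finset

variable {k : Type*} [CommRing k]

theorem hy_le_of_zWord_mem (q : Submodule k (H k))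
    (h : ∀ l, l ≠ [] → (∀ n ∈ l, 1 ≤ n) → zWord k l ∈ q) : hy k ≤ q := by
  refine hy_induction (fun _ _ => add_mem) (fun c _ => q.smul_mem c) fun n hn u hu => ?_
  refine h1_le_of_zWord_mem (q.comap (LinearMap.mulLeft k (z k n))) (fun l hl => ?_) hu
  rw [Submodule.mem_comap, LinearMap.mulLeft_apply, ← zWord_cons]
  exact h _ (by simp) (by simpa using ⟨hn, hl⟩)

theorem sigmaIndex_nil (m : ℕ) : sigmaIndex m [] = (if m = 0 then 1 else 0 : H k) := by
  rcases m with _ | m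
  · simp [sigmaIndex]
  · simp [sigmaIndex]

theorem sigmaIndex_cons (m a : ℕ) (l : List ℕ) :
    sigmaIndex (k := k) m (a :: l) =
      ∑ p ∈ antidiagonal m, z k (a + p.1) * sigmaIndex p.2 l := by
  simp only [sigmaIndex, mul_sum]
  rw [sum_sigma']
  refine sum_bij' (fun ε _ => ⟨(ε 0, ∑ i, Fin.tail ε i), Fin.tail ε⟩)
    (fun s _ => Fin.cons s.1.1 s.2) ?_ ?_ ?_ ?_ ?_
  · intro ε hε
    rw [Finset.Nat.mem_antidiagonalTuple] at hε
    simp only [mem_sigma, HasAntidiagonal.mem_antidiagonal, Finset.Nat.mem_antidiagonalTuple]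
    refine ⟨?_, trivial⟩
    rw [← hε]
    exact (Fin.sum_univ_succ ε).symm
  · rintro ⟨⟨i, j⟩, ε⟩ h
    simp only [mem_sigma, HasAntidiagonal.mem_antidiagonal,
      Finset.Nat.mem_antidiagonalTuple] at h ⊢
    refine (Fin.sum_univ_succ (n := l.length) _).trans ?_
    simp [h]
  · intro ε _
    exact Fin.cons_self_tail ε
  · rintro ⟨⟨i, j⟩, ε⟩ h
    simp only [mem_sigma, HasAntidiagonal.mem_antidiagonal,
      Finset.Nat.mem_antidiagonalTuple] at h
    obtain ⟨-, rfl⟩ := h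
    rfl
  · intro ε _
    rw [← zWord_cons]
    congr 1
    exact List.ofFn_succ

theorem sigma_zWord (m : ℕ) {l : List ℕ} (hl : l ≠ []) (hl1 : ∀ n ∈ l, 1 ≤ n) :
    sigma m (zWord k l) = sigmaIndex m l := by
  have h : ofIndex l ≠ [] := by
    intro h0
    have := toIndex_ofIndex hl1
    rw [h0] at this
    exact hl this.symm
  rw [← word_ofIndex, sigma, linExt_word, if_neg h, if_pos ((ofIndex_endsY l).resolve_left h),
    toIndex_ofIndex hl1]

variable (k) in
/-- The algebra map `x ↦ x`, `y ↦ (1 + x u)⁻¹ y`, which is `∑_m (-1)^m σ_m u^m` on `𝔥¹`. -/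
def sigmaSeries : H k →ₐ[k] PowerSeries (H k) :=
  FreeAlgebra.lift k fun a =>
    match a with
    | .x => cx k
    | .y => geomSeries (-ltr k .x) * cy k

theorem sigmaSeries_x : sigmaSeries k (ltr k .x) = cx k := by simp [sigmaSeries]

theorem sigmaSeries_y : sigmaSeries k (ltr k .y) = geomSeries (-ltr k .x) * cy k := by
  simp [sigmaSeries]

theorem coeff_sigmaSeries_z (m : ℕ) {a : ℕ} (ha : 1 ≤ a) :
    PowerSeries.coeff m (sigmaSeries k (z k a)) = (-1 : k) ^ m • z k (a + m) := by
  rw [z, map_mul (sigmaSeries k), map_pow, sigmaSeries_x, sigmaSeries_y, ← map_pow,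
    PowerSeries.coeff_C_mul, PowerSeries.coeff_mul_C, geomSeries, PowerSeries.coeff_mk, z,
    Nat.sub_add_comm ha, pow_add]
  rcases Nat.even_or_odd m with h | h <;> simp [h.neg_pow, mul_assoc]

theorem coeff_sigmaSeries_zWord (m : ℕ) {l : List ℕ} (hl : ∀ n ∈ l, 1 ≤ n) :
    PowerSeries.coeff m (sigmaSeries k (zWord k l)) = (-1 : k) ^ m • sigmaIndex m l := by
  induction l generalizing m with
  | nil =>
    rw [zWord_nil, map_one, PowerSeries.coeff_one, sigmaIndex_nil]
    split_ifs with h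
    · simp [h]
    · simp
  | cons a l ih =>
    rw [zWord_cons, map_mul (sigmaSeries k), PowerSeries.coeff_mul, sigmaIndex_cons, smul_sum]
    refine sum_congr rfl fun p hp => ?_
    rw [HasAntidiagonal.mem_antidiagonal] at hp
    rw [ih p.2 fun n hn => hl n (by simp [hn]), coeff_sigmaSeries_z _ (hl a (by simp)),
      smul_mul_smul_comm, ← pow_add, hp]

/-- Restricted to `𝔥y`: by convention `σ_m(1) = 1` for every `m`, while the algebra map sends `1` to
the constant series `1`. -/
theorem coeff_sigmaSeries (m : ℕ) {w : H k} (hw : w ∈ hy k) :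
    PowerSeries.coeff m (sigmaSeries k w) = (-1 : k) ^ m • sigma m w := by
  refine hy_le_of_zWord_mem
    { carrier := {w | PowerSeries.coeff m (sigmaSeries k w) = (-1 : k) ^ m • sigma m w}
      add_mem' := fun {u v} hu hv => by
        simp only [Set.mem_ofPred_eq] at hu hv ⊢
        simp only [map_add, hu, hv, smul_add]
      zero_mem' := by simp
      smul_mem' := fun c u hu => by
        simp only [Set.mem_ofPred_eq] at hu ⊢
        rw [map_smul (sigmaSeries k), map_smul (sigma m), PowerSeries.coeff_smul, hu, smul_comm] }
    (fun l hl hl1 => ?_) hw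
  exact (coeff_sigmaSeries_zWord m hl1).trans (by rw [sigma_zWord m hl hl1])

theorem sigma_zero {w : H k} (hw : w ∈ hy k) : sigma 0 w = w := by
  refine hy_le_of_zWord_mem (LinearMap.eqLocus (sigma 0) LinearMap.id) (fun l hl hl1 => ?_) hw
  rw [LinearMap.mem_eqLocus, sigma_zWord 0 hl hl1, sigmaIndex,
    Finset.Nat.antidiagonalTuple_zero_right]
  simp

variable (k) in
/-- The algebra map `x ↦ x (1 + y u)⁻¹`, `y ↦ y`. -/
def sigmaBarSeries : H k →ₐ[k] PowerSeries (H k) :=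
  FreeAlgebra.lift k fun a =>
    match a with
    | .x => cx k * geomSeries (-ltr k .y)
    | .y => cy k

theorem sigmaBarSeries_x : sigmaBarSeries k (ltr k .x) = cx k * geomSeries (-ltr k .y) := by
  simp [sigmaBarSeries]

theorem sigmaBarSeries_y : sigmaBarSeries k (ltr k .y) = cy k := by
  simp [sigmaBarSeries]

theorem tau_mul (u v : H k) : tau (u * v) = tau v * tau u := by simp [tau]

theorem tau_one : tau (1 : H k) = 1 := by simp [tau]

theorem tau_x : tau (ltr k .x) = ltr k .y := by simp [tau, tauHom]

theorem tau_y : tau (ltr k .y) = ltr k .x := by simp [tau, tauHom]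

theorem tau_pow (u : H k) (n : ℕ) : tau (u ^ n) = tau u ^ n := by
  induction n with
  | zero => simp [tau_one]
  | succ n ih => rw [pow_succ, tau_mul, ih, pow_succ']

theorem coeff_sigmaBarSeries (m : ℕ) (w : H k) : PowerSeries.coeff m (sigmaBarSeries k w) =
    tau (PowerSeries.coeff m (sigmaSeries k (tau w))) := by
  induction w using letter_induction generalizing m with
  | hadd u v hu hv => simp only [map_add, hu, hv]
  | hsmul c u hu =>
    rw [map_smul (sigmaBarSeries k), map_smul tau, map_smul (sigmaSeries k), PowerSeries.coeff_smul,
      PowerSeries.coeff_smul, hu, map_smul tau]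
  | hone =>
    rw [tau_one, map_one (sigmaBarSeries k), map_one (sigmaSeries k), PowerSeries.coeff_one]
    split_ifs
    · rw [tau_one]
    · rw [map_zero]
  | hmul a u hu =>
    have ha : ∀ m, PowerSeries.coeff m (sigmaBarSeries k (ltr k a)) =
        tau (PowerSeries.coeff m (sigmaSeries k (tau (ltr k a)))) := by
      intro m
      cases a
      · rw [sigmaBarSeries_x, tau_x, sigmaSeries_y, PowerSeries.coeff_C_mul,
          PowerSeries.coeff_mul_C, tau_mul, tau_y, geomSeries, geomSeries, PowerSeries.coeff_mk,
          PowerSeries.coeff_mk, tau_pow, map_neg, tau_x]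
      · rw [sigmaBarSeries_y, tau_y, sigmaSeries_x, PowerSeries.coeff_C, PowerSeries.coeff_C]
        split_ifs
        · rw [tau_x]
        · rw [map_zero]
    -- `τ` reverses products, so the two indices of the convolution have to be exchanged.
    rw [map_mul (sigmaBarSeries k), tau_mul, map_mul (sigmaSeries k), PowerSeries.coeff_mul,
      PowerSeries.coeff_mul, map_sum, ← Finset.Nat.sum_antidiagonal_swap]
    refine sum_congr rfl fun p _ => ?_
    rw [tau_mul, ← ha, ← hu]
    rfl

/-- A comparison of algebra maps on letters: on `x` it is the definition of `Δ(x)`, and on `y` it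
says `(1 + uΔ(x))⁻¹ Δ(y) = y`. -/
theorem sigmaBarSeries_eq (w : H k) : sigmaBarSeries k w = deltaExt k (sigmaSeries k w) := by
  induction w using letter_induction with
  | hadd u v hu hv => simp only [map_add, hu, hv]
  | hsmul c u hu =>
    ext n
    have := congrArg (PowerSeries.coeff n) hu
    rw [coeff_deltaExt] at this
    rw [map_smul (sigmaBarSeries k), map_smul (sigmaSeries k), PowerSeries.coeff_smul, this,
      coeff_deltaExt, smul_sum]
    simp
  | hone => rw [map_one, map_one, ← map_one PowerSeries.C, deltaExt_C, map_one, map_one]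
  | hmul a u hu =>
    rw [map_mul (sigmaBarSeries k), map_mul (sigmaSeries k), hu]
    cases a
    · rw [sigmaBarSeries_x, sigmaSeries_x, deltaExt_C_mul, deltaHom_x]
    · rw [sigmaBarSeries_y, sigmaSeries_y, mul_assoc]
      set g := sigmaSeries k u
      have h1 : (1 + PowerSeries.X * deltaHom k (ltr k .x)) *
          deltaExt k (geomSeries (-ltr k .x) * (cy k * g)) =
          deltaHom k (ltr k .y) * deltaExt k g := by
        rw [← deltaExt_C_mul, add_mul, one_mul, mul_assoc, ← deltaExt_C_mul, ← deltaExt_X_mul,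
          ← map_add (deltaExt k), ← mul_assoc (PowerSeries.C _), ← mul_assoc PowerSeries.X,
          ← add_mul, ← mul_assoc PowerSeries.X, ← one_add_mul, one_add_mul_geomSeries_neg, one_mul]
      have h2 : deltaHom k (ltr k .y) = (1 + PowerSeries.X * deltaHom k (ltr k .x)) * cy k := by
        rw [deltaHom_y, deltaHom_x]
        simp only [add_mul, one_mul, mul_assoc]
      have h3 : 1 + PowerSeries.X * deltaHom k (ltr k .x) =
          (1 + PowerSeries.X * PowerSeries.C (ltr k .x + ltr k .y)) * geomSeries (-ltr k .y) := by
        rw [deltaHom_x, map_add, mul_add, add_mul, add_mul, one_mul]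
        nth_rewrite 2 [geomSeries_neg_eq]
        simp only [mul_assoc]
        abel
      -- An explicit left inverse of `1 + uΔ(x)`, obtained from its factorization in `h3`;
      -- cancelling it in `h1` gives the claim.
      have h4 : (1 + PowerSeries.X * cy k) * geomSeries (-(ltr k .x + ltr k .y)) *
          (1 + PowerSeries.X * deltaHom k (ltr k .x)) = 1 := by
        rw [h3, mul_assoc, ← mul_assoc (geomSeries _), geomSeries_neg_mul_one_add, one_mul,
          one_add_mul_geomSeries_neg]
      have h5 := congrArg ((1 + PowerSeries.X * cy k) *
        geomSeries (-(ltr k .x + ltr k .y)) * ·) h1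
      rw [h2, mul_assoc _ (cy k), ← mul_assoc _ (1 + PowerSeries.X * deltaHom k (ltr k .x)),
        h4, one_mul, ← mul_assoc _ (1 + PowerSeries.X * deltaHom k (ltr k .x)), h4, one_mul] at h5
      exact h5.symm

theorem tau_mem_xhy {w : H k} (hw : w ∈ xhy k) : tau w ∈ xhy k := by
  obtain ⟨v, rfl⟩ := mem_xhy.1 hw
  exact mem_xhy.2 ⟨tau v, by simp only [tau_mul, tau_x, tau_y, mul_assoc]⟩

theorem smul_sigmaBar0 (m : ℕ) (w : h0 k) (hw : (w : H k) ∈ xhy k) :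
    (-1 : k) ^ m • sigmaBar0 m w =
      ∑ p ∈ antidiagonal m, (-1 : k) ^ p.2 • delta0 k p.1 (sigma0 p.2 w) := by
  refine Subtype.ext ?_
  rw [AddSubmonoidClass.coe_finsetSum]
  have h := congrArg (PowerSeries.coeff m) (sigmaBarSeries_eq (w : H k))
  rw [coeff_sigmaBarSeries, coeff_sigmaSeries m (xhy_le_hy (tau_mem_xhy hw)), map_smul,
    coeff_deltaExt] at h
  refine h.trans (sum_congr rfl fun p _ => ?_)
  rw [coeff_sigmaSeries _ (xhy_le_hy hw), map_smul]
  rfl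

theorem sigma0_one (m : ℕ) : sigma0 m (one0 k) = one0 k := by
  refine Subtype.ext ?_
  change sigma m (1 : H k) = 1
  rw [← word_nil, sigma, linExt_word, if_pos rfl, word_nil]

theorem sigmaBar0_one (m : ℕ) : sigmaBar0 m (one0 k) = one0 k := by
  have h : tau0 (one0 k) = one0 k := Subtype.ext tau_one
  rw [sigmaBar0, LinearMap.comp_apply, LinearMap.comp_apply, h, sigma0_one, h]

theorem delta0_one {m : ℕ} (hm : m ≠ 0) : delta0 k m (one0 k) = 0 := Subtype.ext (delta_one hm)

theorem exists_eq_smul_one_add (w : h0 k) :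
    ∃ (c : k) (v : h0 k), (v : H k) ∈ xhy k ∧ w = c • one0 k + v := by
  obtain ⟨c, v, h⟩ := mem_h0.1 w.2
  exact ⟨c, ⟨_, xhy_le_h0 (mem_xhy.2 ⟨v, rfl⟩)⟩, mem_xhy.2 ⟨v, rfl⟩, Subtype.ext h⟩

variable {R : Type*} [CommRing R] [Algebra k R] (ζ : h0 k →ₗ[k] R)

/-- On `x𝔥y` one has `(-1)ᵐ σ̄_m = ∑ (-1)ʲ Δ_{m-j} σ_j`. If the `Δ_i` with `i ≥ 1` vanish under `ζ`,
only `σ_m` survives. Conversely `σ_m` cancels against `σ̄_m`, induction removes the intermediate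
terms, and `Δ_m σ_0 = Δ_m` remains. Constants contribute nothing to either condition. -/
theorem delta0_iff_sigma0 :
    (∀ m, m ≠ 0 → ∀ w, ζ (delta0 k m w) = 0) ↔
      ∀ m w, ζ (sigma0 m w - sigmaBar0 m w) = 0 := by
  have hs : ∀ m (a : R), (-1 : k) ^ m • a = 0 → a = 0 := fun m a h => by
    have h2 : (-1 : k) ^ m • (-1 : k) ^ m • a = 0 := by rw [h, smul_zero]
    rwa [smul_smul, ← mul_pow, neg_one_mul, neg_neg, one_pow, one_smul] at h2
  constructor
  · intro h m w
    obtain ⟨c, v, hv, rfl⟩ := exists_eq_smul_one_add w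
    simp only [map_add, map_smul, sigma0_one, sigmaBar0_one, add_sub_add_left_eq_sub]
    refine hs m _ ?_
    rw [map_sub, smul_sub, ← map_smul ζ, ← map_smul ζ _ (sigmaBar0 m v), smul_sigmaBar0 m v hv,
      map_sum, sum_eq_single (0, m)]
    · rw [delta0_zero, sub_self]
    · rintro ⟨i, j⟩ hij hne
      rw [HasAntidiagonal.mem_antidiagonal] at hij
      have hi : i ≠ 0 := by
        rintro rfl
        exact hne (by rw [← hij, zero_add])
      rw [map_smul, h i hi, smul_zero]
    · intro h; exact absurd (by simp) h
  · intro h m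
    induction m using Nat.strong_induction_on with
    | _ m ih =>
      intro hm w
      obtain ⟨c, v, hv, rfl⟩ := exists_eq_smul_one_add w
      rw [map_add, map_smul, delta0_one hm, smul_zero, zero_add]
      have e := congrArg ζ (smul_sigmaBar0 m v hv)
      have e2 := h m v
      rw [map_sub, sub_eq_zero] at e2
      have h0 : sigma0 0 v = v := Subtype.ext (sigma_zero (xhy_le_hy hv))
      rw [map_smul, ← e2, map_sum, ← add_sum_erase _ _ (show (0, m) ∈ antidiagonal m by simp),
        ← add_sum_erase _ _ (show (m, 0) ∈ (antidiagonal m).erase (0, m) by simp [hm]),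
        sum_eq_zero] at e
      · simpa [delta0_zero, h0] using e
      · rintro ⟨i, j⟩ hij
        simp only [mem_erase, HasAntidiagonal.mem_antidiagonal, ne_eq, Prod.mk.injEq, not_and] at hij
        rw [map_smul, ih i (by omega) (by omega), smul_zero]

end Ohno

/-! ### Regularized values of `yᵐ` and the map `ρ` -/

section Regularizations

open Finset

variable {k : Type*} [CommRing k]

theorem stuffle_y_pow_z_succ (m : ℕ) {n : ℕ} (hn : 1 ≤ n) :
    stuffle 0 (ltr k .y ^ m) (z k n) = PowerSeries.coeff m (geomSeries (ltr k .y) *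
      ((PowerSeries.C (z k n) + PowerSeries.X * PowerSeries.C (z k (n + 1))) *
        geomSeries (ltr k .y))) := by
  have h1 : stSeries k 1 = geomSeries (ltr k .y) := by
    ext m
    rw [coeff_stSeries, stuffle_one_right _ _ (y_pow_mem k m)]
    simp [geomSeries]
  rw [← coeff_stSeries, ← mul_one (z k n), stSeries_z_mul hn one_mem_h1, h1, mul_one]

/-- By `stuffle_y_pow_z_succ` each summand has a part with `z_n` and a part with `z_{n+1}`, and the
alternating sum telescopes. -/
theorem sum_stuffle_y_pow_z (m : ℕ) {r : ℕ} (hr : 1 ≤ r) :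
    ∑ p ∈ antidiagonal m, (-1 : k) ^ p.1 • stuffle 0 (ltr k .y ^ p.2) (z k (p.1 + r)) =
      PowerSeries.coeff m (geomSeries (ltr k .y) *
        (PowerSeries.C (z k r) * geomSeries (ltr k .y))) := by
  have h := fun m r hr => stuffle_y_pow_z_succ (k := k) m (n := r) hr
  simp only [add_mul, mul_add, map_add, mul_assoc, mul_X_mul] at h
  induction m generalizing r with
  | zero =>
    rw [Finset.Nat.antidiagonal_zero, sum_singleton, pow_zero, one_smul, zero_add, h 0 r hr,
      PowerSeries.coeff_zero_X_mul, add_zero]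
  | succ m ih =>
    have e : ∀ n, n + 1 + r = n + (r + 1) := fun n => by omega
    rw [Finset.Nat.sum_antidiagonal_succ]
    simp only [pow_zero, one_smul, zero_add, pow_succ (-1 : k), mul_neg_one, neg_smul, sum_neg_distrib, e]
    rw [ih (by omega), h (m + 1) r hr, PowerSeries.coeff_succ_X_mul, add_neg_cancel_right]

/-- Newton's identity, with `yᵐ` in the role of the elementary symmetric functions and `z_n` in that
of the power sums. -/
theorem succ_smul_y_pow (m : ℕ) :
    (m + 1 : k) • ltr k .y ^ (m + 1) =
      ∑ p ∈ antidiagonal m, (-1 : k) ^ p.1 • stuffle 0 (ltr k .y ^ p.2) (z k (p.1 + 1)) := by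
  rw [sum_stuffle_y_pow_z m le_rfl, z_one, PowerSeries.coeff_mul]
  have : ∀ p ∈ antidiagonal m, PowerSeries.coeff p.1 (geomSeries (ltr k .y)) *
      PowerSeries.coeff p.2 (cy k * geomSeries (ltr k .y)) = ltr k .y ^ (m + 1) := by
    intro p hp
    rw [HasAntidiagonal.mem_antidiagonal] at hp
    rw [PowerSeries.coeff_C_mul, geomSeries, PowerSeries.coeff_mk, PowerSeries.coeff_mk, ← pow_succ',
      ← pow_add, ← add_assoc, hp]
  rw [sum_congr rfl this, sum_const, Finset.Nat.card_antidiagonal, ← Nat.cast_smul_eq_nsmul k]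
  push_cast
  rfl

theorem shuffle_y_y_pow (m : ℕ) :
    shuffle 0 (ltr k .y) (ltr k .y ^ m) = (m + 1 : k) • ltr k .y ^ (m + 1) := by
  induction m with
  | zero => simp [shuffle_one_right]
  | succ m ih =>
    have h := shuffle_letter .y .y 1 (ltr k .y ^ m)
    rw [mul_one, shuffle_one_left, ih, mul_smul_comm, ← pow_succ', ← pow_succ'] at h
    rw [h]
    push_cast
    module

variable (k) in
/-- `z_n` as an element of `𝔥¹`. -/
def z1 (n : ℕ) : h1 k := ⟨z k n, hy_le_h1 (z_mem_hy n)⟩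

theorem z1_one : z1 k 1 = yPow k 1 := Subtype.ext (by rw [yPow_coe, pow_one]; exact z_one)

theorem succ_smul_yPow_stuffle (m : ℕ) :
    (m + 1 : k) • yPow k (m + 1) =
      ∑ p ∈ antidiagonal m, (-1 : k) ^ p.1 • stuffle1 0 (yPow k p.2) (z1 k (p.1 + 1)) := by
  refine Subtype.ext ?_
  rw [AddSubmonoidClass.coe_finsetSum]
  exact succ_smul_y_pow m

theorem succ_smul_yPow_shuffle (m : ℕ) :
    (m + 1 : k) • yPow k (m + 1) = shuffle1 0 (yPow k 1) (yPow k m) := by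
  refine Subtype.ext ?_
  change (m + 1 : k) • ltr k .y ^ (m + 1) = shuffle 0 (ltr k .y ^ 1) (ltr k .y ^ m)
  rw [pow_one, shuffle_y_y_pow]

variable {R : Type*} [CommRing R]

theorem rho_X_pow (A : PowerSeries R) (n : ℕ) : rho A (X ^ n) =
    ∑ p ∈ antidiagonal n, C (((n.descFactorial p.1 : ℕ) : R) * PowerSeries.coeff p.1 A) *
      X ^ p.2 := by
  have h := (Polynomial.basisMonomials R).constr_basis R (fun n =>
    ∑ p ∈ antidiagonal n, C (((n.descFactorial p.1 : ℕ) : R) * PowerSeries.coeff p.1 A) *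
      X ^ p.2 : ℕ → R[X]) n
  rwa [Polynomial.coe_basisMonomials, show (fun s => Polynomial.monomial s (1 : R)) n = X ^ n from
    Polynomial.monomial_one_right_eq_X_pow n] at h

theorem rho_C_mul (A : PowerSeries R) (a : R) (f : R[X]) : rho A (C a * f) = C a * rho A f := by
  rw [← Polynomial.smul_eq_C_mul, map_smul, Polynomial.smul_eq_C_mul]

theorem coeff_rho_X_pow (A : PowerSeries R) (hA : PowerSeries.coeff 0 A = 1) {n N : ℕ}
    (h : n ≤ N) : (rho A (X ^ n)).coeff N = if n = N then 1 else 0 := by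
  rw [rho_X_pow, Polynomial.finsetSum_coeff]
  simp only [Polynomial.coeff_C_mul, Polynomial.coeff_X_pow]
  split_ifs with hn
  · subst hn
    rw [sum_eq_single (0, n)]
    · simp [hA]
    · rintro ⟨i, j⟩ hij hne
      rw [HasAntidiagonal.mem_antidiagonal] at hij
      rw [if_neg, mul_zero]
      rintro rfl
      exact hne (by simp at hij; rw [hij])
    · intro h; exact absurd (by simp) h
  · refine sum_eq_zero fun p hp => ?_
    rw [HasAntidiagonal.mem_antidiagonal] at hp
    rw [if_neg (by omega), mul_zero]

/-- `ρ` is triangular in the powers of `T` with diagonal entries `A_0 = 1`, so it preserves leading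
coefficients. -/
theorem rho_injective (A : PowerSeries R) (hA : PowerSeries.coeff 0 A = 1) :
    Function.Injective (rho A) := by
  rw [injective_iff_map_eq_zero]
  intro p hp
  have h : (rho A p).coeff p.natDegree = p.leadingCoeff := by
    have e := congrArg (rho A) (Polynomial.as_sum_range_C_mul_X_pow p)
    rw [e, map_sum, Polynomial.finsetSum_coeff, sum_eq_single p.natDegree]
    · rw [rho_C_mul, Polynomial.coeff_C_mul, coeff_rho_X_pow A hA le_rfl, if_pos rfl, mul_one]
      rfl
    · intro i hi hne
      rw [mem_range] at hi
      rw [rho_C_mul, Polynomial.coeff_C_mul, coeff_rho_X_pow A hA (by omega), if_neg hne, mul_zero]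
    · intro h; exact absurd (by simp) h
  rw [hp, Polynomial.coeff_zero] at h
  exact Polynomial.leadingCoeff_eq_zero.1 h.symm

variable [Algebra k R]

/-- The finite double shuffle relations over an arbitrary base ring. -/
structure FiniteDoubleShuffle (ζ : h0 k →ₗ[k] R) : Prop where
  map_one : ζ (one0 k) = 1
  shuffle : ∀ w₁ w₂, ζ (shuffle0 0 w₁ w₂) = ζ w₁ * ζ w₂
  stuffle : ∀ w₁ w₂, ζ (stuffle0 0 w₁ w₂) = ζ w₁ * ζ w₂

/-- `∑_{n ≥ 2} (-1)ⁿ ζ(z_n) uⁿ`. -/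
def zetaSeries (ζ : h0 k →ₗ[k] R) : PowerSeries R :=
  PowerSeries.mk fun n => if hn : 2 ≤ n then (-1) ^ n * ζ (z0 k n hn) else 0

/-- The characterization of `exp (∑_{n ≥ 2} (-1)ⁿ / n ζ(z_n) uⁿ)` by a differential equation. -/
structure IsExpSeries (ζ : h0 k →ₗ[k] R) (A : PowerSeries R) : Prop where
  coeff_zero : PowerSeries.coeff 0 A = 1
  eulerDer : eulerDer A = zetaSeries ζ * A

variable {ζ : h0 k →ₗ[k] R} {A : PowerSeries R} {F G : h1 k →ₗ[k] R[X]}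

theorem IsRegHom.map_z1 {mul : h1 k → h1 k → h1 k} (hG : IsRegHom mul ζ G) {n : ℕ} (hn : 2 ≤ n) :
    G (z1 k n) = C (ζ (z0 k n hn)) := hG.restrict (z0 k n hn)

theorem IsRegHom.map_yPow_zero {mul : h1 k → h1 k → h1 k} (hG : IsRegHom mul ζ G) :
    G (yPow k 0) = 1 := by rw [yPow_zero, hG.map_one]

/-- The generating series of Newton's identity after `G`: here `G(y) = T`, while `G(z_n) = ζ(z_n)`
for `n ≥ 2`. Formally it says `∑ G(yᵐ)uᵐ = A(u)⁻¹ e^{Tu}`. -/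
theorem eulerDer_stuffle_y (hG : IsRegHom (stuffle1 0) ζ G) :
    eulerDer (PowerSeries.mk fun m => G (yPow k m)) =
      (PowerSeries.X * PowerSeries.C X - (zetaSeries ζ).map C) *
        PowerSeries.mk fun m => G (yPow k m) := by
  ext1 m
  rcases m with _ | m
  · simp only [coeff_eulerDer, PowerSeries.coeff_mul, Finset.Nat.antidiagonal_zero, sum_singleton,
      map_sub, PowerSeries.coeff_map, zetaSeries, PowerSeries.coeff_mk]
    simp [-PowerSeries.coeff_zero_eq_constantCoeff]
  · have h : PowerSeries.X * PowerSeries.C X - (zetaSeries ζ).map C =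
        PowerSeries.X * PowerSeries.mk fun n => (-1 : k) ^ n • G (z1 k (n + 1)) := by
      ext1 n
      rcases n with _ | n
      · rw [map_sub, PowerSeries.coeff_map, zetaSeries, PowerSeries.coeff_mk]
        simp
      · rw [map_sub, PowerSeries.coeff_succ_X_mul, PowerSeries.coeff_succ_X_mul,
          PowerSeries.coeff_map, zetaSeries, PowerSeries.coeff_mk, PowerSeries.coeff_mk]
        rcases n with _ | n
        · simp [z1_one, hG.map_y]
        · rw [dif_pos (by omega), hG.map_z1 (by omega), PowerSeries.coeff_succ_C, zero_sub,
            map_mul, pow_succ _ (n + 1)]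
          rcases Nat.even_or_odd (n + 1) with h | h <;> simp [h.neg_one_pow]
    have h2 := congrArg G (succ_smul_yPow_stuffle (k := k) m)
    rw [map_smul, map_sum] at h2
    rw [coeff_eulerDer, PowerSeries.coeff_mk, h, mul_assoc, PowerSeries.coeff_succ_X_mul,
      PowerSeries.coeff_mul, ← Nat.cast_smul_eq_nsmul k]
    push_cast
    rw [h2]
    refine sum_congr rfl fun p _ => ?_
    rw [map_smul, hG.map_mul, PowerSeries.coeff_mk, PowerSeries.coeff_mk, smul_mul_assoc, mul_comm]

theorem factorial_smul_map_yPow (hF : IsRegHom (shuffle1 0) ζ F) (m : ℕ) :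
    (m.factorial : R[X]) * F (yPow k m) = X ^ m := by
  induction m with
  | zero => simp [hF.map_yPow_zero]
  | succ m ih =>
    have h := congrArg F (succ_smul_yPow_shuffle (k := k) m)
    rw [map_smul, hF.map_mul, hF.map_y, show (m + 1 : k) = ((m + 1 : ℕ) : k) by push_cast; rfl,
      Nat.cast_smul_eq_nsmul, nsmul_eq_mul] at h
    rw [Nat.factorial_succ, Nat.cast_mul, mul_comm ((m + 1 : ℕ) : R[X]), mul_assoc, h, pow_succ',
      ← ih]
    ring

variable [Algebra ℚ k]

theorem smul_left_cancel_succ {M : Type*} [AddCommGroup M] [Module k M] (m : ℕ) {a b : M}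
    (h : (m + 1 : k) • a = (m + 1 : k) • b) : a = b := by
  have hu : algebraMap ℚ k ((m : ℚ) + 1)⁻¹ * (m + 1 : k) = 1 := by
    have : (m + 1 : k) = algebraMap ℚ k ((m : ℚ) + 1) := by simp
    rw [this, ← map_mul, inv_mul_cancel₀ (by positivity), map_one]
  rw [← one_smul k a, ← one_smul k b, ← hu, mul_smul, mul_smul, h]

/-- Both `∑ F(yᵐ)uᵐ = e^{Tu}` and `A(u) ∑ G(yᵐ)uᵐ` have constant term `1` and solve `u h' = Tu h`,
whose solution is unique when positive integers are invertible. -/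
theorem shuffle_yPow_eq (hA : IsExpSeries ζ A) (hF : IsRegHom (shuffle1 0) ζ F)
    (hG : IsRegHom (stuffle1 0) ζ G) (m : ℕ) :
    F (yPow k m) = ∑ p ∈ antidiagonal m, C (PowerSeries.coeff p.1 A) * G (yPow k p.2) := by
  set g : PowerSeries R[X] := PowerSeries.mk fun m => G (yPow k m) with hg
  have hAg : eulerDer (A.map C * g) = PowerSeries.X * (PowerSeries.C X * (A.map C * g)) := by
    have hA' : eulerDer (A.map (C : R →+* R[X])) = (zetaSeries ζ).map C * A.map C := by
      rw [← map_mul, ← hA.eulerDer]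
      ext1 n
      rw [coeff_eulerDer, PowerSeries.coeff_map, PowerSeries.coeff_map, coeff_eulerDer, map_nsmul]
    rw [eulerDer_mul, hA', eulerDer_stuffle_y hG, ← hg]
    ring
  have hc : ∀ m, PowerSeries.coeff m (A.map C * g) =
      ∑ p ∈ antidiagonal m, C (PowerSeries.coeff p.1 A) * G (yPow k p.2) := by
    intro m
    rw [PowerSeries.coeff_mul]
    simp [hg]
  rw [← hc]
  induction m with
  | zero => rw [hF.map_yPow_zero]; simp [hg, hG.map_yPow_zero, hA.coeff_zero, PowerSeries.coeff_mul]
  | succ m ih =>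
    apply smul_left_cancel_succ (k := k) m
    have h := congrArg (PowerSeries.coeff (m + 1)) hAg
    rw [coeff_eulerDer, PowerSeries.coeff_succ_X_mul, PowerSeries.coeff_C_mul, ← ih,
      ← Nat.cast_smul_eq_nsmul k] at h
    push_cast at h
    rw [h, ← map_smul, succ_smul_yPow_shuffle, hF.map_mul, hF.map_y]

theorem factorial_mul_left_cancel (k : Type*) [CommRing k] [Algebra ℚ k] {R : Type*} [CommRing R]
    [Algebra k R] (m : ℕ) {a b : R[X]}
    (h : (m.factorial : R[X]) * a = (m.factorial : R[X]) * b) : a = b := by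
  obtain ⟨n, hn⟩ := Nat.exists_eq_add_of_lt m.factorial_pos
  rw [zero_add] at hn
  apply smul_left_cancel_succ (k := k) n
  rw [show (n + 1 : k) = ((n + 1 : ℕ) : k) by push_cast; rfl, Nat.cast_smul_eq_nsmul,
    Nat.cast_smul_eq_nsmul, ← hn, nsmul_eq_mul, nsmul_eq_mul, h]

/-- The defining property `ρ(e^{Tu}) = A(u)e^{Tu}`, read coefficientwise through `m! F(yᵐ) = Tᵐ`. -/
theorem rho_map_yPow_shuffle (hF : IsRegHom (shuffle1 0) ζ F) (m : ℕ) :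
    rho A (F (yPow k m)) =
      ∑ p ∈ antidiagonal m, C (PowerSeries.coeff p.1 A) * F (yPow k p.2) := by
  refine factorial_mul_left_cancel k m ?_
  rw [← map_natCast C, ← rho_C_mul, map_natCast, factorial_smul_map_yPow hF, rho_X_pow, mul_sum]
  refine sum_congr rfl fun p hp => ?_
  rw [HasAntidiagonal.mem_antidiagonal] at hp
  have : m.factorial = m.descFactorial p.1 * p.2.factorial := by
    rw [← Nat.factorial_mul_descFactorial (show p.1 ≤ m by omega), mul_comm]
    congr 2; omega
  rw [this, ← factorial_smul_map_yPow hF p.2, map_mul, map_natCast]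
  push_cast
  ring

/-- The comparison map `ρ` sends the stuffle regularization of `yᵐ` to its shuffle
regularization. -/
theorem rho_map_yPow_stuffle (hA : IsExpSeries ζ A) (hF : IsRegHom (shuffle1 0) ζ F)
    (hG : IsRegHom (stuffle1 0) ζ G) (m : ℕ) : rho A (G (yPow k m)) = F (yPow k m) := by
  induction m using Nat.strong_induction_on with
  | _ m ih =>
    -- Applying `ρ` to `shuffle_yPow_eq` gives two convolutions with `A`, of `F(yʲ)` and of
    -- `ρ(G(yʲ))`. By induction they agree in all terms with `j < m`, and `A_0 = 1` leaves the
    -- claim.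
    have h1 := congrArg (rho A) (shuffle_yPow_eq hA hF hG m)
    rw [rho_map_yPow_shuffle hF, map_sum, ← add_sum_erase _ _ (show (0, m) ∈ antidiagonal m by simp),
      ← add_sum_erase _ _ (show (0, m) ∈ antidiagonal m by simp)] at h1
    rw [sum_congr (g := fun p => rho A (C (PowerSeries.coeff p.1 A) * G (yPow k p.2))) rfl] at h1
    · simpa [hA.coeff_zero] using (add_right_cancel h1).symm
    · rintro ⟨i, j⟩ hij
      simp only [mem_erase, HasAntidiagonal.mem_antidiagonal, ne_eq, Prod.mk.injEq, not_and] at hij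
      rw [rho_C_mul, ih j (by omega)]

end Regularizations

/-! ### The equivalences at `t = 0` and their interpolation -/

section Equivalences

open Finset

variable {k : Type*} [CommRing k] {R : Type*} [CommRing R] [Algebra k R]
variable {ζ : h0 k →ₗ[k] R} {A : PowerSeries R} {F G : h1 k →ₗ[k] R[X]}

theorem IsRegHom.map_mul_incl {mul : h1 k → h1 k → h1 k} (hF : IsRegHom mul ζ F) (u : h1 k)
    (w : h0 k) : F (mul u (incl k w)) = F u * C (ζ w) := by rw [hF.map_mul, hF.restrict]

/-- A relation `φ(w • w₀) = φ(w) ζ(w₀)` needs to be checked only for `w` in a sequence of divided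
powers. -/
theorem SliceProduct.map_mul_of_seq {mul : h1 k → h1 k → h1 k} {d : h1 k →ₗ[k] h1 k}
    (h : SliceProduct mul d)
    (hζ : ∀ a b c, mul (incl k a) (incl k b) = incl k c → ζ c = ζ a * ζ b) (φ : h1 k →ₗ[k] R)
    {W : ℕ → h1 k} (h0 : W 0 = one1 k) (hW : ∀ m, d (W (m + 1)) = W m)
    (hφ : ∀ m c, φ (mul (W m) (incl k c)) = φ (W m) * ζ c) (w : h1 k) (c : TMZV.h0 k) :
    φ (mul w (incl k c)) = φ w * ζ c := by
  let q : Submodule k (h1 k) :=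
    { carrier := {w | ∀ c, φ (mul w (incl k c)) = φ w * ζ c}
      add_mem' := fun {u v} hu hv c => by rw [h.add_left, map_add, hu, hv, map_add, add_mul]
      zero_mem' := fun c => by
        rw [← h.bilin_apply, map_zero, LinearMap.zero_apply, map_zero, zero_mul]
      smul_mem' := fun a u hu c => by
        rw [h.smul_left, map_smul, hu, map_smul, smul_mul_assoc] }
  refine h.mem_of_seq h0 hW q (fun m a b => ?_) w c
  obtain ⟨e, he⟩ := h.mul_mem a b
  -- Multiplication by `𝔥⁰` is moved to the other factor: `(a • W_m) • b = W_m • (a • b)`.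
  rw [h.comm (incl k a), h.assoc, he, hφ, hφ, hζ _ _ _ he, mul_assoc]

/-- Two products `•`, `•'` satisfy `F(w • w₀)(0) = F(w •' w₀)(0)` for a homomorphism `F` with
respect to `•` if they do so for `w` in a sequence of divided powers for `•'`. -/
theorem SliceProduct.eval_map_eq_of_seq {mul mul' : h1 k → h1 k → h1 k} {d d' : h1 k →ₗ[k] h1 k}
    (h : SliceProduct mul d) (h' : SliceProduct mul' d')
    (hζ : ∀ a b c, mul' (incl k a) (incl k b) = incl k c → ζ c = ζ a * ζ b)
    (hF : IsRegHom mul ζ F) {W : ℕ → h1 k} (h0 : W 0 = one1 k) (hW : ∀ m, d' (W (m + 1)) = W m)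
    (hφ : ∀ m, 1 ≤ m → ∀ c,
      (F (mul (W m) (incl k c))).eval 0 = (F (mul' (W m) (incl k c))).eval 0)
    (w : h1 k) (c : TMZV.h0 k) : (F (mul w (incl k c))).eval 0 = (F (mul' w (incl k c))).eval 0 := by
  have key : ∀ w c, (F (mul w (incl k c))).eval 0 = (F w).eval 0 * ζ c := fun w c => by
    rw [hF.map_mul_incl, Polynomial.eval_mul, Polynomial.eval_C]
  -- As `F` is multiplicative for `•`, the claim says that `w ↦ F(w)(0)` turns `w •' c` into
  -- `F(w)(0) ζ(c)`, and this can be tested on divided powers for `•'`.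
  have := h'.map_mul_of_seq hζ ((Polynomial.leval (0 : R)).restrictScalars k ∘ₗ F) h0 hW
    (fun m c => ?_) w c
  · exact (key w c).trans this.symm
  · rcases m.eq_zero_or_pos with rfl | hm
    · rw [h0, h'.one_mul, ← h.one_mul (incl k c)]
      exact key _ _
    · exact (hφ m hm c).symm.trans (key _ _)

theorem S0_derT (t : k) (n : ℕ) (w : h0 k) : S0 t (derT t n w) = der0 n (S0 t w) :=
  S0_comp_neg t _

theorem S0_sigmaT_sub (t : k) (m : ℕ) (w : h0 k) :
    S0 t (sigmaT t m w - sigmaBarT t m w) = sigma0 m (S0 t w) - sigmaBar0 m (S0 t w) := by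
  rw [map_sub]
  exact congrArg₂ _ (S0_comp_neg t _) (S0_comp_neg t _)

theorem FiniteDoubleShuffle.shuffle_incl (hζ : FiniteDoubleShuffle ζ) (a b c : h0 k)
    (h : shuffle1 0 (incl k a) (incl k b) = incl k c) : ζ c = ζ a * ζ b := by
  rw [← hζ.shuffle]
  congr 1
  exact incl_injective h.symm

theorem FiniteDoubleShuffle.stuffle_incl (hζ : FiniteDoubleShuffle ζ) (a b c : h0 k)
    (h : stuffle1 0 (incl k a) (incl k b) = incl k c) : ζ c = ζ a * ζ b := by
  rw [← hζ.stuffle]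
  congr 1
  exact incl_injective h.symm

/-- The statement `ζ ∘ Δ_m = 0` on `𝔥⁰` for `m ≥ 1`. -/
def DeltaVanishes (ζ : h0 k →ₗ[k] R) : Prop := ∀ m, m ≠ 0 → ∀ w, ζ (delta0 k m w) = 0

theorem map_stuffle_yPow (hF : IsRegHom (shuffle1 0) ζ F) (m : ℕ) (w : h0 k) :
    F (stuffle1 0 (yPow k m) (incl k w)) =
      ∑ p ∈ antidiagonal m, F (yPow k p.1) * C (ζ (delta0 k p.2 w)) := by
  rw [stuffle1_yPow, map_sum]
  exact sum_congr rfl fun p _ => hF.map_mul_incl _ _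

/-- `G(yᵐ)(0)` need not vanish, so `Δ_m` is not isolated directly. With `gᵢ = G(yⁱ)(0)`, the
comparison identity becomes `g_m ζ(w) = ∑ gᵢ ζ(Δ_{m-i} w)`; the term `i = m` cancels, induction
removes the middle ones, and `g_0 = 1`. -/
theorem deltaVanishes_of_stuffle_reg (hG : IsRegHom (stuffle1 0) ζ G)
    (h : ∀ (w₁ : h1 k) (w₀ : h0 k),
      (G (shuffle1 0 w₁ (incl k w₀) - stuffle1 0 w₁ (incl k w₀))).eval 0 = 0) :
    DeltaVanishes ζ := by
  intro m
  induction m using Nat.strong_induction_on with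
  | _ m ih =>
    intro hm w
    have h1 : ∀ i v, (G (shuffle1 0 (yPow k i) (incl k v))).eval 0 =
        (G (yPow k i)).eval 0 * ζ v := fun i v => by
      have := h (yPow k i) v
      rw [map_sub, Polynomial.eval_sub, sub_eq_zero] at this
      rw [this, hG.map_mul_incl, Polynomial.eval_mul, Polynomial.eval_C]
    have h2 := congrArg (fun f => (G f).eval 0) (stuffle1_yPow m w)
    simp only [hG.map_mul_incl, map_sum, Polynomial.eval_mul, Polynomial.eval_C,
      Polynomial.eval_finsetSum, h1] at h2
    rw [← add_sum_erase _ _ (show (m, 0) ∈ antidiagonal m by simp), delta0_zero,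
      ← add_sum_erase _ _ (show (0, m) ∈ (antidiagonal m).erase (m, 0) by simp [hm.symm]),
      sum_eq_zero] at h2
    · simpa [hG.map_yPow_zero] using h2
    · rintro ⟨i, j⟩ hij
      simp only [mem_erase, HasAntidiagonal.mem_antidiagonal, ne_eq, Prod.mk.injEq, not_and] at hij
      rw [ih j (by omega) (by omega), mul_zero]

variable [Algebra ℚ k]

theorem eval_zero_map_yPow (hF : IsRegHom (shuffle1 0) ζ F) {m : ℕ} (hm : m ≠ 0) :
    (F (yPow k m)).eval 0 = 0 := by
  obtain ⟨n, rfl⟩ := Nat.exists_eq_succ_of_ne_zero hm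
  have h := congrArg (fun f => (F f).eval 0) (succ_smul_yPow_shuffle (k := k) n)
  rw [hF.map_mul, hF.map_y, Polynomial.eval_mul, Polynomial.eval_X, zero_mul, map_smul,
    Polynomial.eval_smul] at h
  exact smul_left_cancel_succ (k := k) n (h.trans (smul_zero _).symm)

/-- `F(yⁱ)` has no constant term for `i ≥ 1`, so only the summand `1 ⧢ Δ_m w` survives at `T = 0`.
-/
theorem eval_zero_map_stuffle_yPow (hF : IsRegHom (shuffle1 0) ζ F) (m : ℕ) (w : h0 k) :
    (F (stuffle1 0 (yPow k m) (incl k w))).eval 0 = ζ (delta0 k m w) := by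
  rw [map_stuffle_yPow hF, Polynomial.eval_finsetSum, sum_eq_single (0, m)]
  · simp [hF.map_yPow_zero]
  · rintro ⟨i, j⟩ hij hne
    rw [HasAntidiagonal.mem_antidiagonal] at hij
    have hi : i ≠ 0 := by
      rintro rfl
      exact hne (by rw [← hij, zero_add])
    rw [Polynomial.eval_mul, eval_zero_map_yPow hF hi, zero_mul]
  · intro h; exact absurd (by simp) h

/-- Only products `c * yᵐ` with `c ∈ 𝔥⁰` need checking. There `ρ ∘ G` gives `ζ(c)F(yᵐ)`, and so does
`F` once the terms with `Δ_j`, `j ≥ 1`, are gone. -/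
theorem comparison_of_deltaVanishes (hA : IsExpSeries ζ A) (hF : IsRegHom (shuffle1 0) ζ F)
    (hG : IsRegHom (stuffle1 0) ζ G) (hD : DeltaVanishes ζ) (w : h1 k) :
    F w - rho A (G w) = 0 := by
  let f : h1 k →ₗ[k] R[X] := F - ((rho A).restrictScalars k) ∘ₗ G
  refine sliceProduct_stuffle.mem_of_seq yPow_zero del1_yPow (LinearMap.ker f) (fun m c => ?_) w
  rw [LinearMap.mem_ker]
  change F _ - rho A (G _) = 0
  rw [sliceProduct_stuffle.comm, hG.map_mul_incl, map_stuffle_yPow hF,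
    mul_comm (G _), rho_C_mul, rho_map_yPow_stuffle hA hF hG, sum_eq_single (m, 0)]
  · rw [delta0_zero, mul_comm, sub_self]
  · rintro ⟨i, j⟩ hij hne
    rw [HasAntidiagonal.mem_antidiagonal] at hij
    have hj : j ≠ 0 := by
      rintro rfl
      exact hne (by rw [← hij, add_zero])
    rw [hD j hj, C_0, mul_zero]
  · intro h; exact absurd (by simp) h

theorem comparison_tfae (hA : IsExpSeries ζ A) (hF : IsRegHom (shuffle1 0) ζ F)
    (hG : IsRegHom (stuffle1 0) ζ G) : List.TFAE [
      DeltaVanishes ζ,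
      ∀ w, F w - rho A (G w) = 0,
      ∀ w, (F w - rho A (G w)).eval 0 = 0,
      ∀ (w₁ : h1 k) (w₀ : h0 k), F (shuffle1 0 w₁ (incl k w₀) - stuffle1 0 w₁ (incl k w₀)) = 0,
      ∀ (w₁ : h1 k) (w₀ : h0 k), G (shuffle1 0 w₁ (incl k w₀) - stuffle1 0 w₁ (incl k w₀)) = 0,
      ∀ (w₁ : h1 k) (w₀ : h0 k),
        (F (shuffle1 0 w₁ (incl k w₀) - stuffle1 0 w₁ (incl k w₀))).eval 0 = 0,
      ∀ (w₁ : h1 k) (w₀ : h0 k),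
        (G (shuffle1 0 w₁ (incl k w₀) - stuffle1 0 w₁ (incl k w₀))).eval 0 = 0,
      ∀ n, 1 ≤ n → ∀ w, ζ (der0 n w) = 0,
      ∀ m w, ζ (sigma0 m w - sigmaBar0 m w) = 0] := by
  tfae_have 1 → 2 := comparison_of_deltaVanishes hA hF hG
  tfae_have 2 → 3 := fun h w => by rw [h, Polynomial.eval_zero]
  -- Tested on `yᵐ * w`, where `ρ ∘ G` gives `ζ(w)F(yᵐ)`, which vanishes at `T = 0`.
  tfae_have 3 → 1 := fun h m hm w => by
    have := h (stuffle1 0 (yPow k m) (incl k w))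
    rwa [Polynomial.eval_sub, eval_zero_map_stuffle_yPow hF, hG.map_mul_incl, mul_comm, rho_C_mul,
      rho_map_yPow_stuffle hA hF hG, Polynomial.eval_mul, eval_zero_map_yPow hF hm, mul_zero,
      sub_zero] at this
  tfae_have 2 → 4 := fun h w₁ w₀ => by
    have h' : ∀ w, F w = rho A (G w) := fun w => sub_eq_zero.1 (h w)
    rw [map_sub, hF.map_mul_incl, h' (stuffle1 0 _ _), hG.map_mul_incl, h' w₁, mul_comm (G _),
      rho_C_mul, mul_comm, sub_self]
  tfae_have 2 → 5 := fun h w₁ w₀ => by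
    have h' : ∀ w, F w = rho A (G w) := fun w => sub_eq_zero.1 (h w)
    refine rho_injective A hA.coeff_zero ?_
    rw [map_zero, map_sub, map_sub, ← h', hF.map_mul_incl, hG.map_mul_incl, mul_comm (G _),
      rho_C_mul, ← h', mul_comm, sub_self]
  tfae_have 4 → 6 := fun h w₁ w₀ => by rw [h, Polynomial.eval_zero]
  tfae_have 5 → 7 := fun h w₁ w₀ => by rw [h, Polynomial.eval_zero]
  tfae_have 6 → 1 := fun h m hm w => by
    have := h (yPow k m) w
    rwa [map_sub, Polynomial.eval_sub, eval_zero_map_stuffle_yPow hF, hF.map_mul_incl,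
      Polynomial.eval_mul, eval_zero_map_yPow hF hm, zero_mul, zero_sub, neg_eq_zero] at this
  tfae_have 7 → 1 := deltaVanishes_of_stuffle_reg hG
  tfae_have 1 ↔ 8 := delta0_iff_der0 ζ
  tfae_have 1 ↔ 9 := delta0_iff_sigma0 ζ
  tfae_finish

variable (hζ : FiniteDoubleShuffle ζ)
include hζ

theorem isRegHom_shuffle : IsRegHom (shuffle1 0) ζ (regHom (shuffle1 0) ζ) :=
  sliceProduct_shuffle.isRegHom_regHom hζ.map_one hζ.shuffle_incl

theorem isRegHom_stuffle : IsRegHom (stuffle1 0) ζ (regHom (stuffle1 0) ζ) :=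
  sliceProduct_stuffle.isRegHom_regHom hζ.map_one hζ.stuffle_incl

theorem isRegHom_shuffle_interpolated (t : k) : IsRegHom (shuffle1 t) (ζ ∘ₗ S0 t)
    (regHom (shuffle1 0) ζ ∘ₗ (S1 t).toLinearMap) :=
  S1_isRegHom t (S1_shuffle1 t) (isRegHom_shuffle hζ)

theorem isRegHom_stuffle_interpolated (t : k) : IsRegHom (stuffle1 t) (ζ ∘ₗ S0 t)
    (regHom (stuffle1 0) ζ ∘ₗ (S1 t).toLinearMap) :=
  S1_isRegHom t (S1_stuffle1 t) (isRegHom_stuffle hζ)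

/-- The composite with `S_t` has the defining properties of the extension for the `t`-product, so by
uniqueness it is that extension. -/
theorem regHom_shuffle_interpolated (t : k) : regHom (shuffle1 t) (ζ ∘ₗ S0 t) =
    regHom (shuffle1 0) ζ ∘ₗ (S1 t).toLinearMap :=
  (sliceProduct_shuffle_interpolated t).regHom_unique
    (Classical.epsilon_spec ⟨_, isRegHom_shuffle_interpolated hζ t⟩)
    (isRegHom_shuffle_interpolated hζ t)

theorem regHom_stuffle_interpolated (t : k) : regHom (stuffle1 t) (ζ ∘ₗ S0 t) =
    regHom (stuffle1 0) ζ ∘ₗ (S1 t).toLinearMap :=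
  (sliceProduct_stuffle_interpolated t).regHom_unique
    (Classical.epsilon_spec ⟨_, isRegHom_stuffle_interpolated hζ t⟩)
    (isRegHom_stuffle_interpolated hζ t)

/-- The theorem for the `t`-products over a base ring containing `t`. -/
theorem interpolated_tfae (hA : IsExpSeries ζ A) (t : k) : List.TFAE [
      ∀ n, 1 ≤ n → ∀ w, ζ (der0 n w) = 0,
      ∀ w, regHom (shuffle1 t) (ζ ∘ₗ S0 t) w - rho A (regHom (stuffle1 t) (ζ ∘ₗ S0 t) w) = 0,
      ∀ w, (regHom (shuffle1 t) (ζ ∘ₗ S0 t) w -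
        rho A (regHom (stuffle1 t) (ζ ∘ₗ S0 t) w)).eval 0 = 0,
      ∀ (w₁ : h1 k) (w₀ : h0 k), regHom (shuffle1 t) (ζ ∘ₗ S0 t)
        (shuffle1 t w₁ (incl k w₀) - stuffle1 t w₁ (incl k w₀)) = 0,
      ∀ (w₁ : h1 k) (w₀ : h0 k), regHom (stuffle1 t) (ζ ∘ₗ S0 t)
        (shuffle1 t w₁ (incl k w₀) - stuffle1 t w₁ (incl k w₀)) = 0,
      ∀ (w₁ : h1 k) (w₀ : h0 k), (ζ ∘ₗ S0 t) (reg (shuffle1 t)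
        (shuffle1 t w₁ (incl k w₀) - stuffle1 t w₁ (incl k w₀))) = 0,
      ∀ (w₁ : h1 k) (w₀ : h0 k), (ζ ∘ₗ S0 t) (reg (stuffle1 t)
        (shuffle1 t w₁ (incl k w₀) - stuffle1 t w₁ (incl k w₀))) = 0,
      ∀ m, 1 ≤ m → ∀ w₀ : h0 k, (ζ ∘ₗ S0 t) (reg (shuffle1 t)
        (shuffle1 t (yPow k m) (incl k w₀) - stuffle1 t (yPow k m) (incl k w₀))) = 0,
      ∀ m, 1 ≤ m → ∀ w₀ : h0 k, (ζ ∘ₗ S0 t) (reg (stuffle1 t)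
        (shuffle1 t (yPow k m) (incl k w₀) - stuffle1 t (yPow k m) (incl k w₀))) = 0,
      ∀ n, 1 ≤ n → ∀ w, (ζ ∘ₗ S0 t) (derT t n w) = 0,
      ∀ m w, (ζ ∘ₗ S0 t) (sigmaT t m w - sigmaBarT t m w) = 0] := by
  have hF := isRegHom_shuffle hζ
  have hG := isRegHom_stuffle hζ
  have main := comparison_tfae hA hF hG
  have hregF : ∀ w, (ζ ∘ₗ S0 t) (reg (shuffle1 t) w) =
      (regHom (shuffle1 0) ζ (S1 t w)).eval 0 :=
    (sliceProduct_shuffle_interpolated t).apply_reg (isRegHom_shuffle_interpolated hζ t)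
  have hregG : ∀ w, (ζ ∘ₗ S0 t) (reg (stuffle1 t) w) =
      (regHom (stuffle1 0) ζ (S1 t w)).eval 0 :=
    (sliceProduct_stuffle_interpolated t).apply_reg (isRegHom_stuffle_interpolated hζ t)
  have hS0 : Function.Surjective (S0 t) := fun w => ⟨_, S0_comp_neg t w⟩
  have hS : ∀ w₁ w₀, S1 t (shuffle1 t w₁ (incl k w₀) - stuffle1 t w₁ (incl k w₀)) =
      shuffle1 0 (S1 t w₁) (incl k (S0 t w₀)) - stuffle1 0 (S1 t w₁) (incl k (S0 t w₀)) :=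
    fun w₁ w₀ => by rw [map_sub, S1_shuffle1, S1_stuffle1, S1_incl]
  rw [regHom_shuffle_interpolated hζ, regHom_stuffle_interpolated hζ]
  simp only [hregF, hregG, hS, LinearMap.comp_apply, LinearEquiv.coe_coe]
  set F := regHom (shuffle1 0) ζ with hFdef
  set G := regHom (stuffle1 0) ζ with hGdef
  have e2 : (∀ w, F (S1 t w) - rho A (G (S1 t w)) = 0) ↔ ∀ w, F w - rho A (G w) = 0 :=
    ((S1 t).surjective.forall (p := fun w => F w - rho A (G w) = 0)).symm
  have e3 : (∀ w, (F (S1 t w) - rho A (G (S1 t w))).eval 0 = 0) ↔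
      ∀ w, (F w - rho A (G w)).eval 0 = 0 :=
    ((S1 t).surjective.forall (p := fun w => (F w - rho A (G w)).eval 0 = 0)).symm
  -- As `S_t` is onto `𝔥¹` and `𝔥⁰`, conditions on all pairs are insensitive to it.
  have e4 : ∀ P : h1 k → h0 k → Prop, (∀ w₁ w₀, P (S1 t w₁) (S0 t w₀)) ↔ ∀ w₁ w₀, P w₁ w₀ :=
    fun P => ⟨fun h w₁ w₀ => by
      obtain ⟨w₁, rfl⟩ := (S1 t).surjective w₁
      obtain ⟨w₀, rfl⟩ := hS0 w₀
      exact h w₁ w₀, fun h w₁ w₀ => h _ _⟩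
  rw [e2, e3,
    e4 fun w₁ w₀ => F (shuffle1 0 w₁ (incl k w₀) - stuffle1 0 w₁ (incl k w₀)) = 0,
    e4 fun w₁ w₀ => G (shuffle1 0 w₁ (incl k w₀) - stuffle1 0 w₁ (incl k w₀)) = 0,
    e4 fun w₁ w₀ => (F (shuffle1 0 w₁ (incl k w₀) - stuffle1 0 w₁ (incl k w₀))).eval 0 = 0,
    e4 fun w₁ w₀ => (G (shuffle1 0 w₁ (incl k w₀) - stuffle1 0 w₁ (incl k w₀))).eval 0 = 0]
  tfae_have 1 ↔ 2 := main.out 7 1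
  tfae_have 2 ↔ 3 := main.out 1 2
  tfae_have 2 ↔ 4 := main.out 1 3
  tfae_have 2 ↔ 5 := main.out 1 4
  tfae_have 2 ↔ 6 := main.out 1 5
  tfae_have 2 ↔ 7 := main.out 1 6
  tfae_have 6 → 8 := fun h m _ w₀ => h _ _
  tfae_have 7 → 9 := fun h m _ w₀ => h _ _
  -- `F` is multiplicative for the shuffle product, so the test is against the stuffle product,
  -- along the divided powers `S_t(yᵐ)`. For `G` below the roles are exchanged.
  tfae_have 8 → 6 := fun h w₁ w₀ => by
    rw [map_sub, Polynomial.eval_sub, sub_eq_zero]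
    refine sliceProduct_shuffle.eval_map_eq_of_seq sliceProduct_stuffle hζ.stuffle_incl hF
      (W := fun m => S1 t (yPow k m)) (S1_yPow_zero t) (del1_S1_yPow t) (fun m hm c => ?_) w₁ w₀
    obtain ⟨c, rfl⟩ := hS0 c
    have := h m hm c
    rwa [map_sub, Polynomial.eval_sub, sub_eq_zero] at this
  tfae_have 9 → 7 := fun h w₁ w₀ => by
    rw [map_sub, Polynomial.eval_sub, sub_eq_zero, eq_comm]
    refine sliceProduct_stuffle.eval_map_eq_of_seq sliceProduct_shuffle hζ.shuffle_incl hG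
      (W := fun m => S1 t (yPow k m)) (S1_yPow_zero t) (del1_S1_yPow t) (fun m hm c => ?_) w₁ w₀
    obtain ⟨c, rfl⟩ := hS0 c
    have := h m hm c
    rwa [map_sub, Polynomial.eval_sub, sub_eq_zero, eq_comm] at this
  tfae_have 10 ↔ 1 := by
    simp only [S0_derT]
    exact forall_congr' fun n => forall_congr' fun _ =>
      (hS0.forall (p := fun w => ζ (der0 n w) = 0)).symm
  tfae_have 11 ↔ 1 := by
    simp only [S0_sigmaT_sub]
    exact (forall_congr' fun m => (hS0.forall
      (p := fun w => ζ (sigma0 m w - sigmaBar0 m w) = 0)).symm).trans (main.out 8 7)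
  tfae_finish

end Equivalences

/-! ### The differential equation of `A_R` -/

section ExpSeries

open PowerSeries

theorem eulerDer_eq_X_mul_derivative {A : Type*} [CommRing A] (g : PowerSeries A) :
    eulerDer g = PowerSeries.X * derivative A g := by
  ext1 n
  rcases n with _ | n
  · rw [coeff_eulerDer, zero_smul, coeff_zero_X_mul]
  · rw [coeff_eulerDer, coeff_succ_X_mul, PowerSeries.coeff_derivative, nsmul_eq_mul, mul_comm]
    push_cast
    rfl

theorem eulerDer_map {A B : Type*} [CommRing A] [CommRing B] (f : A →+* B) (g : PowerSeries A) :
    eulerDer (g.map f) = (eulerDer g).map f := by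
  ext1 n
  rw [coeff_eulerDer, PowerSeries.coeff_map, PowerSeries.coeff_map, coeff_eulerDer, map_nsmul]

theorem constantCoeff_exp_subst {K R : Type*} [CommRing K] [Algebra ℚ K] [CommRing R] [Algebra K R]
    {g : PowerSeries R} (hg : constantCoeff g = 0) :
    PowerSeries.coeff 0 ((exp K).subst g) = 1 := by
  rw [coeff_subst' (HasSubst.of_constantCoeff_zero' hg), finsum_eq_single _ 0]
  · simp
  · intro n hn
    simp [hg, hn]

theorem eulerDer_exp_subst {K R : Type*} [CommRing K] [Algebra ℚ K] [CommRing R] [Algebra K R]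
    {g : PowerSeries R} (hg : constantCoeff g = 0) :
    eulerDer ((exp K).subst g) = eulerDer g * (exp K).subst g := by
  let _ : Algebra ℚ R := ((algebraMap K R).comp (algebraMap ℚ K)).toAlgebra
  have hs := HasSubst.of_constantCoeff_zero' hg
  -- The exponential over `K` is replaced by the one over `R`, to which the chain rule for
  -- substitution applies.
  have e : (exp K).subst g = (exp R).subst g := by
    ext1 n
    rw [coeff_subst' hs, coeff_subst' hs]
    refine finsum_congr fun d => ?_
    rw [coeff_exp, coeff_exp, algebra_compatible_smul R]
    rfl
  rw [e, eulerDer_eq_X_mul_derivative, derivative_subst hs, derivative_exp,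
    eulerDer_eq_X_mul_derivative]
  ring

theorem isExpSeries_expSeries {K R : Type*} [Field K] [CharZero K] [CommRing R] [Algebra K R]
    (Z : h0 K →ₗ[K] R) : IsExpSeries Z (expSeries Z) where
  coeff_zero := constantCoeff_exp_subst (by rw [← coeff_zero_eq_constantCoeff_apply]; simp)
  eulerDer := by
    rw [expSeries, eulerDer_exp_subst (by rw [← coeff_zero_eq_constantCoeff_apply]; simp)]
    congr 1
    ext1 n
    rw [coeff_eulerDer, coeff_mk, zetaSeries, coeff_mk]
    split_ifs with hn
    · have h0 : (n : K) ≠ 0 := Nat.cast_ne_zero.2 (by omega)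
      rw [← Nat.cast_smul_eq_nsmul K, smul_smul, mul_div_cancel₀ _ h0, Algebra.smul_def]
      simp
    · exact smul_zero _

end ExpSeries

/-! ### Extension of scalars -/

section BaseChange

/-- The words spanning `𝔥⁰`. -/
def Admissible (w : List Letter) : Prop := w = [] ∨ ∃ v, w = .x :: (v ++ [.y])

theorem Admissible.word_mem_h0 (k : Type*) [CommRing k] {w : List Letter} (h : Admissible w) :
    word k w ∈ h0 k := by
  rcases h with rfl | ⟨v, rfl⟩
  · exact one_mem_h0
  · rw [← word_x_y]
    exact xhy_le_h0 (mem_xhy.2 ⟨_, rfl⟩)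

theorem Admissible.endsY {w : List Letter} (h : Admissible w) : w = [] ∨ EndsY w :=
  h.imp_right fun ⟨v, hv⟩ => by simpa [hv] using endsY_append (.x :: v)

/-- An admissible word as an element of `𝔥⁰`. -/
def word0 (k : Type*) [CommRing k] (w : List Letter) (h : Admissible w) : h0 k :=
  ⟨word k w, h.word_mem_h0 k⟩

@[elab_as_elim]
theorem h0_induction {k : Type*} [CommRing k] {p : h0 k → Prop}
    (word : ∀ w hw, p (word0 k w hw)) (add : ∀ u v, p u → p v → p (u + v))
    (smul : ∀ (c : k) u, p u → p (c • u)) (u : h0 k) : p u := by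
  have h1 : p (one0 k) := word [] (.inl rfl)
  let q : Submodule k (h0 k) :=
    { carrier := {u | p u}
      add_mem' := fun {u v} => add u v
      zero_mem' := by simpa using smul 0 _ h1
      smul_mem' := smul }
  let f : H k →ₗ[k] h0 k := (LinearMap.mulLeft k (ltr k .x) ∘ₗ
    LinearMap.mulRight k (ltr k .y)).codRestrict (h0 k) fun v => xhy_le_h0 (mem_xhy.2 ⟨v, rfl⟩)
  obtain ⟨u, hu⟩ := u
  obtain ⟨c, v, rfl⟩ := mem_h0.1 hu
  have hf : f v ∈ q := linear_mem f q (fun w => by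
    have : f (TMZV.word k w) = word0 k _ (.inr ⟨w, rfl⟩) := Subtype.ext (word_x_y w)
    rw [this]
    exact word _ _) v
  exact q.add_mem (q.smul_mem c h1) hf

/-- Multiplicativity is a bilinear condition, so it suffices on words; this lets double shuffle
relations pass to a larger base ring. -/
theorem map_bilin_eq_mul {k A : Type*} [CommRing k] [CommRing A] [Algebra k A] (ζ : h0 k →ₗ[k] A)
    (B : H k →ₗ[k] H k →ₗ[k] H k) (hB : ∀ u v : h0 k, B u.1 v.1 ∈ h0 k)
    (h : ∀ v w hv hw, ζ ⟨B (word0 k v hv).1 (word0 k w hw).1, hB _ _⟩ =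
      ζ (word0 k v hv) * ζ (word0 k w hw)) (u v : h0 k) :
    ζ ⟨B u.1 v.1, hB u v⟩ = ζ u * ζ v := by
  induction u using h0_induction with
  | word u' hu' =>
    induction v using h0_induction with
    | word v' hv' => exact h _ _ _ _
    | add v v' hv hv' =>
      rw [map_add, mul_add, ← hv, ← hv', ← map_add]
      exact congrArg _ (Subtype.ext (map_add (B _) _ _))
    | smul c v hv =>
      rw [map_smul, mul_smul_comm, ← hv, ← map_smul]
      exact congrArg _ (Subtype.ext (map_smul (B _) _ _))
  | add u u' hu hu' =>
    rw [map_add, add_mul, ← hu, ← hu', ← map_add]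
    exact congrArg _ (Subtype.ext (LinearMap.map_add₂ B _ _ _))
  | smul c u hu =>
    rw [map_smul, smul_mul_assoc, ← hu, ← map_smul]
    exact congrArg _ (Subtype.ext (LinearMap.map_smul₂ B _ _ _))

variable (k k' : Type*) [CommRing k] [CommRing k'] [Algebra k k']

/-- The extension of scalars `k⟨x, y⟩ → k'⟨x, y⟩`. -/
def baseChange : H k →ₐ[k] H k' := FreeAlgebra.lift k (ltr k')

@[simp] theorem baseChange_ltr (a : Letter) : baseChange k k' (ltr k a) = ltr k' a :=
  FreeAlgebra.lift_ι_apply _ _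

@[simp] theorem baseChange_word (w : List Letter) : baseChange k k' (word k w) = word k' w := by
  induction w with
  | nil => simp
  | cons a w ih => simp [ih]

@[simp] theorem baseChange_z (n : ℕ) : baseChange k k' (z k n) = z k' n := by simp [z]

@[simp] theorem baseChange_zWord (l : List ℕ) : baseChange k k' (zWord k l) = zWord k' l := by
  simp [zWord, map_list_prod, Function.comp_def]

theorem baseChange_mem_h0 {u : H k} (hu : u ∈ h0 k) : baseChange k k' u ∈ h0 k' := by
  obtain ⟨c, v, rfl⟩ := mem_h0.1 hu
  refine mem_h0.2 ⟨algebraMap k k' c, baseChange k k' v, ?_⟩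
  simp only [map_add, map_smul, map_mul, map_one, baseChange_ltr]
  rfl

/-- The extension of scalars on `𝔥⁰`. -/
def baseChange0 (u : h0 k) : h0 k' := ⟨baseChange k k' u, baseChange_mem_h0 k k' u.2⟩

/-- At `t = 0` the recursion has integer coefficients, so it commutes with extension of scalars. -/
theorem baseChange_shuffleWord : ∀ u v : List Letter,
    baseChange k k' (shuffleWord 0 u v) = shuffleWord 0 u v
  | [], v => by simp [shuffleWord]
  | a :: u, [] => by simp [shuffleWord]
  | a :: u, b :: v => by
      rw [shuffleWord, shuffleWord]
      simp [rhoLetter_zero, baseChange_shuffleWord u (b :: v), baseChange_shuffleWord (a :: u) v]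
  termination_by u v => u.length + v.length

theorem baseChange_stuffleIndex : ∀ u v : List ℕ,
    baseChange k k' (stuffleIndex 0 u v) = stuffleIndex 0 u v
  | [], v => by simp [stuffleIndex]
  | a :: u, [] => by simp [stuffleIndex]
  | a :: u, b :: v => by
      rw [stuffleIndex, stuffleIndex]
      simp [baseChange_stuffleIndex u (b :: v), baseChange_stuffleIndex (a :: u) v,
        baseChange_stuffleIndex u v]
  termination_by u v => u.length + v.length

theorem baseChange_derWord (n : ℕ) (w : List Letter) :
    baseChange k k' (derWord n w) = derWord n w := by
  induction w with
  | nil => simp [derWord]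
  | cons a w ih => cases a <;> simp [derWord, derLetter, ih]

theorem baseChange0_word0 {w : List Letter} (h : Admissible w) :
    baseChange0 k k' (word0 k w h) = word0 k' w h := Subtype.ext (baseChange_word k k' w)

theorem baseChange0_shuffle0 {v w : List Letter} (hv : Admissible v) (hw : Admissible w) :
    baseChange0 k k' (shuffle0 0 (word0 k v hv) (word0 k w hw)) =
      shuffle0 0 (word0 k' v hv) (word0 k' w hw) := by
  apply Subtype.ext
  simp [baseChange0, shuffle0, word0, shuffle, baseChange_shuffleWord]

theorem baseChange0_stuffle0 {v w : List Letter} (hv : Admissible v) (hw : Admissible w) :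
    baseChange0 k k' (stuffle0 0 (word0 k v hv) (word0 k w hw)) =
      stuffle0 0 (word0 k' v hv) (word0 k' w hw) := by
  apply Subtype.ext
  simp [baseChange0, stuffle0, word0, stuffle, baseChange_stuffleIndex, hv.endsY, hw.endsY]

theorem baseChange0_der0 (n : ℕ) {w : List Letter} (h : Admissible w) :
    baseChange0 k k' (der0 n (word0 k w h)) = der0 n (word0 k' w h) := by
  apply Subtype.ext
  simp [baseChange0, der0, word0, der, baseChange_derWord]

theorem baseChange0_z0 {n : ℕ} (hn : 2 ≤ n) : baseChange0 k k' (z0 k n hn) = z0 k' n hn :=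
  Subtype.ext (baseChange_z k k' n)

theorem baseChange0_add (u v : h0 k) :
    baseChange0 k k' (u + v) = baseChange0 k k' u + baseChange0 k k' v :=
  Subtype.ext (map_add (baseChange k k') (u : H k) v)

theorem baseChange0_smul (c : k) (u : h0 k) :
    baseChange0 k k' (c • u) = algebraMap k k' c • baseChange0 k k' u :=
  Subtype.ext (map_smul (baseChange k k') c (u : H k))

end BaseChange

/-! ### From `K` to `K[t]` and conclusion -/

section PolynomialExtension

attribute [local instance] Polynomial.algebra

variable {K R : Type*} [Field K] [CommRing R] [Algebra K R] {Z : h0 K →ₗ[K] R}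

theorem Zext_baseChange0 (u : h0 K) : Zext Z (baseChange0 K K[X] u) = C (Z u) := by
  refine h0_induction (fun w hw => ?_) (fun u v hu hv => ?_) (fun c u hu => ?_) u
  · rw [baseChange0_word0]
    simp [Zext, word0, hw.word_mem_h0 K]
  · rw [baseChange0_add, map_add, hu, hv, map_add, C_add]
  · rw [baseChange0_smul, map_smul, hu, map_smul, Algebra.smul_def, Algebra.smul_def c, C_mul]
    congr 1
    exact Polynomial.map_C _

theorem DoubleShuffle.finiteDoubleShuffle (hZ : DoubleShuffle Z) : FiniteDoubleShuffle Z :=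
  ⟨hZ.map_one, hZ.shuffle, hZ.stuffle⟩

theorem finiteDoubleShuffle_Zext (hZ : DoubleShuffle Z) : FiniteDoubleShuffle (Zext Z) := by
  refine ⟨?_, map_bilin_eq_mul _ (shuffle 0) (fun u v => shuffle_mem_h0 0 u.2 v.2) fun v w hv hw => ?_,
    map_bilin_eq_mul _ (stuffle 0) (fun u v => stuffle_mem_h0 0 u.2 v.2) fun v w hv hw => ?_⟩
  · have : one0 K[X] = baseChange0 K K[X] (one0 K) := Subtype.ext (map_one (baseChange K K[X])).symm
    rw [this, Zext_baseChange0, hZ.map_one, C_1]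
  · change Zext Z (shuffle0 0 _ _) = _
    rw [← baseChange0_shuffle0 K, ← baseChange0_word0 K K[X] hv,
      ← baseChange0_word0 K K[X] hw, Zext_baseChange0,
      Zext_baseChange0, Zext_baseChange0, hZ.shuffle, C_mul]
  · change Zext Z (stuffle0 0 _ _) = _
    rw [← baseChange0_stuffle0 K, ← baseChange0_word0 K K[X] hv,
      ← baseChange0_word0 K K[X] hw, Zext_baseChange0,
      Zext_baseChange0, Zext_baseChange0, hZ.stuffle, C_mul]

/-- Both conditions are linear and hence tested on words, where the two values differ only by the
injective map `R → R[t]`. -/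
theorem Zext_der0_iff (n : ℕ) :
    (∀ w, Zext Z (der0 n w) = 0) ↔ ∀ w, Z (der0 n w) = 0 := by
  have key : ∀ w hw, Zext Z (der0 n (word0 K[X] w hw)) = C (Z (der0 n (word0 K w hw))) :=
    fun w hw => by rw [← baseChange0_der0 K, Zext_baseChange0]
  constructor <;> intro h w <;>
    refine h0_induction (fun w hw => ?_) (fun u v hu hv => ?_) (fun c u hu => ?_) w
  · exact C_eq_zero.1 ((key w hw).symm.trans (h _))
  · rw [map_add, map_add, hu, hv, add_zero]
  · rw [map_smul, map_smul, hu, smul_zero]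
  · rw [key, h, C_0]
  · rw [map_add, map_add, hu, hv, add_zero]
  · rw [map_smul, map_smul, hu, smul_zero]

variable [CharZero K]

theorem isExpSeries_Zext : IsExpSeries (Zext Z) ((expSeries Z).map C) where
  coeff_zero := by
    rw [PowerSeries.coeff_map, (isExpSeries_expSeries Z).coeff_zero, C_1]
  eulerDer := by
    rw [eulerDer_map, (isExpSeries_expSeries Z).eulerDer, map_mul]
    congr 1
    ext1 n
    rw [PowerSeries.coeff_map, zetaSeries, zetaSeries, PowerSeries.coeff_mk, PowerSeries.coeff_mk]
    split_ifs with hn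
    · rw [← baseChange0_z0 K K[X], Zext_baseChange0]
      simp
    · exact C_0

/-- The equivalences at `t = 0` are used over `K` here and over `K[t]` for the interpolated
conditions; the derivation condition is the bridge between the two base rings. -/
theorem extendedDoubleShuffle_iff (hZ : DoubleShuffle Z) :
    ExtendedDoubleShuffle Z ↔ ∀ n, 1 ≤ n → ∀ w, Zext Z (der0 n w) = 0 := by
  have h := (comparison_tfae (isExpSeries_expSeries Z) (isRegHom_shuffle hZ.finiteDoubleShuffle)
    (isRegHom_stuffle hZ.finiteDoubleShuffle)).out 1 7
  simp only [Zext_der0_iff]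
  exact ⟨fun hE => h.1 hE.comparison, fun hE => ⟨hZ, h.2 hE⟩⟩

end PolynomialExtension

end TMZV

end

theorem mainTheorem1 {K R : Type*} [Field K] [CharZero K] [CommRing R] [Algebra K R]
    (Z : TMZV.h0 K →ₗ[K] R) (hZ : TMZV.DoubleShuffle Z) :
    List.TFAE [
      -- (0)
      TMZV.ExtendedDoubleShuffle Z,
      -- (1)
      ∀ w₁ : TMZV.h1 K[X], TMZV.Ztsh Z w₁ - TMZV.rhoT Z (TMZV.Ztst Z w₁) = 0,
      -- (2)
      ∀ w₁ : TMZV.h1 K[X], (TMZV.Ztsh Z w₁ - TMZV.rhoT Z (TMZV.Ztst Z w₁)).eval 0 = 0,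
      -- (3)
      ∀ (w₁ : TMZV.h1 K[X]) (w₀ : TMZV.h0 K[X]),
        TMZV.Ztsh Z (TMZV.shuffle1 X w₁ (TMZV.incl _ w₀) -
          TMZV.stuffle1 X w₁ (TMZV.incl _ w₀)) = 0,
      -- (3')
      ∀ (w₁ : TMZV.h1 K[X]) (w₀ : TMZV.h0 K[X]),
        TMZV.Ztst Z (TMZV.shuffle1 X w₁ (TMZV.incl _ w₀) -
          TMZV.stuffle1 X w₁ (TMZV.incl _ w₀)) = 0,
      -- (4)
      ∀ (w₁ : TMZV.h1 K[X]) (w₀ : TMZV.h0 K[X]),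
        TMZV.Zt Z (TMZV.reg (TMZV.shuffle1 X) (TMZV.shuffle1 X w₁ (TMZV.incl _ w₀) -
          TMZV.stuffle1 X w₁ (TMZV.incl _ w₀))) = 0,
      -- (4')
      ∀ (w₁ : TMZV.h1 K[X]) (w₀ : TMZV.h0 K[X]),
        TMZV.Zt Z (TMZV.reg (TMZV.stuffle1 X) (TMZV.shuffle1 X w₁ (TMZV.incl _ w₀) -
          TMZV.stuffle1 X w₁ (TMZV.incl _ w₀))) = 0,
      -- (5)
      ∀ m : ℕ, 1 ≤ m → ∀ w₀ : TMZV.h0 K[X],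
        TMZV.Zt Z (TMZV.reg (TMZV.shuffle1 X)
          (TMZV.shuffle1 X (TMZV.yPow _ m) (TMZV.incl _ w₀) -
            TMZV.stuffle1 X (TMZV.yPow _ m) (TMZV.incl _ w₀))) = 0,
      -- (5')
      ∀ m : ℕ, 1 ≤ m → ∀ w₀ : TMZV.h0 K[X],
        TMZV.Zt Z (TMZV.reg (TMZV.stuffle1 X)
          (TMZV.shuffle1 X (TMZV.yPow _ m) (TMZV.incl _ w₀) -
            TMZV.stuffle1 X (TMZV.yPow _ m) (TMZV.incl _ w₀))) = 0,
      -- (6)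
      ∀ n : ℕ, 1 ≤ n → ∀ w₀ : TMZV.h0 K[X], TMZV.Zt Z (TMZV.derT X n w₀) = 0,
      -- (7)
      ∀ (m : ℕ) (w₀ : TMZV.h0 K[X]),
        TMZV.Zt Z (TMZV.sigmaT X m w₀ - TMZV.sigmaBarT X m w₀) = 0] := by
  let _ : Algebra K[X] R[X] := Polynomial.algebra K R
  rw [TMZV.extendedDoubleShuffle_iff hZ]
  exact TMZV.interpolated_tfae (TMZV.finiteDoubleShuffle_Zext hZ) TMZV.isExpSeries_Zext X
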